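/- Let $d \ge 1$, $r > 0$, and let $\mathcal X \subset [0,r]^d$ be compact and convex. Let $k$ be a stationary kernel on $\mathcal X$ with $k(x,x) = 1$ for all $x \in \mathcal X$, and let $f \sim \mathcal{GP}(0,k)$ be a centered Gaussian process on $\mathcal X$ with covariance $k$ whose sample paths are almost surely differentiable on $\mathcal X$. Assume that there are constants $a, b > 0$ such that $$\Pr\Bigl(\sup_{x \in \mathcal X}\Bigl|\frac{\partial f}{\partial x_j}(x)\Bigr| > L\Bigr) \le a \exp\bigl(-(L/b)^2\bigr) \qquad \text{for all } L > 0 \text{ and } j \in \{1,\dots,d\}.$$ For $t \ge 1$ put $$s_t := 2d \log\Bigl(b d r t^2 \bigl(\sqrt{\log(ad)} + \sqrt{\pi}/2\bigr)\Bigr) - 2\log 2,$$ where $ad \ge 1$ and $s_t \ge 0$ for all $t \ge 1$ (so that all square roots here and below are real). Let $\sigma > 0$, let $\epsilon_1, \epsilon_2, \dots$ be i.i.d. $\mathcal N(0,\sigma^2)$, and let $\zeta_1, \zeta_2, \dots$ be independent, where $\zeta_t$ has the two-parameter exponential distribution with shift $s_t$ and rate $\lambda = 1/2$, i.e. the law of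 $s_t + Z$ with $Z \sim \mathrm{Exp}(1/2)$; let $f$, $(\epsilon_t)_t$ and $(\zeta_t)_t$ be mutually independent. Run IRGP-UCB: for $t = 1, 2, \dots$, $$x_t \in \operatorname*{argmax}_{x \in \mathcal X}\; \mu_{t-1}(x) + \zeta_t^{1/2}\,\sigma_{t-1}(x), \qquad y_t = f(x_t) + \epsilon_t,$$ with ties broken by a measurable rule depending only on $(x_i,y_i)_{i<t}$ and $\zeta_1,\dots,\zeta_t$, where $\mu_{t-1}$ and $\sigma_{t-1}$ are the Gaussian process posterior mean and standard deviation given the data $(x_i,y_i)_{i<t}$: $$\mu_{t-1}(x) = \mathbf k_{t-1}(x)^\top(\mathbf K + \sigma^2 \mathbf I)^{-1}\mathbf y_{t-1}, \qquad \sigma_{t-1}^2(x) = k(x,x) - \mathbf k_{t-1}(x)^\top(\mathbf K + \sigma^2 \mathbf I)^{-1}\mathbf k_{t-1}(x),$$ with $\mathbf k_{t-1}(x) = (k(x,x_i))_{i<t}$, $\mathbf K = (k(x_i,x_j))_{i,j<t}$ and $\mathbf y_{t-1} = (y_i)_{i<t}$. Let $x^* \in \operatorname{argmax}_{x\in\mathcal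 X} f(x)$ and, for $T \ge 1$, $$\mathrm{BCR}_T := \mathbb E\Bigl[\sum_{t=1}^T f(x^*) - f(x_t)\Bigr], \qquad \gamma_T := \sup_{a_1,\dots,a_T \in \mathcal X} I\bigl((f(a_i) + \epsilon_i)_{i=1}^T;\ (f(a_i))_{i=1}^T\bigr),$$ where $I$ is the Shannon mutual information. Then, for every $T \ge 1$, $\gamma_T$ is finite, the regret $\sum_{t=1}^T f(x^*) - f(x_t)$ is integrable, and $$\mathrm{BCR}_T \le \frac{\pi^2}{6} + \sqrt{C_1\, T\, \gamma_T\, (2 + s_T)}, \qquad C_1 := \frac{2}{\log(1 + \sigma^{-2})}.$$ -/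

import Mathlib

open MeasureTheory ProbabilityTheory
open scoped ENNReal Matrix

noncomputable section

namespace BayesOpt

/-! ### Gaussian process prior -/

section Prior

variable {Ω : Type*} [MeasurableSpace Ω] {d : ℕ}

/-- `k` is stationary on `X`: `k x y` depends only on `x - y`. -/
def IsStationaryOn (X : Set (EuclideanSpace ℝ (Fin d)))
    (k : EuclideanSpace ℝ (Fin d) → EuclideanSpace ℝ (Fin d) → ℝ) : Prop :=
  ∃ κ : EuclideanSpace ℝ (Fin d) → ℝ, ∀ x ∈ X, ∀ y ∈ X, k x y = κ (x - y)

/-- `f` restricted to the domain `X` is a Gaussian process with zero mean and covariance `k`.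
The values `f x ω` for `x ∉ X` are irrelevant. -/
structure IsCenteredGP (μ : Measure Ω) (X : Set (EuclideanSpace ℝ (Fin d)))
    (k : EuclideanSpace ℝ (Fin d) → EuclideanSpace ℝ (Fin d) → ℝ)
    (f : EuclideanSpace ℝ (Fin d) → Ω → ℝ) : Prop where
  measurable : ∀ x ∈ X, Measurable (f x)
  gaussian : IsGaussianProcess (fun (x : X) (ω : Ω) => f x ω) μ
  mean_eq : ∀ x ∈ X, ∫ ω, f x ω ∂μ = 0
  cov_eq : ∀ x ∈ X, ∀ y ∈ X, covariance (f x) (f y) μ = k x y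

/-- Almost every sample path is differentiable on `X`, with gradient `g x ω` at `x`, and for every
coordinate `j` one has `P (sup_{x ∈ X} |∂f/∂x_j| > L) ≤ a exp (-(L/b)²)` for all `L > 0`.
Differentiability is taken within `X`, so that only values of `f` on `X` matter; if `X` has nonempty
interior, the gradient is unique (and is the usual one at interior points). -/
def HasSubGaussianDerivatives (μ : Measure Ω) (X : Set (EuclideanSpace ℝ (Fin d)))
    (f : EuclideanSpace ℝ (Fin d) → Ω → ℝ) (a b : ℝ) : Prop :=
  ∃ g : EuclideanSpace ℝ (Fin d) → Ω → EuclideanSpace ℝ (Fin d),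
    (∀ᵐ ω ∂μ, ∀ x ∈ X, HasGradientWithinAt (fun z => f z ω) (g x ω) X x) ∧
    ∀ j : Fin d, ∀ L : ℝ, 0 < L →
      μ {ω | ∃ x ∈ X, L < |g x ω j|} ≤ ENNReal.ofReal (a * Real.exp (-(L / b) ^ 2))

end Prior

/-! ### Posterior mean and standard deviation -/

section Posterior

variable {E : Type*}

/-- `K + σ² I` for the query points `p 0, …, p (n-1)`. -/
def noisyGram (k : E → E → ℝ) (σ : ℝ) {n : ℕ} (p : Fin n → E) : Matrix (Fin n) (Fin n) ℝ :=
  Matrix.of (fun i j => k (p i) (p j)) + σ ^ 2 • (1 : Matrix (Fin n) (Fin n) ℝ)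

/-- Posterior mean at `z` given the data `(p i, y i)`, `i < n`. -/
def postMean (k : E → E → ℝ) (σ : ℝ) {n : ℕ} (p : Fin n → E) (y : Fin n → ℝ) (z : E) : ℝ :=
  (fun i => k z (p i)) ⬝ᵥ ((noisyGram k σ p)⁻¹ *ᵥ y)

/-- Posterior variance at `z` given the query points `p i`, `i < n`. -/
def postVar (k : E → E → ℝ) (σ : ℝ) {n : ℕ} (p : Fin n → E) (z : E) : ℝ :=
  k z z - (fun i => k z (p i)) ⬝ᵥ ((noisyGram k σ p)⁻¹ *ᵥ (fun i => k z (p i)))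

/-- Posterior standard deviation. -/
def postStd (k : E → E → ℝ) (σ : ℝ) {n : ℕ} (p : Fin n → E) (z : E) : ℝ :=
  Real.sqrt (postVar k σ p z)

end Posterior

/-! ### The algorithm -/

/-- The two-parameter exponential distribution: the law of `s + Z` with `Z ∼ Exp(rate)`. -/
def twoParamExp (s rate : ℝ) : Measure ℝ := (expMeasure rate).map (fun z => s + z)

section Run

variable {Ω : Type*} [MeasurableSpace Ω] {d : ℕ}

/-- The noisy observation `y_t = f(x_t) + ε_t`. -/
def obs (f : EuclideanSpace ℝ (Fin d) → Ω → ℝ) (ε : ℕ → Ω → ℝ)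
    (x : ℕ → Ω → EuclideanSpace ℝ (Fin d)) (t : ℕ) (ω : Ω) : ℝ :=
  f (x t ω) ω + ε t ω

/-- A run of IRGP-UCB with confidence shifts `s` and rate `1/2`. Time in the code starts at `0`: the
index `n` is the iteration number `n + 1`, at which `n` data points are available and the
confidence parameter has the shift `s (n + 1)`. -/
structure IsIRGPUCBRun (μ : Measure Ω) (X : Set (EuclideanSpace ℝ (Fin d)))
    (k : EuclideanSpace ℝ (Fin d) → EuclideanSpace ℝ (Fin d) → ℝ) (σ : ℝ) (s : ℕ → ℝ)
    (f : EuclideanSpace ℝ (Fin d) → Ω → ℝ) (ε ζ : ℕ → Ω → ℝ)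
    (x : ℕ → Ω → EuclideanSpace ℝ (Fin d)) : Prop where
  noise_measurable : ∀ n, Measurable (ε n)
  /-- The noise is i.i.d. `N(0, σ²)`. -/
  noise_law : ∀ n, μ.map (ε n) = gaussianReal 0 (σ ^ 2).toNNReal
  noise_indep : iIndepFun ε μ
  zeta_measurable : ∀ n, Measurable (ζ n)
  /-- The confidence parameters are independent, two-parameter exponential. -/
  zeta_law : ∀ n, μ.map (ζ n) = twoParamExp (s (n + 1)) (1 / 2)
  zeta_indep : iIndepFun ζ μ
  /-- `f`, the noise sequence and the confidence parameters are mutually independent. -/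
  noise_indep_f : IndepFun (fun ω (z : X) => f z ω) (fun ω n => ε n ω) μ
  zeta_indep_f_noise :
    IndepFun (fun ω => ((fun z : X => f z ω), (fun n => ε n ω))) (fun ω n => ζ n ω) μ
  /-- Each query is a measurable function of the past data `(x_i, y_i)` and of the confidence
  parameters drawn so far (this only restricts how ties in the argmax are broken). -/
  query_rule : ∀ n, ∃ φ : (Fin n → EuclideanSpace ℝ (Fin d) × ℝ) × (Fin (n + 1) → ℝ) →
      EuclideanSpace ℝ (Fin d), Measurable φ ∧
    ∀ ω, x n ω = φ (fun i => (x i ω, obs f ε x i ω), fun i => ζ i ω)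
  query_mem : ∀ n ω, x n ω ∈ X
  /-- Each query maximizes the randomized upper confidence bound over `X`. -/
  query_max : ∀ n ω, IsMaxOn
    (fun z => postMean k σ (fun i : Fin n => x i ω) (fun i : Fin n => obs f ε x i ω) z +
      Real.sqrt (ζ n ω) * postStd k σ (fun i : Fin n => x i ω) z) X (x n ω)

end Run

/-! ### Maximum information gain -/

section Information

variable {Ω : Type*} [MeasurableSpace Ω]

/-- Shannon mutual information: the Kullback-Leibler divergence of the joint law from the product
of the marginal laws. -/
def mutualInfo {S S' : Type*} [MeasurableSpace S] [MeasurableSpace S'] (μ : Measure Ω)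
    (Y : Ω → S) (Z : Ω → S') : ℝ≥0∞ :=
  InformationTheory.klDiv (μ.map (fun ω => (Y ω, Z ω))) ((μ.map Y).prod (μ.map Z))

/-- The maximum information gain: the supremum over `T` points `A 0, …, A (T-1)` of `X` (repetitions
allowed) of the mutual information between the noisy values `f(A i) + ε i` and the
values `f(A i)`. -/
def maxInfoGain {E : Type*} (μ : Measure Ω) (X : Set E) (f : E → Ω → ℝ) (ε : ℕ → Ω → ℝ)
    (T : ℕ) : ℝ≥0∞ :=
  ⨆ A : Fin T → X, mutualInfo μ (fun ω (i : Fin T) => f (A i) ω + ε i ω)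
    (fun ω (i : Fin T) => f (A i) ω)

end Information

/-- `s_t = 2 d log (b d r t² (√(log (a d)) + √π / 2)) - 2 log 2`. -/
def shift (d : ℕ) (a b r : ℝ) (t : ℕ) : ℝ :=
  2 * d * Real.log (b * d * r * (t : ℝ) ^ 2 *
    (Real.sqrt (Real.log (a * d)) + Real.sqrt Real.pi / 2)) - 2 * Real.log 2

end BayesOpt

end

/-!
The regret of step `t` is compared with the randomized upper confidence bound on a finite net of the
domain that depends on `t` only.

*Discretization.* Off a null set, all increments of a path are controlled by the maximum of its
gradient, so the sub-Gaussian tail of the derivatives bounds the mean loss from replacing the maximum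
over the domain by the maximum over a net (`HasSubGaussianDerivatives.lintegral_le`). The shift `s_t`
is exactly such that a net with at most `2 exp (s_t / 2)` points achieves a mean loss of at most
`1 / t²` (`exists_resolution`, `exists_net`); these losses sum to at most `π² / 6`.

*Randomization.* For a net of that size, a union bound over centered Gaussian tails, each of size at
most `exp (-c / 2) / 2`, shows that the square of the largest normalized deviation of the process
from its posterior mean is stochastically dominated by the two-parameter exponential `ζ_t`. Hence,
conditionally on the data, the mean of the maximum of the process over the net is at most the mean of
the maximum of the confidence bounds (`lintegral_sup_gaussian_le`, `lintegral_sup_le_ucbMax`), which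
the query point maximizes over the whole domain. As the process is centered around its posterior mean
at the query point (`integrable_deviation`), the mean regret of step `t` is at most
`1 / t² + E[√ζ_t σ_{t-1}(x_t)]` (`integral_regret_step_le`).

*Adaptive data.* Conditioning on the data is done by a change of measure: the joint law of the
process and of the data has the Gaussian likelihood as its density with respect to the product of
the law of the process with a reference measure (`IsAdaptiveRun.exists_lintegral_runData`). In that
formula the query points are fixed, and for fixed query points the process reweighted by the
likelihood is Gaussian with the posterior mean and variance
(`IsNoisyGP.map_withDensity_likelihood`). No conditional distributions are needed. The function is
treated as a random element of the space of continuous paths, after modification on a null set, so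
that evaluation at a random point is measurable (`IsIRGPUCBRun.isAdaptiveRun`).

*Summation.* By the Cauchy-Schwarz inequality the remaining sum is at most
`√(∑ E ζ_t) √(E ∑ σ_{t-1}(x_t)²)`, where `E ζ_t = 2 + s_t ≤ 2 + s_T`. The mutual information of the
values at `T` points and their noisy observations is `∑ log (1 + σ_{t-1}² / σ²) / 2`
(`IsNoisyGP.mutualInfo_eq`), so that concavity of the logarithm bounds the second sum by
`C₁ γ_T` for every realization of the query points (`IsNoisyGP.sum_postVar_le`).
-/

namespace BayesOpt

open scoped NNReal
open Filter Topology

/-! ### Densities of Gaussian noise vectors -/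

theorem lintegral_fin_prod {n : ℕ} {f : Fin n → ℝ → ℝ≥0∞} (hf : ∀ i, Measurable (f i)) :
    ∫⁻ y : Fin n → ℝ, ∏ i, f i (y i) = ∏ i, ∫⁻ t, f i t := by
  induction n with
  | zero => simp [lintegral_unique, volume_pi]
  | succ n ih =>
    have h := (volume_preserving_piFinSuccAbove (fun _ : Fin (n + 1) => ℝ) (Fin.last n)).symm
    have hm : Measurable fun y : Fin (n + 1) → ℝ => ∏ i, f i (y i) :=
      Finset.measurable_prod _ fun i _ => (hf i).comp (measurable_pi_apply i)
    rw [← h.lintegral_comp hm, Fin.prod_univ_castSucc, ← ih fun i => hf i.castSucc, mul_comm]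
    have h1 : Measurable fun y : Fin n → ℝ => ∏ i : Fin n, f i.castSucc (y i) :=
      Finset.measurable_prod _ fun i _ => (hf i.castSucc).comp (measurable_pi_apply i)
    rw [← lintegral_prod_mul (hf (Fin.last n)).aemeasurable h1.aemeasurable]
    refine lintegral_congr fun z => ?_
    rw [Fin.prod_univ_castSucc, mul_comm]
    simp [MeasurableEquiv.piFinSuccAbove, Fin.insertNthEquiv]

theorem pi_gaussianReal_eq_withDensity {n : ℕ} {v : ℝ≥0} (hv : v ≠ 0) :
    Measure.pi (fun _ : Fin n => gaussianReal 0 v) =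
      (volume : Measure (Fin n → ℝ)).withDensity fun y => ∏ i, gaussianPDF 0 v (y i) := by
  refine (Measure.pi_eq fun s hs => ?_)
  rw [withDensity_apply _ (MeasurableSet.univ_pi hs), ← lintegral_indicator (MeasurableSet.univ_pi hs)]
  have : ∀ y : Fin n → ℝ, (Set.univ.pi s).indicator (fun y => ∏ i, gaussianPDF 0 v (y i)) y =
      ∏ i, (s i).indicator (gaussianPDF 0 v) (y i) := by
    intro y
    by_cases hy : y ∈ Set.univ.pi s
    · rw [Set.indicator_of_mem hy]
      exact Finset.prod_congr rfl fun i _ => by rw [Set.indicator_of_mem (hy i trivial)]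
    · rw [Set.indicator_of_notMem hy]
      simp only [Set.mem_univ_pi, not_forall] at hy
      obtain ⟨i, hi⟩ := hy
      exact (Finset.prod_eq_zero (Finset.mem_univ i) (Set.indicator_of_notMem hi _)).symm
  simp_rw [this]
  rw [lintegral_fin_prod fun i => (measurable_gaussianPDF 0 v).indicator (hs i)]
  refine Finset.prod_congr rfl fun i _ => ?_
  rw [lintegral_indicator (hs i), gaussianReal_apply _ hv]

/-- The likelihood of the observations `y` for the noise variance `v` when the noiseless values
are `u`. -/
noncomputable def likelihood (v : ℝ≥0) {n : ℕ} (y u : Fin n → ℝ) : ℝ≥0∞ :=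
  ∏ i, gaussianPDF 0 v (y i - u i)

theorem continuous_gaussianPDF (m : ℝ) (v : ℝ≥0) : Continuous (gaussianPDF m v) := by
  unfold gaussianPDF gaussianPDFReal
  exact ENNReal.continuous_ofReal.comp (by fun_prop)

theorem continuous_likelihood (v : ℝ≥0) {n : ℕ} :
    Continuous fun q : (Fin n → ℝ) × (Fin n → ℝ) => likelihood v q.1 q.2 := by
  unfold likelihood gaussianPDF
  have : ∀ q : (Fin n → ℝ) × (Fin n → ℝ), ∏ i, ENNReal.ofReal (gaussianPDFReal 0 v (q.1 i - q.2 i))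
      = ENNReal.ofReal (∏ i, gaussianPDFReal 0 v (q.1 i - q.2 i)) := fun q =>
    (ENNReal.ofReal_prod_of_nonneg fun i _ => gaussianPDFReal_nonneg _ _ _).symm
  simp_rw [this]
  unfold gaussianPDFReal
  exact ENNReal.continuous_ofReal.comp (by fun_prop)

theorem measurable_likelihood (v : ℝ≥0) {n : ℕ} {α : Type*} [MeasurableSpace α]
    {y u : α → Fin n → ℝ} (hy : Measurable y) (hu : Measurable u) :
    Measurable fun q => likelihood v (y q) (u q) :=
  Finset.measurable_prod _ fun i _ => (measurable_gaussianPDF 0 v).comp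
    (((measurable_pi_apply i).comp hy).sub ((measurable_pi_apply i).comp hu))

theorem gaussianPDF_le (m : ℝ) (v : ℝ≥0) (t : ℝ) :
    gaussianPDF m v t ≤ ENNReal.ofReal (√(2 * Real.pi * v))⁻¹ := by
  refine ENNReal.ofReal_le_ofReal ?_
  rw [gaussianPDFReal]
  refine mul_le_of_le_one_right (by positivity) (Real.exp_le_one_iff.2 ?_)
  rw [neg_div]
  exact neg_nonpos.2 (by positivity)

theorem likelihood_le (v : ℝ≥0) {n : ℕ} (y u : Fin n → ℝ) :
    likelihood v y u ≤ ENNReal.ofReal (√(2 * Real.pi * v))⁻¹ ^ n := by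
  refine (Finset.prod_le_prod' fun i _ => gaussianPDF_le 0 v _).trans ?_
  simp

theorem likelihood_pos {v : ℝ≥0} (hv : v ≠ 0) {n : ℕ} (y u : Fin n → ℝ) :
    0 < likelihood v y u :=
  pos_iff_ne_zero.2 (Finset.prod_ne_zero_iff.2 fun _ _ => (gaussianPDF_pos 0 hv _).ne')

/-- Adding independent Gaussian noise `e` to `U` gives a random vector whose conditional law has
the likelihood as its density with respect to Lebesgue measure. -/
theorem lintegral_add_noise {Ω α : Type*} [MeasurableSpace Ω] [MeasurableSpace α] {μ : Measure Ω}
    [IsProbabilityMeasure μ] {n : ℕ} {v : ℝ≥0} (hv : v ≠ 0)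
    {U e : Ω → Fin n → ℝ} {V : Ω → α} (hU : Measurable U) (hV : Measurable V) (he : Measurable e)
    (he_law : μ.map e = Measure.pi fun _ => gaussianReal 0 v)
    (h_indep : IndepFun (fun ω => (U ω, V ω)) e μ)
    {Ψ : (Fin n → ℝ) → α → ℝ≥0∞} (hΨ : Measurable fun q : (Fin n → ℝ) × α => Ψ q.1 q.2) :
    ∫⁻ ω, Ψ (U ω + e ω) (V ω) ∂μ =
      ∫⁻ y, ∫⁻ ω, likelihood v y (U ω) * Ψ y (V ω) ∂μ := by
  have hUV : Measurable fun ω => (U ω, V ω) := hU.prodMk hV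
  have h1 := (indepFun_iff_map_prod_eq_prod_map_map hUV.aemeasurable he.aemeasurable).1 h_indep
  have hm : Measurable fun q : ((Fin n → ℝ) × α) × (Fin n → ℝ) => Ψ (q.1.1 + q.2) q.1.2 :=
    hΨ.comp (f := fun q : ((Fin n → ℝ) × α) × (Fin n → ℝ) => (q.1.1 + q.2, q.1.2)) (by fun_prop)
  have hd : Measurable fun y : Fin n → ℝ => ∏ i, gaussianPDF 0 v (y i) :=
    Finset.measurable_prod _ fun i _ => (measurable_gaussianPDF 0 v).comp (measurable_pi_apply i)
  calc ∫⁻ ω, Ψ (U ω + e ω) (V ω) ∂μ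
      = ∫⁻ q, Ψ (q.1.1 + q.2) q.1.2 ∂(μ.map fun ω => ((U ω, V ω), e ω)) := by
        rw [lintegral_map hm (hUV.prodMk he)]
    _ = ∫⁻ q, ∫⁻ z, Ψ (q.1 + z) q.2 ∂(μ.map e) ∂(μ.map fun ω => (U ω, V ω)) := by
        have := Measure.isProbabilityMeasure_map (μ := μ) he.aemeasurable
        rw [h1, lintegral_prod _ hm.aemeasurable]
    _ = ∫⁻ ω, ∫⁻ z, Ψ (U ω + z) (V ω) ∂(μ.map e) ∂μ := by
        have := Measure.isProbabilityMeasure_map (μ := μ) he.aemeasurable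
        rw [lintegral_map hm.lintegral_prod_right' hUV]
    _ = ∫⁻ ω, (∫⁻ y, likelihood v y (U ω) * Ψ y (V ω)) ∂μ := by
        refine lintegral_congr fun ω => ?_
        have hs : Measurable fun z => Ψ (U ω + z) (V ω) :=
          hΨ.comp ((measurable_const.add measurable_id).prodMk measurable_const)
        rw [he_law, pi_gaussianReal_eq_withDensity hv, lintegral_withDensity_eq_lintegral_mul _ hd hs,
          ← lintegral_sub_right_eq_self _ (U ω)]
        simp [likelihood]
    _ = _ := by
        have hm' : Measurable fun q : Ω × (Fin n → ℝ) => likelihood v q.2 (U q.1) * Ψ q.2 (V q.1) :=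
          (measurable_likelihood v measurable_snd (hU.comp measurable_fst)).mul
            (hΨ.comp (measurable_snd.prodMk (hV.comp measurable_fst)))
        rw [lintegral_lintegral_swap
          (f := fun ω y => likelihood v y (U ω) * Ψ y (V ω)) hm'.aemeasurable]

/-! ### The posterior of a Gaussian process at fixed query points -/

/-- `F` is a centered Gaussian process with covariance `k`, observed in independent Gaussian noise
`ε` of variance `σ ^ 2`. -/
structure IsNoisyGP {Ω E : Type*} [MeasurableSpace Ω] (μ : Measure Ω) (k : E → E → ℝ) (σ : ℝ)
    (F : E → Ω → ℝ) (ε : ℕ → Ω → ℝ) : Prop where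
  sigma_pos : 0 < σ
  measurable : ∀ z, Measurable (F z)
  gaussian : IsGaussianProcess F μ
  mean_eq : ∀ z, ∫ ω, F z ω ∂μ = 0
  cov_eq : ∀ z w, covariance (F z) (F w) μ = k z w
  noise_measurable : ∀ n, Measurable (ε n)
  noise_law : ∀ n, μ.map (ε n) = gaussianReal 0 (σ ^ 2).toNNReal
  noise_indep : iIndepFun ε μ
  indep : IndepFun (fun ω z => F z ω) (fun ω n => ε n ω) μ

namespace IsNoisyGP

variable {Ω E : Type*} [MeasurableSpace Ω] {μ : Measure Ω} {k : E → E → ℝ} {σ : ℝ}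
  {F : E → Ω → ℝ} {ε : ℕ → Ω → ℝ} {n : ℕ}

theorem var_ne_zero (h : IsNoisyGP μ k σ F ε) : (σ ^ 2).toNNReal ≠ 0 :=
  (Real.toNNReal_pos.2 (pow_pos h.sigma_pos 2)).ne'

theorem isProbabilityMeasure (h : IsNoisyGP μ k σ F ε) : IsProbabilityMeasure μ :=
  h.gaussian.isProbabilityMeasure

theorem hasGaussianLaw_noise (h : IsNoisyGP μ k σ F ε) (n : ℕ) : HasGaussianLaw (ε n) μ :=
  ⟨by rw [h.noise_law]; infer_instance⟩

theorem memLp (h : IsNoisyGP μ k σ F ε) (z : E) : MemLp (F z) 2 μ :=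
  (h.gaussian.hasGaussianLaw_eval z).memLp_two

theorem memLp_noise (h : IsNoisyGP μ k σ F ε) (n : ℕ) : MemLp (ε n) 2 μ :=
  (h.hasGaussianLaw_noise n).memLp_two

theorem integral_noise (h : IsNoisyGP μ k σ F ε) (n : ℕ) : ∫ ω, ε n ω ∂μ = 0 := by
  have := integral_map (μ := μ) (f := fun x : ℝ => x) (h.noise_measurable n).aemeasurable
    (by fun_prop)
  rw [h.noise_law] at this
  simpa using this.symm

theorem variance_noise (h : IsNoisyGP μ k σ F ε) (n : ℕ) : variance (ε n) μ = σ ^ 2 := by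
  have := variance_map (μ := μ) (X := fun x : ℝ => x) (by fun_prop)
    (h.noise_measurable n).aemeasurable
  rw [h.noise_law, variance_fun_id_gaussianReal, Real.coe_toNNReal _ (sq_nonneg σ)] at this
  exact this.symm

theorem cov_noise (h : IsNoisyGP μ k σ F ε) (i j : ℕ) :
    covariance (ε i) (ε j) μ = if i = j then σ ^ 2 else 0 := by
  split_ifs with hij
  · rw [hij, covariance_self (h.noise_measurable j).aemeasurable, h.variance_noise]
  · have := h.isProbabilityMeasure
    exact (h.noise_indep.indepFun hij).covariance_eq_zero (h.memLp_noise i) (h.memLp_noise j)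

theorem indepFun_noise (h : IsNoisyGP μ k σ F ε) (z : E) (n : ℕ) : IndepFun (F z) (ε n) μ :=
  h.indep.comp (measurable_pi_apply z) (measurable_pi_apply n)

theorem cov_apply_noise (h : IsNoisyGP μ k σ F ε) (z : E) (n : ℕ) :
    covariance (F z) (ε n) μ = 0 := by
  have := h.isProbabilityMeasure
  exact (h.indepFun_noise z n).covariance_eq_zero (h.memLp z) (h.memLp_noise n)

theorem symm (h : IsNoisyGP μ k σ F ε) (z w : E) : k z w = k w z := by
  rw [← h.cov_eq, ← h.cov_eq, covariance_comm]

theorem posSemidef_gram (h : IsNoisyGP μ k σ F ε) (p : Fin n → E) :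
    (Matrix.of fun i j => k (p i) (p j)).PosSemidef := by
  have := h.isProbabilityMeasure
  refine Matrix.PosSemidef.of_dotProduct_mulVec_nonneg ?_ fun x => ?_
  · ext i j
    simp [h.symm (p j) (p i)]
  · have h1 : covariance (fun ω => ∑ i, x i * F (p i) ω) (fun ω => ∑ i, x i * F (p i) ω) μ =
        star x ⬝ᵥ (Matrix.of fun i j => k (p i) (p j)) *ᵥ x := by
      rw [covariance_fun_sum_fun_sum (fun i => (h.memLp (p i)).const_mul _)
        (fun i => (h.memLp (p i)).const_mul _)]
      simp only [dotProduct, Matrix.mulVec, Finset.mul_sum, Matrix.of_apply, star_trivial]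
      refine Finset.sum_congr rfl fun i _ => Finset.sum_congr rfl fun j _ => ?_
      rw [covariance_const_mul_left, covariance_const_mul_right, h.cov_eq]
      ring
    rw [← h1, covariance_self]
    · exact variance_nonneg _ _
    · exact (Finset.measurable_sum _ fun i _ =>
        (h.measurable (p i)).const_mul (x i)).aemeasurable

theorem posDef_noisyGram (h : IsNoisyGP μ k σ F ε) (p : Fin n → E) :
    (noisyGram k σ p).PosDef :=
  Matrix.PosDef.posSemidef_add (h.posSemidef_gram p)
    (Matrix.PosDef.one.smul (pow_pos h.sigma_pos 2))

/-- The coefficients of the observations in the posterior mean. -/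
noncomputable def _root_.BayesOpt.postCoeff (k : E → E → ℝ) (σ : ℝ) (p : Fin n → E) (z : E) :
    Fin n → ℝ :=
  (fun i => k z (p i)) ᵥ* (noisyGram k σ p)⁻¹

theorem _root_.BayesOpt.postMean_eq_sum (k : E → E → ℝ) (σ : ℝ) (p : Fin n → E) (y : Fin n → ℝ)
    (z : E) : postMean k σ p y z = ∑ i, postCoeff k σ p z i * y i := by
  rw [postMean, Matrix.dotProduct_mulVec, postCoeff, dotProduct]

theorem sum_postCoeff_mul (h : IsNoisyGP μ k σ F ε) (p : Fin n → E) (z : E) (j : Fin n) :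
    ∑ i, postCoeff k σ p z i * noisyGram k σ p i j = k z (p j) := by
  have hu : IsUnit (noisyGram k σ p).det :=
    (Matrix.isUnit_iff_isUnit_det _).1 (h.posDef_noisyGram p).isUnit
  have : postCoeff k σ p z ᵥ* noisyGram k σ p = fun i => k z (p i) := by
    rw [postCoeff, Matrix.vecMul_vecMul, Matrix.nonsing_inv_mul _ hu, Matrix.vecMul_one]
  exact congrFun this j

theorem postVar_le (h : IsNoisyGP μ k σ F ε) (p : Fin n → E) (z : E) :
    postVar k σ p z ≤ k z z := by
  have := (h.posDef_noisyGram p).inv.posSemidef.dotProduct_mulVec_nonneg (fun i => k z (p i))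
  rw [star_trivial] at this
  exact sub_le_self _ this

/-- The observation of the value at `p i`. -/
def _root_.BayesOpt.fixedObs (F : E → Ω → ℝ) (ε : ℕ → Ω → ℝ) (p : Fin n → E) (ω : Ω) (i : Fin n) :
    ℝ :=
  F (p i) ω + ε i ω

theorem measurable_fixedObs (h : IsNoisyGP μ k σ F ε) (p : Fin n → E) :
    Measurable (fixedObs F ε p) :=
  measurable_pi_lambda _ fun i => (h.measurable (p i)).add (h.noise_measurable i)

theorem memLp_fixedObs (h : IsNoisyGP μ k σ F ε) (p : Fin n → E) (i : Fin n) :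
    MemLp (fun ω => fixedObs F ε p ω i) 2 μ :=
  (h.memLp (p i)).add (h.memLp_noise i)

theorem cov_apply_fixedObs (h : IsNoisyGP μ k σ F ε) (p : Fin n → E) (z : E) (j : Fin n) :
    covariance (F z) (fun ω => fixedObs F ε p ω j) μ = k z (p j) := by
  have := h.isProbabilityMeasure
  have := covariance_add_right (h.memLp z) (h.memLp (p j)) (h.memLp_noise j)
  rw [h.cov_eq, h.cov_apply_noise, add_zero] at this
  exact this

theorem cov_fixedObs (h : IsNoisyGP μ k σ F ε) (p : Fin n → E) (i j : Fin n) :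
    covariance (fun ω => fixedObs F ε p ω i) (fun ω => fixedObs F ε p ω j) μ =
      noisyGram k σ p i j := by
  have := h.isProbabilityMeasure
  have h1 := covariance_add_left (h.memLp (p i)) (h.memLp_noise i) (h.memLp_fixedObs p j)
  have h2 := covariance_add_right (h.memLp_noise i) (h.memLp (p j)) (h.memLp_noise j)
  rw [h.cov_noise, covariance_comm (ε i) (F (p j)), h.cov_apply_noise] at h2
  rw [h.cov_apply_fixedObs] at h1
  refine h1.trans ?_
  have h3 : covariance (ε i) (fun ω => fixedObs F ε p ω j) μ =
    0 + if (i : ℕ) = j then σ ^ 2 else 0 := h2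
  rw [h3]
  simp [noisyGram, Matrix.one_apply, Fin.ext_iff]

/-- The error of the posterior mean at `z`, given the observations at the points `p i`. -/
noncomputable def _root_.BayesOpt.residual (k : E → E → ℝ) (σ : ℝ) (F : E → Ω → ℝ) (ε : ℕ → Ω → ℝ)
    (p : Fin n → E) (z : E) (ω : Ω) : ℝ :=
  F z ω - postMean k σ p (fixedObs F ε p ω) z

theorem hasGaussianLaw_residual_prodMk (h : IsNoisyGP μ k σ F ε) (p : Fin n → E) (z : E) :
    HasGaussianLaw (fun ω => (fun _ : Unit => residual k σ F ε p z ω, fixedObs F ε p ω)) μ := by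
  classical
  have hF : HasGaussianLaw (fun ω => (F z ω, fun i => F (p i) ω)) μ := by
    let L : ((insert z (Finset.univ.image p) : Finset E) → ℝ) →L[ℝ] ℝ × (Fin n → ℝ) :=
      { toFun x := (x ⟨z, by simp⟩, fun i => x ⟨p i, by simp⟩)
        map_add' x y := by ext <;> simp
        map_smul' m x := by ext <;> simp }
    exact (h.gaussian.hasGaussianLaw _).map L
  have he : HasGaussianLaw (fun ω (i : Fin n) => ε i ω) μ :=
    iIndepFun.hasGaussianLaw (fun i : Fin n => h.hasGaussianLaw_noise i)
      (h.noise_indep.precomp Fin.val_injective)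
  have hi : IndepFun (fun ω => (F z ω, fun i => F (p i) ω)) (fun ω (i : Fin n) => ε i ω) μ :=
    h.indep.comp (φ := fun u : E → ℝ => (u z, fun i => u (p i)))
      (ψ := fun (u : ℕ → ℝ) (i : Fin n) => u i) (by fun_prop) (by fun_prop)
  let L : (ℝ × (Fin n → ℝ)) × (Fin n → ℝ) →L[ℝ] (Unit → ℝ) × (Fin n → ℝ) :=
    { toFun x := (fun _ => x.1.1 - ∑ i, postCoeff k σ p z i * (x.1.2 i + x.2 i), x.1.2 + x.2)
      map_add' x y := by
        ext
        · simp only [Prod.fst_add, Prod.snd_add, Pi.add_apply, mul_add, Finset.sum_add_distrib]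
          ring
        · simp only [Prod.fst_add, Prod.snd_add, Pi.add_apply]
          ring
      map_smul' m x := by
        ext
        · simp only [Prod.smul_fst, Prod.smul_snd, Pi.smul_apply, smul_eq_mul, RingHom.id_apply,
            mul_sub, Finset.mul_sum]
          congr 1
          exact Finset.sum_congr rfl fun i _ => by ring
        · simp only [Prod.smul_fst, Prod.smul_snd, Pi.smul_apply, smul_eq_mul, RingHom.id_apply,
            Pi.add_apply]
          ring }
  have hL : (fun ω => (fun _ : Unit => residual k σ F ε p z ω, fixedObs F ε p ω)) =
      L ∘ fun ω => ((F z ω, fun i => F (p i) ω), fun i : Fin n => ε i ω) := by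
    funext ω
    refine Prod.ext (funext fun _ => ?_) rfl
    simp [L, residual, postMean_eq_sum, fixedObs]
  rw [hL]
  exact (IndepFun.hasGaussianLaw hF he hi).map L

theorem measurable_residual (h : IsNoisyGP μ k σ F ε) (p : Fin n → E) (z : E) :
    Measurable (residual k σ F ε p z) := by
  have hs : residual k σ F ε p z = fun ω => F z ω -
      ∑ i, postCoeff k σ p z i * fixedObs F ε p ω i :=
    funext fun ω => by rw [residual, postMean_eq_sum]
  rw [hs]
  exact (h.measurable z).sub (Finset.measurable_sum _ fun i _ =>
    ((measurable_pi_apply i).comp (h.measurable_fixedObs p)).const_mul _)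

theorem hasGaussianLaw_residual (h : IsNoisyGP μ k σ F ε) (p : Fin n → E) (z : E) :
    HasGaussianLaw (residual k σ F ε p z) μ :=
  (h.hasGaussianLaw_residual_prodMk p z).fst.eval ()

theorem covariance_residual_left (h : IsNoisyGP μ k σ F ε) (p : Fin n → E) (z : E) {G : Ω → ℝ}
    (hG : MemLp G 2 μ) :
    covariance (residual k σ F ε p z) G μ = covariance (F z) G μ -
      ∑ i, postCoeff k σ p z i * covariance (fun ω => fixedObs F ε p ω i) G μ := by
  have := h.isProbabilityMeasure
  have hs : residual k σ F ε p z = fun ω => F z ω -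
      ∑ i, postCoeff k σ p z i * fixedObs F ε p ω i :=
    funext fun ω => by rw [residual, postMean_eq_sum]
  have hi := fun i => (h.memLp_fixedObs p i).const_mul (postCoeff k σ p z i)
  rw [hs, covariance_fun_sub_left (h.memLp z) (memLp_finsetSum _ fun i _ => hi i) hG,
    covariance_fun_sum_left hi hG]
  simp_rw [covariance_const_mul_left]

theorem covariance_residual_fixedObs (h : IsNoisyGP μ k σ F ε) (p : Fin n → E) (z : E)
    (j : Fin n) :
    covariance (residual k σ F ε p z) (fun ω => fixedObs F ε p ω j) μ = 0 := by
  rw [h.covariance_residual_left p z (h.memLp_fixedObs p j), h.cov_apply_fixedObs]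
  simp_rw [h.cov_fixedObs]
  rw [h.sum_postCoeff_mul, sub_self]

/-- The residual is Gaussian and uncorrelated with the observations, hence independent of them. -/
theorem indepFun_residual (h : IsNoisyGP μ k σ F ε) (p : Fin n → E) (z : E) :
    IndepFun (residual k σ F ε p z) (fixedObs F ε p) μ := by
  have := HasGaussianLaw.indepFun_of_covariance_eval
    (X := fun (_ : Unit) => residual k σ F ε p z) (Y := fun i ω => fixedObs F ε p ω i)
    (h.hasGaussianLaw_residual_prodMk p z) fun _ j => h.covariance_residual_fixedObs p z j
  exact this.comp (φ := fun u : Unit → ℝ => u ()) (ψ := id) (by fun_prop) measurable_id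

theorem variance_residual (h : IsNoisyGP μ k σ F ε) (p : Fin n → E) (z : E) :
    variance (residual k σ F ε p z) μ = postVar k σ p z := by
  have := h.isProbabilityMeasure
  have hR := (h.hasGaussianLaw_residual p z).memLp_two
  have h0 : covariance (residual k σ F ε p z) (residual k σ F ε p z) μ =
      covariance (residual k σ F ε p z) (F z) μ := by
    rw [covariance_comm, h.covariance_residual_left p z hR, covariance_comm]
    simp_rw [covariance_comm _ (residual k σ F ε p z), h.covariance_residual_fixedObs]
    simp
  rw [← covariance_self (h.measurable_residual p z).aemeasurable, h0,
    h.covariance_residual_left p z (h.memLp z), h.cov_eq, postVar, Matrix.dotProduct_mulVec,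
    ← postCoeff, dotProduct]
  simp_rw [covariance_comm _ (F z), h.cov_apply_fixedObs]

theorem integral_residual (h : IsNoisyGP μ k σ F ε) (p : Fin n → E) (z : E) :
    ∫ ω, residual k σ F ε p z ω ∂μ = 0 := by
  have := h.isProbabilityMeasure
  have hi : ∀ i, ∫ ω, fixedObs F ε p ω i ∂μ = 0 := fun i => by
    have := integral_add ((h.memLp (p i)).integrable one_le_two)
      ((h.memLp_noise i).integrable one_le_two)
    rw [h.mean_eq, h.integral_noise, add_zero] at this
    exact this
  have hI := fun i => ((h.memLp_fixedObs p i).integrable one_le_two).const_mul (postCoeff k σ p z i)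
  simp only [residual, postMean_eq_sum]
  rw [integral_sub ((h.memLp z).integrable one_le_two) (integrable_finsetSum _ fun i _ => hI i),
    integral_finsetSum _ fun i _ => hI i, h.mean_eq]
  simp_rw [integral_const_mul, hi]
  simp

theorem postVar_nonneg (h : IsNoisyGP μ k σ F ε) (p : Fin n → E) (z : E) :
    0 ≤ postVar k σ p z :=
  h.variance_residual p z ▸ variance_nonneg _ _

theorem map_residual (h : IsNoisyGP μ k σ F ε) (p : Fin n → E) (z : E) :
    μ.map (residual k σ F ε p z) = gaussianReal 0 (postVar k σ p z).toNNReal := by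
  rw [(h.hasGaussianLaw_residual p z).map_eq_gaussianReal, h.integral_residual,
    h.variance_residual]

theorem map_noise (h : IsNoisyGP μ k σ F ε) (n : ℕ) :
    μ.map (fun ω (i : Fin n) => ε i ω) = Measure.pi fun _ => gaussianReal 0 (σ ^ 2).toNNReal := by
  have := h.isProbabilityMeasure
  have hi : iIndepFun (fun i : Fin n => ε i) μ := h.noise_indep.precomp Fin.val_injective
  rw [(iIndepFun_iff_map_fun_eq_pi_map fun i : Fin n => (h.noise_measurable i).aemeasurable).1 hi]
  simp_rw [h.noise_law]

/-- The joint law of the observations and of a random element `V` built from the process. -/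
theorem lintegral_fixedObs (h : IsNoisyGP μ k σ F ε) (p : Fin n → E) {α : Type*}
    [MeasurableSpace α] {φ : (E → ℝ) → α} (hφ : Measurable φ)
    {Ψ : (Fin n → ℝ) → α → ℝ≥0∞} (hΨ : Measurable fun q : (Fin n → ℝ) × α => Ψ q.1 q.2) :
    ∫⁻ ω, Ψ (fixedObs F ε p ω) (φ fun z => F z ω) ∂μ =
      ∫⁻ y, ∫⁻ ω, likelihood (σ ^ 2).toNNReal y (fun i => F (p i) ω) *
        Ψ y (φ fun z => F z ω) ∂μ := by
  have := h.isProbabilityMeasure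
  refine lintegral_add_noise h.var_ne_zero (U := fun ω i => F (p i) ω)
    (V := fun ω => φ fun z => F z ω) (e := fun ω i => ε i ω)
    (measurable_pi_lambda _ fun i => h.measurable (p i))
    (hφ.comp (measurable_pi_lambda _ h.measurable))
    (measurable_pi_lambda _ fun i => h.noise_measurable i) (h.map_noise n) ?_ hΨ
  exact h.indep.comp (φ := fun u : E → ℝ => (fun i => u (p i), φ u))
    (ψ := fun (u : ℕ → ℝ) (i : Fin n) => u i) (by fun_prop) (by fun_prop)

/-- The marginal density of the observations `y` at the points `p i`. -/
noncomputable def _root_.BayesOpt.evidence (μ : Measure Ω) (σ : ℝ) (F : E → Ω → ℝ) (p : Fin n → E)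
    (y : Fin n → ℝ) : ℝ≥0∞ :=
  ∫⁻ ω, likelihood (σ ^ 2).toNNReal y (fun i => F (p i) ω) ∂μ

theorem lintegral_comp_fixedObs (h : IsNoisyGP μ k σ F ε) (p : Fin n → E)
    {ψ : (Fin n → ℝ) → ℝ≥0∞} (hψ : Measurable ψ) :
    ∫⁻ ω, ψ (fixedObs F ε p ω) ∂μ = ∫⁻ y, evidence μ σ F p y * ψ y := by
  rw [h.lintegral_fixedObs p (φ := fun _ => ()) measurable_const (Ψ := fun y _ => ψ y)
    (hψ.comp measurable_fst)]
  refine lintegral_congr fun y => lintegral_mul_const _ ?_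
  exact measurable_likelihood _ measurable_const (measurable_pi_lambda _ fun i => h.measurable _)

theorem continuous_lintegral_likelihood_mul (h : IsNoisyGP μ k σ F ε) (p : Fin n → E)
    {H : Ω → ℝ≥0∞} (hH : Measurable H) {C : ℝ≥0∞} (hC : C ≠ ∞) (hHC : ∀ ω, H ω ≤ C) :
    Continuous fun y =>
      ∫⁻ ω, likelihood (σ ^ 2).toNNReal y (fun i => F (p i) ω) * H ω ∂μ := by
  have := h.isProbabilityMeasure
  refine continuous_iff_continuousAt.2 fun y => ?_
  refine tendsto_lintegral_filter_of_dominated_convergence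
    (fun _ => ENNReal.ofReal (√(2 * Real.pi * (σ ^ 2).toNNReal))⁻¹ ^ n * C) ?_ ?_ ?_ ?_
  · exact Eventually.of_forall fun y => (measurable_likelihood _ measurable_const
      (measurable_pi_lambda _ fun i => h.measurable _)).mul hH
  · exact Eventually.of_forall fun y => ae_of_all _ fun ω =>
      mul_le_mul' (likelihood_le _ _ _) (hHC ω)
  · rw [lintegral_const, measure_univ, mul_one]
    exact ENNReal.mul_ne_top (ENNReal.pow_ne_top ENNReal.ofReal_ne_top) hC
  · refine ae_of_all _ fun ω => ENNReal.Tendsto.mul_const ?_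
      (Or.inr (ne_top_of_le_ne_top hC (hHC ω)))
    exact ((continuous_likelihood _).comp
      (continuous_id.prodMk continuous_const)).tendsto y

theorem evidence_ne_top (h : IsNoisyGP μ k σ F ε) (p : Fin n → E) (y : Fin n → ℝ) :
    evidence μ σ F p y ≠ ∞ := by
  have := h.isProbabilityMeasure
  refine ne_top_of_le_ne_top ?_ (lintegral_mono fun ω => likelihood_le _ _ _)
  rw [lintegral_const, measure_univ, mul_one]
  exact ENNReal.pow_ne_top ENNReal.ofReal_ne_top

theorem continuous_evidence (h : IsNoisyGP μ k σ F ε) (p : Fin n → E) :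
    Continuous (evidence μ σ F p) := by
  have := h.continuous_lintegral_likelihood_mul p (H := fun _ => 1)
    measurable_const ENNReal.one_ne_top fun _ => le_rfl
  simp_rw [mul_one] at this
  exact this

theorem evidence_pos (h : IsNoisyGP μ k σ F ε) (p : Fin n → E) (y : Fin n → ℝ) :
    0 < evidence μ σ F p y := by
  have := h.isProbabilityMeasure
  rw [evidence, lintegral_pos_iff_support (measurable_likelihood _ measurable_const
    (measurable_pi_lambda _ fun i => h.measurable _))]
  have : Function.support (fun ω => likelihood (σ ^ 2).toNNReal y fun i => F (p i) ω) = Set.univ :=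
    Set.eq_univ_of_forall fun ω => (likelihood_pos h.var_ne_zero _ _).ne'
  rw [this]
  simp

theorem continuous_postMean (k : E → E → ℝ) (σ : ℝ) (p : Fin n → E) (z : E) :
    Continuous fun y => postMean k σ p y z := by
  simp only [postMean_eq_sum]
  fun_prop

/-- Bayes' rule: weighting by the likelihood of the observations `y` turns the law of `F z` into
the Gaussian law with the posterior mean and variance, up to the mass given by the evidence. The
two sides agree for almost every `y` by independence of the residual, and then for every `y` by
continuity. -/
theorem map_withDensity_likelihood (h : IsNoisyGP μ k σ F ε) (p : Fin n → E) (y : Fin n → ℝ)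
    (z : E) :
    (μ.withDensity fun ω => likelihood (σ ^ 2).toNNReal y fun i => F (p i) ω).map (F z) =
      evidence μ σ F p y • gaussianReal (postMean k σ p y z) (postVar k σ p z).toNNReal := by
  have := h.isProbabilityMeasure
  have hl : ∀ y, Measurable fun ω => likelihood (σ ^ 2).toNNReal y fun i => F (p i) ω := fun y =>
    measurable_likelihood _ measurable_const (measurable_pi_lambda _ fun i => h.measurable _)
  have hfin : IsFiniteMeasure
      (μ.withDensity fun ω => likelihood (σ ^ 2).toNNReal y fun i => F (p i) ω) :=
    isFiniteMeasure_withDensity (h.evidence_ne_top p y)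
  refine ext_of_forall_lintegral_eq_of_IsFiniteMeasure fun θ => ?_
  obtain ⟨C, hC⟩ : ∃ C : ℝ≥0, ∀ t, θ t ≤ C :=
    ⟨nndist θ 0, BoundedContinuousFunction.NNReal.upper_bound θ⟩
  have hC' : ∀ t, (θ t : ℝ≥0∞) ≤ C := fun t => ENNReal.coe_le_coe.2 (hC t)
  have hθ : Measurable fun t => (θ t : ℝ≥0∞) := by fun_prop
  have hθc : Continuous fun t => (θ t : ℝ≥0∞) :=
    ENNReal.continuous_coe.comp θ.continuous
  have hR := h.measurable_residual p z
  let lhs : (Fin n → ℝ) → ℝ≥0∞ := fun y =>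
    ∫⁻ ω, likelihood (σ ^ 2).toNNReal y (fun i => F (p i) ω) * θ (F z ω) ∂μ
  let mid : (Fin n → ℝ) → ℝ≥0∞ := fun y =>
    ∫⁻ ω, θ (postMean k σ p y z + residual k σ F ε p z ω) ∂μ
  have hlhs : Continuous lhs := h.continuous_lintegral_likelihood_mul p
    (hθ.comp (h.measurable z)) ENNReal.coe_ne_top fun ω => hC' _
  have hmid : Continuous mid := by
    refine continuous_iff_continuousAt.2 fun y => ?_
    refine tendsto_lintegral_filter_of_dominated_convergence (fun _ => (C : ℝ≥0∞))
      (Eventually.of_forall fun y => hθ.comp (hR.const_add _))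
      (Eventually.of_forall fun y => ae_of_all _ fun ω => hC' _) (by simp) ?_
    refine ae_of_all _ fun ω => ?_
    exact (hθc.comp ((continuous_postMean k σ p z).add continuous_const)).tendsto y
  have hmid_le : ∀ y, mid y ≠ ∞ := fun y =>
    ne_top_of_le_ne_top (b := (C : ℝ≥0∞)) ENNReal.coe_ne_top
      ((lintegral_mono fun ω => hC' _).trans (by simp))
  have hrhs : Continuous fun y => evidence μ σ F p y * mid y :=
    continuous_iff_continuousAt.2 fun y => ENNReal.Tendsto.mul
      (h.continuous_evidence p).continuousAt (Or.inr (hmid_le y)) hmid.continuousAt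
      (Or.inr (h.evidence_ne_top p y))
  have key : lhs = fun y => evidence μ σ F p y * mid y := by
    rw [← hlhs.ae_eq_iff_eq (volume : Measure (Fin n → ℝ)) hrhs]
    refine ae_eq_of_forall_setLIntegral_eq_of_sigmaFinite hlhs.measurable hrhs.measurable
      fun s hs _ => ?_
    have hY := h.measurable_fixedObs p
    have hm1 : Measurable fun q : (Fin n → ℝ) × ℝ => s.indicator 1 q.1 * (θ q.2 : ℝ≥0∞) :=
      ((measurable_one.indicator hs).comp measurable_fst).mul (hθ.comp measurable_snd)
    have hm2 : Measurable fun q : (Fin n → ℝ) × ℝ =>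
        s.indicator 1 q.1 * (θ (postMean k σ p q.1 z + q.2) : ℝ≥0∞) :=
      ((measurable_one.indicator hs).comp measurable_fst).mul
        (hθ.comp (((continuous_postMean k σ p z).measurable.comp measurable_fst).add
          measurable_snd))
    have e1 := h.lintegral_fixedObs p (φ := fun u => u z) (measurable_pi_apply z)
      (Ψ := fun y t => s.indicator 1 y * (θ t : ℝ≥0∞)) hm1
    have e2 : ∫⁻ ω, s.indicator 1 (fixedObs F ε p ω) * (θ (F z ω) : ℝ≥0∞) ∂μ =
        ∫⁻ ω, s.indicator 1 (fixedObs F ε p ω) * mid (fixedObs F ε p ω) ∂μ := by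
      have hi := (indepFun_iff_map_prod_eq_prod_map_map hY.aemeasurable hR.aemeasurable).1
        (h.indepFun_residual p z).symm
      have hp1 := Measure.isProbabilityMeasure_map (μ := μ) hR.aemeasurable
      have e3 := lintegral_map (μ := μ) hm2 (hY.prodMk hR)
      rw [hi, lintegral_prod _ hm2.aemeasurable, lintegral_map hm2.lintegral_prod_right' hY] at e3
      refine (Eq.trans ?_ e3.symm).trans ?_
      · refine lintegral_congr fun ω => ?_
        simp [residual]
      · refine lintegral_congr fun ω => ?_
        have hm3 : Measurable fun t => (θ (postMean k σ p (fixedObs F ε p ω) z + t) : ℝ≥0∞) :=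
          hθ.comp (measurable_const_add _)
        dsimp only
        rw [lintegral_const_mul _ hm3, lintegral_map hm3 hR]
    have e4 := h.lintegral_comp_fixedObs p (ψ := fun y => s.indicator 1 y * mid y)
      ((measurable_one.indicator hs).mul hmid.measurable)
    rw [← lintegral_indicator hs, ← lintegral_indicator hs]
    refine Eq.trans ?_ ((e1.symm.trans (e2.trans e4)).trans ?_)
    · refine lintegral_congr fun y => ?_
      by_cases hy : y ∈ s <;> simp [hy, lhs]
    · refine lintegral_congr fun y => ?_
      by_cases hy : y ∈ s <;> simp [hy]
  rw [lintegral_map hθ (h.measurable z), lintegral_withDensity_eq_lintegral_mul _ (hl y)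
    (g := fun ω => (θ (F z ω) : ℝ≥0∞)) (hθ.comp (h.measurable z)), lintegral_smul_measure]
  refine (congrFun key y).trans ?_
  have hg : gaussianReal (postMean k σ p y z) (postVar k σ p z).toNNReal =
      μ.map fun ω => postMean k σ p y z + residual k σ F ε p z ω := by
    have := Measure.map_map (μ := μ) (f := residual k σ F ε p z)
      (g := fun t => postMean k σ p y z + t) (measurable_const_add _) hR
    rw [h.map_residual, gaussianReal_map_const_add, zero_add] at this
    exact this
  rw [hg, lintegral_map hθ (hR.const_add _), smul_eq_mul]

end IsNoisyGP

/-! ### Mutual information of the values and their noisy observations -/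

theorem lintegral_gaussianPDF_sub_gaussianReal (m : ℝ) (v : ℝ≥0) {s : ℝ≥0} (hs : s ≠ 0) (t : ℝ) :
    ∫⁻ u, gaussianPDF 0 s (t - u) ∂gaussianReal m v = gaussianPDF m (v + s) t := by
  have hvs : v + s ≠ 0 := fun h => hs (add_eq_zero.1 h).2
  have hm : Measurable (gaussianPDF 0 s) := measurable_gaussianPDF 0 s
  have hl : Continuous fun t => ∫⁻ u, gaussianPDF 0 s (t - u) ∂gaussianReal m v := by
    refine continuous_iff_continuousAt.2 fun t => ?_
    refine tendsto_lintegral_filter_of_dominated_convergence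
      (fun _ => ENNReal.ofReal (√(2 * Real.pi * s))⁻¹)
      (Eventually.of_forall fun t => hm.comp (measurable_const.sub measurable_id))
      (Eventually.of_forall fun t => ae_of_all _ fun ω => gaussianPDF_le 0 s _)
      (by rw [lintegral_const, measure_univ, mul_one]; exact ENNReal.ofReal_ne_top) ?_
    exact ae_of_all _ fun u => ((continuous_gaussianPDF 0 s).comp
      (continuous_id.sub continuous_const)).tendsto t
  refine congrFun ((hl.ae_eq_iff_eq (volume : Measure ℝ) (continuous_gaussianPDF m (v + s))).1 ?_) t
  refine ae_eq_of_forall_setLIntegral_eq_of_sigmaFinite hl.measurable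
    (measurable_gaussianPDF _ _) fun S hS _ => ?_
  have h1 : ∫⁻ t in S, gaussianPDF m (v + s) t = gaussianReal m (v + s) S :=
    (gaussianReal_apply m hvs S).symm
  have h2 := gaussianReal_conv_gaussianReal (m₁ := m) (m₂ := 0) (v₁ := v) (v₂ := s)
  rw [add_zero] at h2
  have hS1 : Measurable (S.indicator (1 : ℝ → ℝ≥0∞)) := measurable_one.indicator hS
  have hm2 : Measurable fun q : ℝ × ℝ => gaussianPDF 0 s (q.1 - q.2) :=
    hm.comp (measurable_fst.sub measurable_snd)
  rw [h1, ← h2, ← lintegral_indicator_one hS, Measure.lintegral_conv hS1,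
    lintegral_lintegral_swap (f := fun t u => gaussianPDF 0 s (t - u)) hm2.aemeasurable]
  refine lintegral_congr fun u => ?_
  rw [gaussianReal_of_var_ne_zero 0 hs, lintegral_withDensity_eq_lintegral_mul _ hm
    (g := fun y => S.indicator 1 (u + y)) (hS1.comp (measurable_const_add u)),
    ← lintegral_indicator hS]
  refine Eq.trans ?_ (lintegral_sub_right_eq_self
    (gaussianPDF 0 s * fun y => S.indicator 1 (u + y)) u)
  refine lintegral_congr fun t => ?_
  by_cases ht : t ∈ S <;> simp [ht]

theorem log_gaussianPDFReal (m : ℝ) {v : ℝ≥0} (hv : v ≠ 0) (t : ℝ) :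
    Real.log (gaussianPDFReal m v t) =
      -(1 / 2) * Real.log (2 * Real.pi * v) - (t - m) ^ 2 / (2 * v) := by
  have : (0 : ℝ) < v := NNReal.coe_pos.2 (pos_iff_ne_zero.2 hv)
  rw [gaussianPDFReal, Real.log_mul (by positivity) (Real.exp_ne_zero _), Real.log_exp,
    Real.log_inv, Real.log_sqrt (by positivity)]
  ring

namespace IsNoisyGP

variable {Ω E : Type*} [MeasurableSpace Ω] {μ : Measure Ω} {k : E → E → ℝ} {σ : ℝ}
  {F : E → Ω → ℝ} {ε : ℕ → Ω → ℝ}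

/-- The evidence factorizes into the predictive densities of the successive observations. -/
theorem evidence_eq_prod (h : IsNoisyGP μ k σ F ε) (q : ℕ → E) (y : ℕ → ℝ) (n : ℕ) :
    evidence μ σ F (fun i : Fin n => q i) (fun i : Fin n => y i) =
      ∏ i ∈ Finset.range n, gaussianPDF
        (postMean k σ (fun j : Fin i => q j) (fun j : Fin i => y j) (q i))
        ((postVar k σ (fun j : Fin i => q j) (q i)).toNNReal + (σ ^ 2).toNNReal) (y i) := by
  have := h.isProbabilityMeasure
  induction n with
  | zero => simp [evidence, likelihood]
  | succ n ih =>
    have hl : Measurable fun ω => likelihood (σ ^ 2).toNNReal (fun i : Fin n => y i)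
        (fun i : Fin n => F (q i) ω) :=
      measurable_likelihood _ measurable_const (measurable_pi_lambda _ fun i => h.measurable _)
    have hg : Measurable fun u => gaussianPDF 0 (σ ^ 2).toNNReal (y n - u) :=
      (measurable_gaussianPDF _ _).comp (measurable_const.sub measurable_id)
    have h1 := congrArg (fun ν => ∫⁻ u, gaussianPDF 0 (σ ^ 2).toNNReal (y n - u) ∂ν)
      (h.map_withDensity_likelihood (fun i : Fin n => q i) (fun i => y i) (q n))
    simp only [lintegral_smul_measure, smul_eq_mul] at h1
    rw [lintegral_map hg (h.measurable _), lintegral_withDensity_eq_lintegral_mul _ hl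
      (g := fun ω => gaussianPDF 0 (σ ^ 2).toNNReal (y n - F (q n) ω))
      (hg.comp (h.measurable _)), lintegral_gaussianPDF_sub_gaussianReal _ _ h.var_ne_zero,
      ih] at h1
    rw [Finset.prod_range_succ, ← h1, evidence]
    refine lintegral_congr fun ω => ?_
    simp [likelihood, Fin.prod_univ_castSucc]

theorem cov_residual_noise (h : IsNoisyGP μ k σ F ε) {n : ℕ} (p : Fin n → E) (z : E) :
    covariance (residual k σ F ε p z) (ε n) μ = 0 := by
  have := h.isProbabilityMeasure
  rw [h.covariance_residual_left p z (h.memLp_noise n), h.cov_apply_noise, zero_sub, neg_eq_zero]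
  refine Finset.sum_eq_zero fun i _ => ?_
  have := covariance_add_left (h.memLp (p i)) (h.memLp_noise i) (h.memLp_noise n)
  rw [h.cov_apply_noise, h.cov_noise, if_neg i.2.ne, add_zero] at this
  rw [show covariance (fun ω => fixedObs F ε p ω i) (ε n) μ = 0 from this, mul_zero]

/-- The innovation `F z + ε n - postMean`, the error of the prediction of the next observation. -/
theorem integral_innovation_sq (h : IsNoisyGP μ k σ F ε) {n : ℕ} (p : Fin n → E) (z : E) :
    Integrable (fun ω => (residual k σ F ε p z ω + ε n ω) ^ 2) μ ∧
    ∫ ω, (residual k σ F ε p z ω + ε n ω) ^ 2 ∂μ = postVar k σ p z + σ ^ 2 := by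
  have := h.isProbabilityMeasure
  have hR := (h.hasGaussianLaw_residual p z).memLp_two
  have hs : MemLp (residual k σ F ε p z + ε n) 2 μ := hR.add (h.memLp_noise n)
  refine ⟨hs.integrable_sq, ?_⟩
  have h0 : ∫ ω, (residual k σ F ε p z + ε n) ω ∂μ = 0 := by
    simp only [Pi.add_apply]
    rw [integral_add (hR.integrable one_le_two) ((h.memLp_noise n).integrable one_le_two),
      h.integral_residual, h.integral_noise, add_zero]
  have h1 := variance_of_integral_eq_zero hs.aemeasurable h0
  rw [variance_add hR (h.memLp_noise n), h.cov_residual_noise, h.variance_residual,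
    h.variance_noise] at h1
  simpa using h1.symm

/-- The mutual information of the values of the process at `n` points and their noisy observations,
in terms of the successive posterior variances. -/
theorem mutualInfo_eq (h : IsNoisyGP μ k σ F ε) (q : ℕ → E) (n : ℕ) :
    mutualInfo μ (fun ω (i : Fin n) => F (q i) ω + ε i ω) (fun ω (i : Fin n) => F (q i) ω) =
      ENNReal.ofReal (∑ i ∈ Finset.range n,
        1 / 2 * Real.log (1 + postVar k σ (fun j : Fin i => q j) (q i) / σ ^ 2)) := by
  have := h.isProbabilityMeasure
  set s : ℝ≥0 := (σ ^ 2).toNNReal with hs_def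
  have hs : s ≠ 0 := h.var_ne_zero
  have hs' : (s : ℝ) = σ ^ 2 := Real.coe_toNNReal _ (sq_nonneg σ)
  set v : ℕ → ℝ≥0 := fun i => (postVar k σ (fun j : Fin i => q j) (q i)).toNNReal with hv_def
  have hv' : ∀ i, (v i : ℝ) = postVar k σ (fun j : Fin i => q j) (q i) := fun i =>
    Real.coe_toNNReal _ (h.postVar_nonneg _ _)
  have hvs : ∀ i, v i + s ≠ 0 := fun i hi => hs (add_eq_zero.1 hi).2
  set p : Fin n → E := fun i => q i with hp
  set P : Ω → Fin n → ℝ := fun ω i => F (p i) ω with hP_def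
  have hP : Measurable P := measurable_pi_lambda _ fun i => h.measurable _
  have hY : Measurable (fixedObs F ε p) := h.measurable_fixedObs p
  have hYP : Measurable fun ω => (fixedObs F ε p ω, P ω) := hY.prodMk hP
  have hp1 := Measure.isProbabilityMeasure_map (μ := μ) hY.aemeasurable
  have hp2 := Measure.isProbabilityMeasure_map (μ := μ) hP.aemeasurable
  have hp3 := Measure.isProbabilityMeasure_map (μ := μ) hYP.aemeasurable
  -- the density of the joint law with respect to the product of the marginal laws
  let D : (Fin n → ℝ) × (Fin n → ℝ) → ℝ≥0∞ := fun r => likelihood s r.1 r.2 / evidence μ σ F p r.1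
  have hw : Measurable fun r : (Fin n → ℝ) × (Fin n → ℝ) => likelihood s r.1 r.2 :=
    measurable_likelihood s measurable_fst measurable_snd
  have hD : Measurable D := hw.div ((h.continuous_evidence p).measurable.comp measurable_fst)
  have hJ : μ.map (fun ω => (fixedObs F ε p ω, P ω)) =
      ((μ.map (fixedObs F ε p)).prod (μ.map P)).withDensity D := by
    ext S hS
    have hS1 : Measurable (S.indicator (1 : (Fin n → ℝ) × (Fin n → ℝ) → ℝ≥0∞)) :=
      measurable_one.indicator hS
    have hDS : Measurable (S.indicator D) := hD.indicator hS
    rw [withDensity_apply _ hS, ← lintegral_indicator hS, ← lintegral_indicator_one hS,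
      lintegral_map hS1 hYP, lintegral_prod _ hDS.aemeasurable,
      lintegral_map hDS.lintegral_prod_right' hY]
    have e1 := h.lintegral_fixedObs p (φ := fun u i => u (p i)) (by fun_prop)
      (Ψ := fun y u => S.indicator 1 (y, u)) hS1
    have e2 := h.lintegral_comp_fixedObs p (ψ := fun y => ∫⁻ u, S.indicator D (y, u) ∂μ.map P)
      hDS.lintegral_prod_right'
    refine (e1.trans ?_).trans e2.symm
    refine lintegral_congr fun y => ?_
    have hy : Measurable fun u => S.indicator D (y, u) := hDS.comp measurable_prodMk_left
    have hyP : Measurable fun ω => S.indicator D (y, P ω) := hy.comp hP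
    rw [lintegral_map hy hP, ← lintegral_const_mul _ hyP]
    refine lintegral_congr fun ω => ?_
    by_cases hω : (y, P ω) ∈ S
    · rw [Set.indicator_of_mem hω, Set.indicator_of_mem hω]
      simp only [D, Pi.one_apply, mul_one]
      exact (ENNReal.mul_div_cancel (h.evidence_pos p y).ne' (h.evidence_ne_top p y)).symm
    · rw [Set.indicator_of_notMem hω, Set.indicator_of_notMem hω, mul_zero, mul_zero]
  set Q := (μ.map (fixedObs F ε p)).prod (μ.map P) with hQ
  set J := μ.map (fun ω => (fixedObs F ε p ω, P ω)) with hJ_def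
  have hac : J ≪ Q := hJ ▸ withDensity_absolutelyContinuous _ _
  have hllr : llr J Q =ᵐ[J] fun r => Real.log (D r).toReal := by
    refine hac.ae_eq ?_
    have := Measure.rnDeriv_withDensity Q hD
    rw [← hJ] at this
    filter_upwards [this] with r hr
    simp only [llr_def]
    rw [hr]
  -- the logarithm of the density; its quadratic terms are the squared innovations and the squared
  -- noise, normalized by their variances, which cancel in mean
  let T : Ω → ℝ := fun ω => ∑ i ∈ Finset.range n,
    (1 / 2 * Real.log (1 + postVar k σ (fun j : Fin i => q j) (q i) / σ ^ 2) +
      ((residual k σ F ε (fun j : Fin i => q j) (q i) ω + ε i ω) ^ 2 / (2 * (v i + s)) -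
        (ε i ω) ^ 2 / (2 * s)))
  have hs0 : (0 : ℝ) < s := NNReal.coe_pos.2 (pos_iff_ne_zero.2 hs)
  have hT : ∀ ω, Real.log (D (fixedObs F ε p ω, P ω)).toReal = T ω := by
    intro ω
    have he : evidence μ σ F p (fixedObs F ε p ω) = _ :=
      h.evidence_eq_prod q (fun i => F (q i) ω + ε i ω) n
    have hl : likelihood s (fixedObs F ε p ω) (P ω) =
        ∏ i ∈ Finset.range n, gaussianPDF 0 s (ε i ω) := by
      rw [likelihood, ← Fin.prod_univ_eq_prod_range (fun i => gaussianPDF 0 s (ε i ω))]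
      simp [fixedObs, P, p]
    simp only [D]
    rw [he, hl, ENNReal.toReal_div, ENNReal.toReal_prod, ENNReal.toReal_prod]
    simp_rw [toReal_gaussianPDF]
    rw [Real.log_div (Finset.prod_ne_zero_iff.2 fun i _ => (gaussianPDFReal_pos _ _ _ hs).ne')
      (Finset.prod_ne_zero_iff.2 fun i _ => (gaussianPDFReal_pos _ _ _ (hvs i)).ne'),
      Real.log_prod fun i _ => (gaussianPDFReal_pos _ _ _ hs).ne',
      Real.log_prod fun i _ => (gaussianPDFReal_pos _ _ _ (hvs i)).ne',
      ← Finset.sum_sub_distrib]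
    refine Finset.sum_congr rfl fun i _ => ?_
    have hv0 : (0 : ℝ) ≤ v i := NNReal.coe_nonneg _
    rw [log_gaussianPDFReal _ hs, log_gaussianPDFReal _ (hvs i), ← hv', ← hs', NNReal.coe_add]
    have h1 : Real.log (1 + v i / s) =
        Real.log (2 * Real.pi * (v i + s)) - Real.log (2 * Real.pi * s) := by
      rw [← Real.log_div (by positivity) (by positivity)]
      congr 1
      field_simp
      ring
    have h2 : F (q i) ω + ε i ω - postMean k σ (fun j : Fin i => q j)
        (fun j : Fin i => F (q j) ω + ε j ω) (q i) =
        residual k σ F ε (fun j : Fin i => q j) (q i) ω + ε i ω := by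
      simp only [residual]
      rw [show (fixedObs F ε (fun j : Fin i => q j) ω) = fun j : Fin i => F (q j) ω + ε j ω from rfl]
      ring
    rw [h1, h2]
    ring
  have hint1 : ∀ i, Integrable
      (fun ω => (residual k σ F ε (fun j : Fin i => q j) (q i) ω + ε i ω) ^ 2 / (2 * (v i + s))) μ :=
    fun i => (h.integral_innovation_sq (fun j : Fin i => q j) (q i)).1.div_const _
  have hint2 : ∀ i, Integrable (fun ω => (ε i ω) ^ 2 / (2 * s)) μ :=
    fun i => (h.memLp_noise i).integrable_sq.div_const _
  have hε : ∀ i, ∫ ω, (ε i ω) ^ 2 ∂μ = s := fun i => by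
    rw [← variance_of_integral_eq_zero (h.noise_measurable i).aemeasurable (h.integral_noise i),
      h.variance_noise, hs']
  have hterm : ∀ i, Integrable (fun ω =>
      1 / 2 * Real.log (1 + postVar k σ (fun j : Fin i => q j) (q i) / σ ^ 2) +
      ((residual k σ F ε (fun j : Fin i => q j) (q i) ω + ε i ω) ^ 2 / (2 * (v i + s)) -
        (ε i ω) ^ 2 / (2 * s))) μ := fun i =>
    (integrable_const _).add ((hint1 i).sub (hint2 i))
  have hTint : Integrable T μ := integrable_finsetSum _ fun i _ => hterm i
  have hTval : ∫ ω, T ω ∂μ = ∑ i ∈ Finset.range n,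
      1 / 2 * Real.log (1 + postVar k σ (fun j : Fin i => q j) (q i) / σ ^ 2) := by
    rw [integral_finsetSum _ fun i _ => hterm i]
    refine Finset.sum_congr rfl fun i _ => ?_
    have hadd := integral_add (integrable_const (μ := μ)
      (1 / 2 * Real.log (1 + postVar k σ (fun j : Fin i => q j) (q i) / σ ^ 2)))
      ((hint1 i).sub (hint2 i))
    simp only [Pi.sub_apply] at hadd
    rw [hadd, integral_sub (hint1 i) (hint2 i), integral_div, integral_div,
      (h.integral_innovation_sq (fun j : Fin i => q j) (q i)).2, hε, integral_const,
      probReal_univ, one_smul, ← hv', ← hs']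
    have hv0 : (0 : ℝ) ≤ v i := NNReal.coe_nonneg _
    have : (v i + s : ℝ) ≠ 0 := by positivity
    field_simp
    ring
  have hlog : Measurable fun r => Real.log (D r).toReal := hD.ennreal_toReal.log
  have hcomp : (fun r => Real.log (D r).toReal) ∘ (fun ω => (fixedObs F ε p ω, P ω)) = T :=
    funext hT
  have hJint : Integrable (llr J Q) J := by
    refine Integrable.congr ?_ hllr.symm
    rw [hJ_def, integrable_map_measure hlog.aestronglyMeasurable hYP.aemeasurable, hcomp]
    exact hTint
  have hJval : ∫ r, llr J Q r ∂J = ∫ ω, T ω ∂μ := by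
    rw [integral_congr_ae hllr, hJ_def,
      integral_map hYP.aemeasurable hlog.aestronglyMeasurable]
    exact integral_congr_ae (ae_of_all _ hT)
  have hfin : mutualInfo μ (fun ω (i : Fin n) => F (q i) ω + ε i ω)
      (fun ω (i : Fin n) => F (q i) ω) = InformationTheory.klDiv J Q := rfl
  rw [hfin, InformationTheory.klDiv_of_ac_of_integrable hac hJint, hJval, hTval, probReal_univ,
    probReal_univ, add_sub_cancel_right]

end IsNoisyGP

/-! ### Adaptive queries -/

theorem indepFun_prodMk_left {Ω α β γ : Type*} [MeasurableSpace Ω] [MeasurableSpace α]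
    [MeasurableSpace β] [MeasurableSpace γ] {μ : Measure Ω} [IsProbabilityMeasure μ] {A : Ω → α}
    {B : Ω → β} {C : Ω → γ} (hA : Measurable A) (hB : Measurable B) (hC : Measurable C)
    (h1 : IndepFun A (fun ω => (B ω, C ω)) μ) (h2 : IndepFun B C μ) :
    IndepFun (fun ω => (A ω, B ω)) C μ := by
  have hAB : IndepFun A B μ := h1.comp measurable_id measurable_fst
  rw [indepFun_iff_map_prod_eq_prod_map_map hA.aemeasurable (hB.prodMk hC).aemeasurable] at h1
  rw [indepFun_iff_map_prod_eq_prod_map_map hB.aemeasurable hC.aemeasurable] at h2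
  rw [indepFun_iff_map_prod_eq_prod_map_map hA.aemeasurable hB.aemeasurable] at hAB
  rw [indepFun_iff_map_prod_eq_prod_map_map (hA.prodMk hB).aemeasurable hC.aemeasurable]
  have := Measure.isProbabilityMeasure_map (μ := μ) hA.aemeasurable
  have := Measure.isProbabilityMeasure_map (μ := μ) hB.aemeasurable
  have := Measure.isProbabilityMeasure_map (μ := μ) hC.aemeasurable
  have e := Measure.map_map (μ := μ) (f := fun ω => (A ω, (B ω, C ω)))
    (g := MeasurableEquiv.prodAssoc.symm) (MeasurableEquiv.measurable _)
    (hA.prodMk (hB.prodMk hC))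
  rw [hAB]
  refine Eq.trans e.symm ?_
  rw [h1, h2]
  exact (measurePreserving_prodAssoc (μ.map A) (μ.map B) (μ.map C)).symm.map_eq

theorem iIndepFun_indepFun_fin {Ω : Type*} [MeasurableSpace Ω] {μ : Measure Ω}
    {ξ : ℕ → Ω → ℝ} (hξ : iIndepFun ξ μ) (hm : ∀ n, Measurable (ξ n))
    (n : ℕ) : IndepFun (fun ω (i : Fin n) => ξ i ω) (ξ n) μ := by
  have := hξ.indepFun_finset (Finset.range n) {n} (by simp) hm
  exact this.comp (φ := fun (u : Finset.range n → ℝ) (i : Fin n) => u ⟨i, Finset.mem_range.2 i.2⟩)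
    (ψ := fun (u : ({n} : Finset ℕ) → ℝ) => u ⟨n, by simp⟩) (by fun_prop) (by fun_prop)

/-- The data available after `n` queries: query points, confidence parameters, observations. -/
abbrev Data (𝒳 : Type*) (n : ℕ) : Type _ := Fin n → 𝒳 × ℝ × ℝ

/-- Append a query point, a confidence parameter and an observation to the data. -/
def Data.snoc {𝒳 : Type*} {n : ℕ} (D : Data 𝒳 n) (a : 𝒳 × ℝ × ℝ) : Data 𝒳 (n + 1) :=
  Fin.snoc (α := fun _ => 𝒳 × ℝ × ℝ) D a

theorem Data.measurable_snoc {𝒳 : Type*} [MeasurableSpace 𝒳] {n : ℕ} {α : Type*}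
    [MeasurableSpace α] {D : α → Data 𝒳 n} {a : α → 𝒳 × ℝ × ℝ} (hD : Measurable D)
    (ha : Measurable a) : Measurable fun t => (D t).snoc (a t) := by
  refine measurable_pi_lambda _ fun i => ?_
  refine Fin.lastCases ?_ (fun j => ?_) i
  · simpa [Data.snoc] using ha
  · simpa [Data.snoc, Function.comp_def] using (measurable_pi_apply j).comp hD

/-- A run of a procedure which at time `n` queries a random function `g`, through the evaluation map
`ev`, at a point `x n` depending on the past data and on an auxiliary random parameter `ζ n`, and
observes the value `y n` in Gaussian noise `ε n` of variance `v`. -/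
structure IsAdaptiveRun {Ω 𝓖 𝒳 : Type*} [MeasurableSpace Ω] [MeasurableSpace 𝓖]
    [MeasurableSpace 𝒳] (μ : Measure Ω) (ev : 𝓖 → 𝒳 → ℝ) (v : ℝ≥0) (g : Ω → 𝓖)
    (ε ζ y : ℕ → Ω → ℝ) (x : ℕ → Ω → 𝒳) : Prop where
  measurable_ev : Measurable fun q : 𝓖 × 𝒳 => ev q.1 q.2
  measurable : Measurable g
  noise_measurable : ∀ n, Measurable (ε n)
  zeta_measurable : ∀ n, Measurable (ζ n)
  noise_law : ∀ n, μ.map (ε n) = gaussianReal 0 v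
  noise_indep : iIndepFun ε μ
  zeta_indep : iIndepFun ζ μ
  indep_noise : IndepFun g (fun ω n => ε n ω) μ
  indep_zeta : IndepFun (fun ω => (g ω, fun n => ε n ω)) (fun ω n => ζ n ω) μ
  query : ∀ n, ∃ Q : Data 𝒳 n × ℝ → 𝒳, Measurable Q ∧
    ∀ ω, x n ω = Q (fun i => (x i ω, ζ i ω, y i ω), ζ n ω)
  obs_eq : ∀ n, ∀ᵐ ω ∂μ, y n ω = ev (g ω) (x n ω) + ε n ω

/-- The data of a run after `n` queries. -/
def runData {Ω 𝒳 : Type*} (ζ y : ℕ → Ω → ℝ) (x : ℕ → Ω → 𝒳) (n : ℕ) (ω : Ω) : Data 𝒳 n :=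
  fun i => (x i ω, ζ i ω, y i ω)

/-- The likelihood of the data for the function `h`. -/
noncomputable def Data.likelihood {𝓖 𝒳 : Type*} (ev : 𝓖 → 𝒳 → ℝ) (v : ℝ≥0) {n : ℕ} (h : 𝓖)
    (D : Data 𝒳 n) : ℝ≥0∞ :=
  BayesOpt.likelihood v (fun i => (D i).2.2) fun i => ev h (D i).1

namespace IsAdaptiveRun

variable {Ω 𝓖 𝒳 : Type*} [MeasurableSpace Ω] [MeasurableSpace 𝓖] [MeasurableSpace 𝒳]
  {μ : Measure Ω} {ev : 𝓖 → 𝒳 → ℝ} {v : ℝ≥0} {g : Ω → 𝓖}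
  {ε ζ y : ℕ → Ω → ℝ} {x : ℕ → Ω → 𝒳}

theorem measurable_likelihood (h : IsAdaptiveRun μ ev v g ε ζ y x) (n : ℕ) :
    Measurable fun q : 𝓖 × Data 𝒳 n => Data.likelihood ev v q.1 q.2 := by
  refine BayesOpt.measurable_likelihood v ?_ ?_
  · exact measurable_pi_lambda _ fun i =>
      measurable_snd.comp (measurable_snd.comp ((measurable_pi_apply i).comp measurable_snd))
  · exact measurable_pi_lambda _ fun i => h.measurable_ev.comp
      (measurable_fst.prodMk (measurable_fst.comp ((measurable_pi_apply i).comp measurable_snd)))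

theorem runData_succ_ae (h : IsAdaptiveRun μ ev v g ε ζ y x) {n : ℕ} {Q : Data 𝒳 n × ℝ → 𝒳}
    (hQ : ∀ ω, x n ω = Q (fun i => (x i ω, ζ i ω, y i ω), ζ n ω)) :
    ∀ᵐ ω ∂μ, runData ζ y x (n + 1) ω = (runData ζ y x n ω).snoc
      (Q (runData ζ y x n ω, ζ n ω), ζ n ω,
        ev (g ω) (Q (runData ζ y x n ω, ζ n ω)) + ε n ω) := by
  filter_upwards [h.obs_eq n] with ω hω
  funext i
  refine Fin.lastCases ?_ (fun j => ?_) i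
  · rw [hQ ω] at hω
    simp only [Data.snoc, Fin.snoc_last, runData, Fin.val_last]
    rw [hω, hQ ω]
    rfl
  · simp [Data.snoc, runData]

/-- The data after `n` queries are a function of the queried function and of the noise and the
parameters of the first `n` steps. -/
theorem exists_runData_eq (h : IsAdaptiveRun μ ev v g ε ζ y x) (n : ℕ) :
    ∃ Θ : 𝓖 × (Fin n → ℝ) × (Fin n → ℝ) → Data 𝒳 n, Measurable Θ ∧
      ∀ᵐ ω ∂μ, runData ζ y x n ω = Θ (g ω, fun i => ε i ω, fun i => ζ i ω) := by
  induction n with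
  | zero => exact ⟨fun _ => Fin.elim0, measurable_const,
      ae_of_all _ fun ω => funext fun i => i.elim0⟩
  | succ n ih =>
    obtain ⟨Θ, hΘ, hΘ_eq⟩ := ih
    obtain ⟨Q, hQ, hQ_eq⟩ := h.query n
    let D : 𝓖 × (Fin (n + 1) → ℝ) × (Fin (n + 1) → ℝ) → Data 𝒳 n := fun q =>
      Θ (q.1, fun i => q.2.1 i.castSucc, fun i => q.2.2 i.castSucc)
    have hD : Measurable D := hΘ.comp (by fun_prop)
    let X : 𝓖 × (Fin (n + 1) → ℝ) × (Fin (n + 1) → ℝ) → 𝒳 := fun q =>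
      Q (D q, q.2.2 (Fin.last n))
    have hX : Measurable X := hQ.comp (hD.prodMk (by fun_prop))
    refine ⟨fun q => (D q).snoc (X q, q.2.2 (Fin.last n), ev q.1 (X q) + q.2.1 (Fin.last n)),
      Data.measurable_snoc hD (hX.prodMk (Measurable.prodMk (by fun_prop)
        ((h.measurable_ev.comp (measurable_fst.prodMk hX)).add (by fun_prop)))), ?_⟩
    filter_upwards [hΘ_eq, h.runData_succ_ae hQ_eq] with ω h1 h2
    rw [h2, h1]
    rfl

theorem aemeasurable_runData (h : IsAdaptiveRun μ ev v g ε ζ y x) (n : ℕ) :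
    AEMeasurable (runData ζ y x n) μ := by
  obtain ⟨Θ, hΘ, hΘ_eq⟩ := h.exists_runData_eq n
  exact ⟨_, hΘ.comp (h.measurable.prodMk
    ((measurable_pi_lambda _ fun i : Fin n => h.noise_measurable i).prodMk
      (measurable_pi_lambda _ fun i : Fin n => h.zeta_measurable i))), hΘ_eq⟩

variable [IsProbabilityMeasure μ]

theorem indepFun_zeta (h : IsAdaptiveRun μ ev v g ε ζ y x) (n : ℕ) :
    IndepFun (fun ω => (g ω, runData ζ y x n ω)) (ζ n) μ := by
  obtain ⟨Θ, hΘ, hΘ_eq⟩ := h.exists_runData_eq n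
  have hε : Measurable fun ω m => ε m ω := measurable_pi_lambda _ h.noise_measurable
  have hζ : Measurable fun ω (i : Fin n) => ζ i ω :=
    measurable_pi_lambda _ fun i => h.zeta_measurable i
  have h1 : IndepFun (fun ω => (g ω, fun m => ε m ω)) (fun ω => (fun i : Fin n => ζ i ω, ζ n ω)) μ :=
    h.indep_zeta.comp (φ := id) (ψ := fun u : ℕ → ℝ => (fun i : Fin n => u i, u n))
      measurable_id (by fun_prop)
  have h2 := indepFun_prodMk_left (h.measurable.prodMk hε) hζ (h.zeta_measurable n) h1
    (iIndepFun_indepFun_fin h.zeta_indep h.zeta_measurable n)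
  have h3 := h2.comp (φ := fun q => (q.1.1, Θ (q.1.1, fun i : Fin n => q.1.2 i, q.2))) (ψ := id)
    (by fun_prop) measurable_id
  refine h3.congr ?_ EventuallyEq.rfl
  filter_upwards [hΘ_eq] with ω hω
  simp [hω]

theorem indepFun_noise (h : IsAdaptiveRun μ ev v g ε ζ y x) (n : ℕ) :
    IndepFun (fun ω => ((g ω, runData ζ y x n ω), ζ n ω)) (ε n) μ := by
  obtain ⟨Θ, hΘ, hΘ_eq⟩ := h.exists_runData_eq n
  have hε : Measurable fun ω (i : Fin n) => ε i ω :=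
    measurable_pi_lambda _ fun i => h.noise_measurable i
  have hζ : Measurable fun ω m => ζ m ω := measurable_pi_lambda _ h.zeta_measurable
  have h1 : IndepFun g (fun ω => (fun i : Fin n => ε i ω, ε n ω)) μ :=
    h.indep_noise.comp (φ := id) (ψ := fun u : ℕ → ℝ => (fun i : Fin n => u i, u n))
      measurable_id (by fun_prop)
  have h2 := indepFun_prodMk_left h.measurable hε (h.noise_measurable n) h1
    (iIndepFun_indepFun_fin h.noise_indep h.noise_measurable n)
  have h3 : IndepFun (fun ω m => ζ m ω) (fun ω => ((g ω, fun i : Fin n => ε i ω), ε n ω)) μ :=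
    (h.indep_zeta.comp (φ := fun q : 𝓖 × (ℕ → ℝ) => ((q.1, fun i : Fin n => q.2 i), q.2 n)) (ψ := id)
      (by fun_prop) measurable_id).symm
  have h4 := indepFun_prodMk_left hζ (h.measurable.prodMk hε) (h.noise_measurable n) h3 h2
  have h5 := h4.comp (φ := fun q => ((q.2.1, Θ (q.2.1, q.2.2, fun i : Fin n => q.1 i)), q.1 n))
    (ψ := id) (by fun_prop) measurable_id
  refine h5.congr ?_ EventuallyEq.rfl
  filter_upwards [hΘ_eq] with ω hω
  simp [hω]

theorem lintegral_zeta (h : IsAdaptiveRun μ ev v g ε ζ y x) (n : ℕ)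
    {Ψ : 𝓖 → Data 𝒳 n → ℝ → ℝ≥0∞}
    (hΨ : Measurable fun q : (𝓖 × Data 𝒳 n) × ℝ => Ψ q.1.1 q.1.2 q.2) :
    ∫⁻ ω, Ψ (g ω) (runData ζ y x n ω) (ζ n ω) ∂μ =
      ∫⁻ ω, ∫⁻ z, Ψ (g ω) (runData ζ y x n ω) z ∂(μ.map (ζ n)) ∂μ := by
  have hS : AEMeasurable (fun ω => (g ω, runData ζ y x n ω)) μ :=
    h.measurable.aemeasurable.prodMk (h.aemeasurable_runData n)
  have hz := (h.zeta_measurable n).aemeasurable (μ := μ)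
  have := Measure.isProbabilityMeasure_map hz
  have hi := (indepFun_iff_map_prod_eq_prod_map_map hS hz).1 (h.indepFun_zeta n)
  have e := lintegral_map' hΨ.aemeasurable (hS.prodMk hz)
  rw [hi, lintegral_prod _ hΨ.aemeasurable,
    lintegral_map' hΨ.lintegral_prod_right'.aemeasurable hS] at e
  exact e.symm

theorem lintegral_noise (h : IsAdaptiveRun μ ev v g ε ζ y x) (n : ℕ)
    {Ψ : 𝓖 → Data 𝒳 n → ℝ → ℝ → ℝ≥0∞}
    (hΨ : Measurable fun q : ((𝓖 × Data 𝒳 n) × ℝ) × ℝ => Ψ q.1.1.1 q.1.1.2 q.1.2 q.2) :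
    ∫⁻ ω, Ψ (g ω) (runData ζ y x n ω) (ζ n ω) (ε n ω) ∂μ =
      ∫⁻ ω, ∫⁻ z, ∫⁻ e, Ψ (g ω) (runData ζ y x n ω) z e ∂gaussianReal 0 v ∂(μ.map (ζ n)) ∂μ := by
  have hS : AEMeasurable (fun ω => ((g ω, runData ζ y x n ω), ζ n ω)) μ :=
    (h.measurable.aemeasurable.prodMk (h.aemeasurable_runData n)).prodMk
      (h.zeta_measurable n).aemeasurable
  have he := (h.noise_measurable n).aemeasurable (μ := μ)
  have hi := (indepFun_iff_map_prod_eq_prod_map_map hS he).1 (h.indepFun_noise n)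
  have e := lintegral_map' hΨ.aemeasurable (hS.prodMk he)
  rw [hi, h.noise_law, lintegral_prod _ hΨ.aemeasurable,
    lintegral_map' hΨ.lintegral_prod_right'.aemeasurable hS] at e
  refine e.symm.trans ?_
  exact h.lintegral_zeta n (Ψ := fun a D z => ∫⁻ e, Ψ a D z e ∂gaussianReal 0 v)
    hΨ.lintegral_prod_right'

/-- The joint law of the random function and of the adaptively collected data has the likelihood as
its density with respect to the product of the law of the function and a reference measure on the
data. In this formula the query points are fixed, so that it reduces adaptive to fixed designs. -/
theorem exists_lintegral_runData (h : IsAdaptiveRun μ ev v g ε ζ y x) (hv : v ≠ 0) (n : ℕ) :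
    ∃ ρ : Measure (Data 𝒳 n), SFinite ρ ∧ ∀ Ψ : 𝓖 → Data 𝒳 n → ℝ≥0∞,
      Measurable (fun q : 𝓖 × Data 𝒳 n => Ψ q.1 q.2) →
      ∫⁻ ω, Ψ (g ω) (runData ζ y x n ω) ∂μ =
        ∫⁻ D, ∫⁻ ω, Data.likelihood ev v (g ω) D * Ψ (g ω) D ∂μ ∂ρ := by
  induction n with
  | zero =>
    refine ⟨Measure.dirac Fin.elim0, inferInstance, fun Ψ hΨ => ?_⟩
    have hm : Measurable fun D : Data 𝒳 0 =>
        ∫⁻ ω, Data.likelihood ev v (g ω) D * Ψ (g ω) D ∂μ := by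
      have : Measurable fun q : Data 𝒳 0 × Ω =>
          Data.likelihood ev v (g q.2) q.1 * Ψ (g q.2) q.1 :=
        ((h.measurable_likelihood 0).mul hΨ).comp
          (f := fun q : Data 𝒳 0 × Ω => (g q.2, q.1))
          ((h.measurable.comp measurable_snd).prodMk measurable_fst)
      exact this.lintegral_prod_right'
    rw [lintegral_dirac' _ hm]
    refine lintegral_congr fun ω => ?_
    rw [show runData ζ y x 0 ω = Fin.elim0 from funext fun i => i.elim0]
    simp [Data.likelihood, BayesOpt.likelihood]
  | succ n ih =>
    obtain ⟨ρ, hρ, hρ_eq⟩ := ih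
    obtain ⟨Q, hQ, hQ_eq⟩ := h.query n
    have hz := Measure.isProbabilityMeasure_map (h.zeta_measurable n).aemeasurable (μ := μ)
    -- the new reference measure: the parameter is drawn from its law, the observation is free
    let ext : Data 𝒳 n × (ℝ × ℝ) → Data 𝒳 (n + 1) := fun q =>
      q.1.snoc (Q (q.1, q.2.1), q.2.1, q.2.2)
    have hext : Measurable ext := Data.measurable_snoc measurable_fst
      ((hQ.comp (measurable_fst.prodMk (measurable_fst.comp measurable_snd))).prodMk
        measurable_snd)
    refine ⟨(ρ.prod ((μ.map (ζ n)).prod volume)).map ext, inferInstance, fun Ψ hΨ => ?_⟩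
    let W : Ω × Data 𝒳 (n + 1) → ℝ≥0∞ := fun q =>
      Data.likelihood ev v (g q.1) q.2 * Ψ (g q.1) q.2
    have hW : Measurable W :=
      ((h.measurable_likelihood (n + 1)).mul hΨ).comp
        (f := fun q : Ω × Data 𝒳 (n + 1) => (g q.1, q.2))
        ((h.measurable.comp measurable_fst).prodMk measurable_snd)
    have hev : Measurable fun q : (𝓖 × Data 𝒳 n) × ℝ => ev q.1.1 (Q (q.1.2, q.2)) :=
      h.measurable_ev.comp ((measurable_fst.comp measurable_fst).prodMk
        (hQ.comp ((measurable_snd.comp measurable_fst).prodMk measurable_snd)))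
    let K : ((𝓖 × Data 𝒳 n) × ℝ) × ℝ → ℝ≥0∞ := fun q =>
      Ψ q.1.1.1 (q.1.1.2.snoc (Q (q.1.1.2, q.1.2), q.1.2, ev q.1.1.1 (Q (q.1.1.2, q.1.2)) + q.2))
    have hK : Measurable K :=
      hΨ.comp (f := fun q : ((𝓖 × Data 𝒳 n) × ℝ) × ℝ =>
          (q.1.1.1, q.1.1.2.snoc (Q (q.1.1.2, q.1.2), q.1.2,
            ev q.1.1.1 (Q (q.1.1.2, q.1.2)) + q.2)))
        ((by fun_prop : Measurable fun q : ((𝓖 × Data 𝒳 n) × ℝ) × ℝ => q.1.1.1).prodMk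
          (Data.measurable_snoc (by fun_prop) ((hQ.comp (by fun_prop)).prodMk
            (Measurable.prodMk (by fun_prop) ((hev.comp measurable_fst).add measurable_snd)))))
    let G : (𝓖 × Data 𝒳 n) × (ℝ × ℝ) → ℝ≥0∞ := fun q =>
      gaussianPDF 0 v (q.2.2 - ev q.1.1 (Q (q.1.2, q.2.1))) * Ψ q.1.1 (ext (q.1.2, q.2))
    have hG : Measurable G :=
      ((measurable_gaussianPDF 0 v).comp ((measurable_snd.comp measurable_snd).sub
        (hev.comp (measurable_fst.prodMk (measurable_fst.comp measurable_snd))))).mul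
        (hΨ.comp (f := fun q : (𝓖 × Data 𝒳 n) × (ℝ × ℝ) => (q.1.1, ext (q.1.2, q.2)))
          ((measurable_fst.comp measurable_fst).prodMk
            (hext.comp ((measurable_snd.comp measurable_fst).prodMk measurable_snd))))
    have hGi : Measurable fun q : 𝓖 × Data 𝒳 n =>
        ∫⁻ r, G (q, r) ∂(μ.map (ζ n)).prod volume := hG.lintegral_prod_right'
    have hKG : ∀ q z, ∫⁻ e, K ((q, z), e) ∂gaussianReal 0 v = ∫⁻ t, G (q, (z, t)) := fun q z => by
      have hm : Measurable fun e => K ((q, z), e) := hK.comp measurable_prodMk_left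
      rw [gaussianReal_of_var_ne_zero 0 hv,
        lintegral_withDensity_eq_lintegral_mul _ (measurable_gaussianPDF 0 v) hm,
        ← lintegral_sub_right_eq_self _ (ev q.1 (Q (q.2, z)))]
      simp [K, G, ext]
    have hGW : ∀ ω D r, Data.likelihood ev v (g ω) D * G ((g ω, D), r) = W (ω, ext (D, r)) :=
      fun ω D r => by
        simp only [G, W]
        rw [← mul_assoc]
        congr 1
        simp [Data.likelihood, BayesOpt.likelihood, Fin.prod_univ_castSucc, ext, Data.snoc]
    calc ∫⁻ ω, Ψ (g ω) (runData ζ y x (n + 1) ω) ∂μ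
        = ∫⁻ ω, K (((g ω, runData ζ y x n ω), ζ n ω), ε n ω) ∂μ := by
          refine lintegral_congr_ae ?_
          filter_upwards [h.runData_succ_ae hQ_eq] with ω hω
          rw [hω]
      _ = ∫⁻ ω, ∫⁻ z, ∫⁻ e, K (((g ω, runData ζ y x n ω), z), e)
            ∂gaussianReal 0 v ∂(μ.map (ζ n)) ∂μ :=
          h.lintegral_noise n (Ψ := fun a D z e => K (((a, D), z), e)) hK
      _ = ∫⁻ ω, ∫⁻ r, G ((g ω, runData ζ y x n ω), r) ∂(μ.map (ζ n)).prod volume ∂μ := by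
          refine lintegral_congr fun ω => ?_
          have hm : Measurable fun r => G ((g ω, runData ζ y x n ω), r) :=
            hG.comp measurable_prodMk_left
          rw [lintegral_prod _ hm.aemeasurable]
          exact lintegral_congr fun z => hKG _ z
      _ = ∫⁻ D, ∫⁻ ω, Data.likelihood ev v (g ω) D *
            ∫⁻ r, G ((g ω, D), r) ∂(μ.map (ζ n)).prod volume ∂μ ∂ρ :=
          hρ_eq (fun a D => ∫⁻ r, G ((a, D), r) ∂(μ.map (ζ n)).prod volume) hGi
      _ = ∫⁻ D, ∫⁻ r, ∫⁻ ω, W (ω, ext (D, r)) ∂μ ∂(μ.map (ζ n)).prod volume ∂ρ := by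
          refine lintegral_congr fun D => ?_
          have hm : Measurable fun q : (ℝ × ℝ) × Ω => W (q.2, ext (D, q.1)) :=
            hW.comp (measurable_snd.prodMk (hext.comp (measurable_const.prodMk measurable_fst)))
          rw [lintegral_lintegral_swap (f := fun r ω => W (ω, ext (D, r))) hm.aemeasurable]
          refine lintegral_congr fun ω => ?_
          have hm : Measurable fun r => G ((g ω, D), r) := hG.comp measurable_prodMk_left
          rw [← lintegral_const_mul _ hm]
          exact lintegral_congr fun r => hGW ω D r
      _ = ∫⁻ D, ∫⁻ ω, W (ω, D) ∂μ ∂(ρ.prod ((μ.map (ζ n)).prod volume)).map ext := by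
          have hm : Measurable fun D : Data 𝒳 (n + 1) => ∫⁻ ω, W (ω, D) ∂μ :=
            (hW.comp measurable_swap).lintegral_prod_right'
          have hm' : Measurable fun q => ∫⁻ ω, W (ω, ext q) ∂μ := hm.comp hext
          rw [lintegral_map hm hext, lintegral_prod _ hm'.aemeasurable]

end IsAdaptiveRun

/-! ### Stochastic comparison of a Gaussian maximum with a randomized confidence bound -/

theorem gaussianReal_Ioi_zero_le : gaussianReal 0 1 (Set.Ioi 0) ≤ ENNReal.ofReal (1 / 2) := by
  have h1 : gaussianReal 0 1 (Set.Iio 0) = gaussianReal 0 1 (Set.Ioi 0) := by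
    have h := gaussianReal_map_neg (μ := 0) (v := 1)
    rw [neg_zero] at h
    have h2 := congrArg (fun ν : Measure ℝ => ν (Set.Ioi 0)) h
    beta_reduce at h2
    rw [Measure.map_apply measurable_neg measurableSet_Ioi] at h2
    simpa using h2
  have h2 : gaussianReal 0 1 (Set.Iio 0) + gaussianReal 0 1 (Set.Ioi 0) ≤ 1 := by
    have hd : Disjoint (Set.Iio (0 : ℝ)) (Set.Ioi 0) :=
      Set.disjoint_left.2 fun t h1 h2 => lt_asymm (Set.mem_Iio.1 h1) (Set.mem_Ioi.1 h2)
    rw [← measure_union hd measurableSet_Ioi]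
    exact prob_le_one
  rw [h1, ← two_mul] at h2
  rw [one_div, ENNReal.ofReal_inv_of_pos two_pos, ENNReal.ofReal_ofNat, ← one_div]
  rw [ENNReal.le_div_iff_mul_le (by simp) (by simp), mul_comm]
  exact h2

/-- The Gaussian tail with the constant `1 / 2`, by translation of the density. The constant is what
allows nets with `2 exp (s / 2)` instead of `exp (s / 2)` points. -/
theorem gaussianReal_Ioi_le {t : ℝ} (ht : 0 ≤ t) :
    gaussianReal 0 1 (Set.Ioi t) ≤ ENNReal.ofReal (1 / 2 * Real.exp (-t ^ 2 / 2)) := by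
  have key : ∀ u, (Set.Ioi t).indicator (gaussianPDF 0 1) (u + t) ≤
      ENNReal.ofReal (Real.exp (-t ^ 2 / 2)) * (Set.Ioi 0).indicator (gaussianPDF 0 1) u := by
    intro u
    by_cases hu : 0 < u
    · rw [Set.indicator_of_mem (show u + t ∈ Set.Ioi t by simpa using hu),
        Set.indicator_of_mem (show u ∈ Set.Ioi 0 from hu), gaussianPDF, gaussianPDF,
        ← ENNReal.ofReal_mul (Real.exp_nonneg _)]
      refine ENNReal.ofReal_le_ofReal ?_
      rw [gaussianPDFReal, gaussianPDFReal, mul_left_comm, ← Real.exp_add]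
      refine mul_le_mul_of_nonneg_left (Real.exp_le_exp.2 ?_) (by positivity)
      simp only [NNReal.coe_one, mul_one, sub_zero]
      nlinarith [mul_nonneg hu.le ht]
    · rw [Set.indicator_of_notMem (show u + t ∉ Set.Ioi t by simpa using hu)]
      exact zero_le
  rw [gaussianReal_apply 0 one_ne_zero, ← lintegral_indicator measurableSet_Ioi,
    ← lintegral_add_right_eq_self _ t]
  refine (lintegral_mono key).trans ?_
  rw [lintegral_const_mul _ ((measurable_gaussianPDF 0 1).indicator measurableSet_Ioi),
    lintegral_indicator measurableSet_Ioi, ← gaussianReal_apply 0 one_ne_zero, mul_comm (1 / 2 : ℝ),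
    ENNReal.ofReal_mul (Real.exp_nonneg _)]
  exact mul_le_mul_right gaussianReal_Ioi_zero_le _

theorem gaussianReal_Ioi_add_sqrt_le (m : ℝ) (w : ℝ≥0) {c : ℝ} (hc : 0 ≤ c) :
    gaussianReal m w (Set.Ioi (m + √c * √w)) ≤ ENNReal.ofReal (1 / 2 * Real.exp (-c / 2)) := by
  have h1 : gaussianReal m w = (gaussianReal 0 1).map fun t => √w * t + m := by
    have h2 := gaussianReal_map_const_mul (μ := 0) (v := 1) (√(w : ℝ))
    have h3 := Measure.map_map (μ := gaussianReal 0 1) (measurable_add_const m)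
      (measurable_const_mul √(w : ℝ))
    rw [h2, gaussianReal_map_add_const] at h3
    have : NNReal.mk (√(w : ℝ) ^ 2) (sq_nonneg _) * 1 = w := by
      rw [mul_one]
      exact NNReal.eq (Real.sq_sqrt w.2)
    rw [this, mul_zero, zero_add] at h3
    exact h3
  rw [h1, Measure.map_apply (by fun_prop) measurableSet_Ioi]
  have h2 := gaussianReal_Ioi_le (Real.sqrt_nonneg c)
  rw [Real.sq_sqrt hc] at h2
  refine (measure_mono fun t ht => ?_).trans h2
  have ht' : m + √c * √w < √w * t + m := ht
  have : √(w : ℝ) * √c < √w * t := by linarith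
  exact lt_of_mul_lt_mul_left this (Real.sqrt_nonneg _)

theorem isProbabilityMeasure_twoParamExp (s : ℝ) :
    IsProbabilityMeasure (twoParamExp s (1 / 2)) := by
  have := isProbabilityMeasure_expMeasure (r := 1 / 2) (by norm_num)
  exact Measure.isProbabilityMeasure_map (by fun_prop)

theorem twoParamExp_Ioi {s c : ℝ} (hc : s ≤ c) :
    twoParamExp s (1 / 2) (Set.Ioi c) = ENNReal.ofReal (Real.exp ((s - c) / 2)) := by
  have := isProbabilityMeasure_expMeasure (r := 1 / 2) (by norm_num)
  have h1 : (fun z => s + z) ⁻¹' Set.Ioi c = (Set.Iic (c - s))ᶜ := by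
    ext z
    simp [sub_lt_iff_lt_add']
  have h2 := cdf_expMeasure_eq (r := 1 / 2) (by norm_num) (c - s)
  rw [if_pos (sub_nonneg.2 hc), cdf_eq_real] at h2
  rw [twoParamExp, Measure.map_apply (by fun_prop) measurableSet_Ioi, h1,
    ← ofReal_measureReal, probReal_compl_eq_one_sub measurableSet_Iic, h2]
  congr 1
  rw [sub_sub_cancel]
  congr 1
  ring

theorem lintegral_twoParamExp_le {s : ℝ} (hs : 0 ≤ s) :
    ∫⁻ z, ENNReal.ofReal z ∂twoParamExp s (1 / 2) ≤ ENNReal.ofReal (2 + s) := by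
  have := isProbabilityMeasure_twoParamExp s
  have h0 : ∀ᵐ z ∂twoParamExp s (1 / 2), s ≤ z := by
    rw [ae_iff]
    have h1 := twoParamExp_Ioi (le_refl s)
    rw [sub_self, zero_div, Real.exp_zero, ENNReal.ofReal_one] at h1
    have h2 := (prob_compl_eq_zero_iff (μ := twoParamExp s (1 / 2)) measurableSet_Ioi).2 h1
    exact measure_mono_null (fun z hz => by
      rw [Set.mem_ofPred_eq, not_le] at hz
      simpa using hz.le) h2
  have h1 : ∫⁻ z, ENNReal.ofReal (z - s) ∂twoParamExp s (1 / 2) ≤ ENNReal.ofReal 2 := by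
    rw [lintegral_eq_lintegral_meas_lt (f := fun z => z - s) _
      (h0.mono fun z hz => sub_nonneg.2 hz) (by fun_prop)]
    have h2 : ∀ t ∈ Set.Ioi (0 : ℝ), twoParamExp s (1 / 2) {z | t < z - s} =
        ENNReal.ofReal (Real.exp (-(1 / 2) * t)) := fun t ht => by
      have e : {z : ℝ | t < z - s} = Set.Ioi (s + t) := by
        ext z
        simp [lt_sub_iff_add_lt']
      rw [e, twoParamExp_Ioi (by linarith [Set.mem_Ioi.1 ht])]
      congr 2
      ring
    rw [setLIntegral_congr_fun measurableSet_Ioi h2,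
      ← ofReal_integral_eq_lintegral_ofReal
        (integrableOn_exp_mul_Ioi (a := -(1 / 2)) (by norm_num) 0)
        (ae_of_all _ fun t => Real.exp_nonneg _),
      integral_exp_mul_Ioi (a := -(1 / 2)) (by norm_num) 0]
    norm_num
  calc ∫⁻ z, ENNReal.ofReal z ∂twoParamExp s (1 / 2)
      ≤ ∫⁻ z, (ENNReal.ofReal (z - s) + ENNReal.ofReal s) ∂twoParamExp s (1 / 2) := by
        refine lintegral_mono fun z => ?_
        refine le_trans (le_of_eq ?_) ENNReal.ofReal_add_le
        rw [sub_add_cancel]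
    _ ≤ ENNReal.ofReal 2 + ENNReal.ofReal s := by
        rw [lintegral_add_right _ measurable_const, lintegral_const, measure_univ, mul_one]
        gcongr
    _ = _ := (ENNReal.ofReal_add zero_le_two hs).symm

/-- The upper confidence bound `max i, m i + √t * √(w i)` over a finite family. -/
noncomputable def ucbMax {κ : Type*} [Fintype κ] [Nonempty κ] (m w : κ → ℝ) (t : ℝ) : ℝ :=
  Finset.univ.sup' Finset.univ_nonempty fun i => m i + √t * √(w i)

theorem ucbMax_mono {κ : Type*} [Fintype κ] [Nonempty κ] (m w : κ → ℝ) : Monotone (ucbMax m w) :=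
  fun _ _ h => Finset.sup'_mono_fun fun _ _ => by gcongr

theorem continuous_ucbMax {κ : Type*} [Fintype κ] [Nonempty κ] (m w : κ → ℝ) :
    Continuous (ucbMax m w) :=
  Continuous.finset_sup'_apply _ fun _ _ => by fun_prop

/-- The maximum of finitely many Gaussian variables is, in mean, at most the upper confidence bound
with an exponential confidence parameter: by the union bound and the Gaussian tail, the squared
normalized maximal deviation is stochastically dominated by that parameter. -/
theorem lintegral_sup_gaussian_le {Ω κ : Type*} [MeasurableSpace Ω] [Fintype κ] [Nonempty κ]
    {ν : Measure Ω} [IsFiniteMeasure ν] {G : κ → Ω → ℝ} (hG : ∀ i, Measurable (G i))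
    (m : κ → ℝ) (w : κ → ℝ≥0) (h_law : ∀ i, ν.map (G i) = ν Set.univ • gaussianReal (m i) (w i))
    {s : ℝ} (hs : 0 ≤ s) (h_card : (Fintype.card κ : ℝ) ≤ 2 * Real.exp (s / 2)) :
    ∫⁻ ω, ENNReal.ofReal (Finset.univ.sup' Finset.univ_nonempty (fun i => G i ω) -
        ucbMax m (fun i => w i) 0) ∂ν ≤
      ν Set.univ * ∫⁻ t, ENNReal.ofReal (ucbMax m (fun i => w i) t -
        ucbMax m (fun i => w i) 0) ∂twoParamExp s (1 / 2) := by
  have hP := isProbabilityMeasure_twoParamExp s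
  set h := ucbMax m (fun i => (w i : ℝ)) with h_def
  set M : Ω → ℝ := fun ω => Finset.univ.sup' Finset.univ_nonempty (fun i => G i ω) with hM_def
  have hM : Measurable M := by
    have := Finset.measurable_sup' Finset.univ_nonempty (f := G) fun i _ => hG i
    convert this using 1
    funext ω
    rw [Finset.sup'_apply]
  have hmono : Monotone h := ucbMax_mono _ _
  have hcont : Continuous h := continuous_ucbMax _ _
  have tail : ∀ u c, 0 ≤ c → h c - h 0 ≤ u →
      ν {ω | u < M ω - h 0} ≤ ν Set.univ * ENNReal.ofReal (Real.exp ((s - c) / 2)) := by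
    intro u c hc hcu
    have hsub : {ω | u < M ω - h 0} ⊆ ⋃ i, G i ⁻¹' Set.Ioi (m i + √c * √(w i)) := by
      intro ω hω
      have h1 : h c < M ω := by
        have : u < M ω - h 0 := hω
        linarith
      obtain ⟨i, -, hi⟩ := (Finset.lt_sup'_iff _).1 h1
      refine Set.mem_iUnion.2 ⟨i, lt_of_le_of_lt ?_ hi⟩
      exact Finset.le_sup' (fun i => m i + √c * √(w i : ℝ)) (Finset.mem_univ i)
    refine (measure_mono hsub).trans ((measure_iUnion_fintype_le _ _).trans ?_)
    have hi : ∀ i, ν (G i ⁻¹' Set.Ioi (m i + √c * √(w i))) ≤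
        ν Set.univ * ENNReal.ofReal (1 / 2 * Real.exp (-c / 2)) := fun i => by
      rw [← Measure.map_apply (hG i) measurableSet_Ioi, h_law, Measure.smul_apply, smul_eq_mul]
      exact mul_le_mul_right (gaussianReal_Ioi_add_sqrt_le _ _ hc) _
    refine (Finset.sum_le_sum fun i _ => hi i).trans ?_
    rw [Finset.sum_const, Finset.card_univ, nsmul_eq_mul, mul_left_comm, ← ENNReal.ofReal_natCast,
      ← ENNReal.ofReal_mul (Nat.cast_nonneg _)]
    refine mul_le_mul_right (ENNReal.ofReal_le_ofReal ?_) _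
    have : Real.exp ((s - c) / 2) = Real.exp (s / 2) * Real.exp (-c / 2) := by
      rw [← Real.exp_add]
      congr 1
      ring
    rw [this]
    nlinarith [Real.exp_pos (-c / 2)]
  have dom : ∀ u, 0 < u → ν {ω | u < M ω - h 0} ≤
      ν Set.univ * twoParamExp s (1 / 2) {t | u ≤ h t - h 0} := by
    intro u hu
    have upper : ∀ c, s ≤ c → u ≤ h c - h 0 → ENNReal.ofReal (Real.exp ((s - c) / 2)) ≤
        twoParamExp s (1 / 2) {t | u ≤ h t - h 0} := fun c hc huc => by
      rw [← twoParamExp_Ioi hc]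
      exact measure_mono fun t ht => huc.trans (by
        have := hmono (Set.mem_Ioi.1 ht).le
        linarith)
    by_cases h1 : u ≤ h s - h 0
    · have := upper s le_rfl h1
      rw [sub_self, zero_div, Real.exp_zero, ENNReal.ofReal_one] at this
      calc ν {ω | u < M ω - h 0} ≤ ν Set.univ * 1 := by
            rw [mul_one]
            exact measure_mono (Set.subset_univ _)
        _ ≤ _ := mul_le_mul_right this _
    push Not at h1
    by_cases h2 : ∃ b, s ≤ b ∧ u ≤ h b - h 0
    · -- by continuity the bound `h 0 + u` is attained, at a parameter `c`
      obtain ⟨b, hb, hub⟩ := h2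
      obtain ⟨c, hc, hcu⟩ := intermediate_value_Icc hb (hcont.sub continuous_const).continuousOn
        (Set.mem_Icc.2 ⟨h1.le, hub⟩)
      exact (tail u c (hs.trans hc.1) hcu.le).trans
        (mul_le_mul_right (upper c hc.1 hcu.ge) _)
    · push Not at h2
      -- the bound is never attained: let the parameter tend to infinity
      have h3 : Tendsto (fun c : ℝ => ν Set.univ * ENNReal.ofReal (Real.exp ((s - c) / 2))) atTop
          (𝓝 (ν Set.univ * ENNReal.ofReal 0)) := by
        refine ENNReal.Tendsto.const_mul (ENNReal.tendsto_ofReal ?_)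
          (Or.inr (measure_ne_top _ _))
        refine Real.tendsto_exp_atBot.comp ?_
        have : Tendsto (fun c : ℝ => s - c) atTop atBot := by
          simpa only [sub_eq_add_neg] using
            tendsto_atBot_add_const_left atTop s tendsto_neg_atTop_atBot
        exact this.atBot_div_const two_pos
      rw [ENNReal.ofReal_zero, mul_zero] at h3
      refine (ge_of_tendsto h3 ?_).trans zero_le
      filter_upwards [eventually_ge_atTop s] with c hc
      exact tail u c (hs.trans hc) (h2 c hc).le
  have e1 : ∫⁻ ω, ENNReal.ofReal (M ω - h 0) ∂ν = ∫⁻ ω, ENNReal.ofReal (max (M ω - h 0) 0) ∂ν := by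
    simp
  have e2 : ∫⁻ t, ENNReal.ofReal (h t - h 0) ∂twoParamExp s (1 / 2) =
      ∫⁻ t, ENNReal.ofReal (max (h t - h 0) 0) ∂twoParamExp s (1 / 2) := by
    simp
  have hm1 : AEMeasurable (fun ω => max (M ω - h 0) 0) ν :=
    ((hM.sub_const _).max measurable_const).aemeasurable
  have hm2 : AEMeasurable (fun t => max (h t - h 0) 0) (twoParamExp s (1 / 2)) :=
    ((hcont.measurable.sub_const _).max measurable_const).aemeasurable
  rw [e1, e2, lintegral_eq_lintegral_meas_lt ν (f := fun ω => max (M ω - h 0) 0)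
      (ae_of_all _ fun ω => le_max_right _ _) hm1,
    lintegral_eq_lintegral_meas_le _ (f := fun t => max (h t - h 0) 0)
      (ae_of_all _ fun ω => le_max_right _ _) hm2,
    ← lintegral_const_mul' _ _ (measure_ne_top _ _)]
  refine setLIntegral_mono' measurableSet_Ioi fun u hu => ?_
  have hu' : ¬ u < 0 := not_lt.2 (Set.mem_Ioi.1 hu).le
  have hu'' : ¬ u ≤ 0 := not_le.2 (Set.mem_Ioi.1 hu)
  simp only [lt_max_iff, le_max_iff, hu', hu'', or_false]
  exact dom u hu

/-! ### The posterior along an adaptive run -/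

section Measurability

variable {𝒳 : Type*} [MeasurableSpace 𝒳] {k : 𝒳 → 𝒳 → ℝ} {σ : ℝ} {α : Type*} [MeasurableSpace α]
  {n : ℕ}

theorem measurable_det {M : α → Matrix (Fin n) (Fin n) ℝ}
    (hM : ∀ i j, Measurable fun t => M t i j) : Measurable fun t => (M t).det := by
  simp only [Matrix.det_apply']
  exact Finset.measurable_sum _ fun τ _ =>
    (Finset.measurable_prod _ fun i _ => hM _ _).const_mul _

theorem measurable_matrix_inv {M : α → Matrix (Fin n) (Fin n) ℝ}
    (hM : ∀ i j, Measurable fun t => M t i j) (i j : Fin n) :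
    Measurable fun t => (M t)⁻¹ i j := by
  have h : ∀ t, (M t)⁻¹ i j = ((M t).det)⁻¹ * ((M t).updateRow j (Pi.single i 1)).det := fun t => by
    rw [Matrix.inv_def, Ring.inverse_eq_inv', Matrix.smul_apply, smul_eq_mul,
      Matrix.adjugate_apply]
  simp_rw [h]
  refine (measurable_det hM).inv.mul (measurable_det fun a b => ?_)
  by_cases ha : a = j
  · simp [ha]
  · simpa [Matrix.updateRow_ne ha] using hM a b

theorem measurable_noisyGram_inv (hk : Measurable fun q : 𝒳 × 𝒳 => k q.1 q.2)
    {p : α → Fin n → 𝒳} (hp : Measurable p) (i j : Fin n) :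
    Measurable fun t => (noisyGram k σ (p t))⁻¹ i j := by
  refine measurable_matrix_inv (fun i j => ?_) i j
  have h1 : ∀ i, Measurable fun t => p t i := fun i => (measurable_pi_apply i).comp hp
  simp only [noisyGram, Matrix.add_apply, Matrix.of_apply]
  exact (hk.comp ((h1 i).prodMk (h1 j))).add_const _

theorem measurable_postMean (hk : Measurable fun q : 𝒳 × 𝒳 => k q.1 q.2)
    {p : α → Fin n → 𝒳} (hp : Measurable p) {y : α → Fin n → ℝ} (hy : Measurable y) {z : α → 𝒳}
    (hz : Measurable z) : Measurable fun t => postMean k σ (p t) (y t) (z t) := by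
  have h1 : ∀ i, Measurable fun t => p t i := fun i => (measurable_pi_apply i).comp hp
  simp only [postMean, dotProduct, Matrix.mulVec]
  exact Finset.measurable_sum _ fun i _ => (hk.comp (hz.prodMk (h1 i))).mul
    (Finset.measurable_sum _ fun j _ => (measurable_noisyGram_inv hk hp i j).mul
      ((measurable_pi_apply j).comp hy))

theorem measurable_postVar (hk : Measurable fun q : 𝒳 × 𝒳 => k q.1 q.2)
    {p : α → Fin n → 𝒳} (hp : Measurable p) {z : α → 𝒳} (hz : Measurable z) :
    Measurable fun t => postVar k σ (p t) (z t) := by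
  have h1 : ∀ i, Measurable fun t => p t i := fun i => (measurable_pi_apply i).comp hp
  exact (hk.comp (hz.prodMk hz)).sub (measurable_postMean hk hp
    (measurable_pi_lambda _ fun i => hk.comp (hz.prodMk (h1 i))) hz)

end Measurability

/-- The query points in the data. -/
def Data.pts {𝒳 : Type*} {n : ℕ} (D : Data 𝒳 n) (i : Fin n) : 𝒳 := (D i).1

/-- The observations in the data. -/
def Data.obs {𝒳 : Type*} {n : ℕ} (D : Data 𝒳 n) (i : Fin n) : ℝ := (D i).2.2

theorem Data.measurable_pts {𝒳 : Type*} [MeasurableSpace 𝒳] {n : ℕ} :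
    Measurable (Data.pts : Data 𝒳 n → Fin n → 𝒳) :=
  measurable_pi_lambda _ fun i => measurable_fst.comp (measurable_pi_apply i)

theorem Data.measurable_obs {𝒳 : Type*} [MeasurableSpace 𝒳] {n : ℕ} :
    Measurable (Data.obs : Data 𝒳 n → Fin n → ℝ) :=
  measurable_pi_lambda _ fun i =>
    measurable_snd.comp (measurable_snd.comp (measurable_pi_apply i))

theorem measurable_ucbMax {α κ : Type*} [MeasurableSpace α] [Fintype κ] [Nonempty κ]
    {m w : α → κ → ℝ} {t : α → ℝ} (hm : ∀ i, Measurable fun a => m a i)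
    (hw : ∀ i, Measurable fun a => w a i) (ht : Measurable t) :
    Measurable fun a => ucbMax (m a) (w a) (t a) := by
  have := Finset.measurable_sup' (Finset.univ_nonempty (α := κ))
    (f := fun i a => m a i + √(t a) * √(w a i))
    fun i _ => (hm i).add (ht.sqrt.mul (hw i).sqrt)
  convert this using 1
  funext a
  rw [Finset.sup'_apply, ucbMax]

theorem IsNoisyGP.measurable_likelihood_apply {Ω 𝒳 : Type*} [MeasurableSpace Ω] {μ : Measure Ω}
    {k : 𝒳 → 𝒳 → ℝ} {σ : ℝ} {F : 𝒳 → Ω → ℝ} {ε : ℕ → Ω → ℝ} (h : IsNoisyGP μ k σ F ε) {n : ℕ}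
    (D : Data 𝒳 n) :
    Measurable fun ω => likelihood (σ ^ 2).toNNReal D.obs fun i => F (D.pts i) ω :=
  measurable_likelihood _ measurable_const (measurable_pi_lambda _ fun _ => h.measurable _)

/-- For fixed data: the maximum of the process over finitely many points against that of the
randomized upper confidence bounds, in mean under the likelihood of the data. -/
theorem IsNoisyGP.lintegral_likelihood_mul_sup_le {Ω 𝒳 : Type*} [MeasurableSpace Ω] {μ : Measure Ω}
    {k : 𝒳 → 𝒳 → ℝ} {σ : ℝ} {F : 𝒳 → Ω → ℝ} {ε : ℕ → Ω → ℝ} (h : IsNoisyGP μ k σ F ε)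
    {κ : Type*} [Fintype κ] [Nonempty κ] (c : κ → 𝒳) {n : ℕ} (D : Data 𝒳 n) {s : ℝ} (hs : 0 ≤ s)
    (h_card : (Fintype.card κ : ℝ) ≤ 2 * Real.exp (s / 2)) :
    ∫⁻ ω, likelihood (σ ^ 2).toNNReal D.obs (fun i => F (D.pts i) ω) *
        ENNReal.ofReal (Finset.univ.sup' Finset.univ_nonempty (fun i => F (c i) ω) -
        ucbMax (fun i => postMean k σ D.pts D.obs (c i)) (fun i => postVar k σ D.pts (c i)) 0) ∂μ ≤
      ∫⁻ ω, likelihood (σ ^ 2).toNNReal D.obs (fun i => F (D.pts i) ω) *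
        (∫⁻ z, ENNReal.ofReal (
        ucbMax (fun i => postMean k σ D.pts D.obs (c i)) (fun i => postVar k σ D.pts (c i)) z -
        ucbMax (fun i => postMean k σ D.pts D.obs (c i)) (fun i => postVar k σ D.pts (c i)) 0)
          ∂twoParamExp s (1 / 2)) ∂μ := by
  have hLm := h.measurable_likelihood_apply D
  set ν := μ.withDensity fun ω => likelihood (σ ^ 2).toNNReal D.obs fun i => F (D.pts i) ω with hν
  have hνu : ν Set.univ = evidence μ σ F D.pts D.obs := by
    rw [hν, withDensity_apply _ MeasurableSet.univ, setLIntegral_univ, evidence]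
  have : IsFiniteMeasure ν := isFiniteMeasure_withDensity (h.evidence_ne_top _ _)
  have hsupF : Measurable fun ω =>
      Finset.univ.sup' Finset.univ_nonempty (fun i => F (c i) ω) := by
    have := Finset.measurable_sup' (Finset.univ_nonempty (α := κ)) (f := fun i ω => F (c i) ω)
      fun i _ => h.measurable _
    convert this using 1
    funext a
    rw [Finset.sup'_apply]
  have hv : ∀ i, ((postVar k σ D.pts (c i)).toNNReal : ℝ) = postVar k σ D.pts (c i) := fun i =>
    Real.coe_toNNReal _ (h.postVar_nonneg _ _)
  have main := lintegral_sup_gaussian_le (ν := ν) (G := fun i => F (c i))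
    (fun i => h.measurable _) (fun i => postMean k σ D.pts D.obs (c i))
    (fun i => (postVar k σ D.pts (c i)).toNNReal)
    (fun i => by rw [hνu]; exact h.map_withDensity_likelihood D.pts D.obs (c i)) hs h_card
  simp only [hv] at main
  rw [hνu, hν, lintegral_withDensity_eq_lintegral_mul _ hLm
    (hsupF.sub_const _).ennreal_ofReal] at main
  refine main.trans (le_of_eq ?_)
  rw [lintegral_mul_const _ hLm, evidence]

section Run

variable {Ω 𝓖 𝒳 : Type*} [MeasurableSpace Ω] [MeasurableSpace 𝓖] [MeasurableSpace 𝒳]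
  {μ : Measure Ω} {ev : 𝓖 → 𝒳 → ℝ} {k : 𝒳 → 𝒳 → ℝ} {σ : ℝ} {F : 𝒳 → Ω → ℝ} {g : Ω → 𝓖}
  {ε ζ y : ℕ → Ω → ℝ} {x : ℕ → Ω → 𝒳}

/-- A covariance is measurable as soon as the process has a jointly measurable evaluation. -/
theorem IsNoisyGP.measurable_kernel (h : IsNoisyGP μ k σ F ε)
    (r : IsAdaptiveRun μ ev (σ ^ 2).toNNReal g ε ζ y x) (hev : ∀ ω z, ev (g ω) z = F z ω) :
    Measurable fun q : 𝒳 × 𝒳 => k q.1 q.2 := by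
  have := h.isProbabilityMeasure
  have e : ∀ q : 𝒳 × 𝒳, k q.1 q.2 = ∫ ω, ev (g ω) q.1 * ev (g ω) q.2 ∂μ := fun q => by
    rw [← h.cov_eq, covariance_eq_sub (h.memLp _) (h.memLp _), h.mean_eq, zero_mul, sub_zero]
    simp_rw [hev]
    rfl
  simp_rw [e]
  have hm : Measurable fun q : (𝒳 × 𝒳) × Ω => ev (g q.2) q.1.1 * ev (g q.2) q.1.2 :=
    (r.measurable_ev.comp ((r.measurable.comp measurable_snd).prodMk
      (measurable_fst.comp measurable_fst))).mul
    (r.measurable_ev.comp ((r.measurable.comp measurable_snd).prodMk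
      (measurable_snd.comp measurable_fst)))
  exact hm.stronglyMeasurable.integral_prod_right.measurable

/-- Given the data and the confidence parameter, the deviation of the process from its posterior
mean at a point chosen from them is centered Gaussian with variance at most `1`. Hence inequalities
between expectations under such laws carry over to the deviation. -/
theorem lintegral_deviation_mono (h : IsNoisyGP μ k σ F ε)
    (r : IsAdaptiveRun μ ev (σ ^ 2).toNNReal g ε ζ y x) (hev : ∀ ω z, ev (g ω) z = F z ω)
    (hk : ∀ z, k z z = 1) {n : ℕ} {q : Data 𝒳 n × ℝ → 𝒳} (hq : Measurable q) {θ₁ θ₂ : ℝ → ℝ≥0∞}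
    (hθ₁ : Measurable θ₁) (hθ₂ : Measurable θ₂)
    (hθ : ∀ w : ℝ≥0, w ≤ 1 → ∫⁻ u, θ₁ u ∂gaussianReal 0 w ≤ ∫⁻ u, θ₂ u ∂gaussianReal 0 w) :
    ∫⁻ ω, θ₁ (F (q (runData ζ y x n ω, ζ n ω)) ω -
        postMean k σ (runData ζ y x n ω).pts (runData ζ y x n ω).obs
          (q (runData ζ y x n ω, ζ n ω))) ∂μ ≤
      ∫⁻ ω, θ₂ (F (q (runData ζ y x n ω, ζ n ω)) ω -
        postMean k σ (runData ζ y x n ω).pts (runData ζ y x n ω).obs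
          (q (runData ζ y x n ω, ζ n ω))) ∂μ := by
  have := h.isProbabilityMeasure
  have hz := Measure.isProbabilityMeasure_map (r.zeta_measurable n).aemeasurable (μ := μ)
  obtain ⟨ρ, hρ, hρ_eq⟩ := r.exists_lintegral_runData h.var_ne_zero n
  have hkm := h.measurable_kernel r hev
  let m : Data 𝒳 n → ℝ → ℝ := fun D z => postMean k σ D.pts D.obs (q (D, z))
  have hm : Measurable fun a : Data 𝒳 n × ℝ => m a.1 a.2 :=
    measurable_postMean hkm (Data.measurable_pts.comp measurable_fst)
      (Data.measurable_obs.comp measurable_fst) hq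
  have key : ∀ θ : ℝ → ℝ≥0∞, Measurable θ →
      ∫⁻ ω, θ (F (q (runData ζ y x n ω, ζ n ω)) ω - m (runData ζ y x n ω) (ζ n ω)) ∂μ =
        ∫⁻ D, ∫⁻ z, evidence μ σ F D.pts D.obs *
          ∫⁻ u, θ u ∂gaussianReal 0 (postVar k σ D.pts (q (D, z))).toNNReal ∂(μ.map (ζ n)) ∂ρ := by
    intro θ hθ
    let Ψ : (𝓖 × Data 𝒳 n) × ℝ → ℝ≥0∞ := fun a =>
      θ (ev a.1.1 (q (a.1.2, a.2)) - m a.1.2 a.2)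
    have hΨ : Measurable Ψ := by
      have h1 : Measurable fun a : (𝓖 × Data 𝒳 n) × ℝ => (a.1.2, a.2) := by fun_prop
      exact hθ.comp ((r.measurable_ev.comp ((measurable_fst.comp measurable_fst).prodMk
        (hq.comp h1))).sub (hm.comp h1))
    have e1 := r.lintegral_zeta n (Ψ := fun a D z => Ψ ((a, D), z)) hΨ
    have e2 := hρ_eq (fun a D => ∫⁻ z, Ψ ((a, D), z) ∂(μ.map (ζ n))) hΨ.lintegral_prod_right'
    rw [e2] at e1
    refine Eq.trans ?_ (e1.trans ?_)
    · simp only [Ψ, hev]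
    refine lintegral_congr fun D => ?_
    have hL : ∀ ω, Data.likelihood ev (σ ^ 2).toNNReal (g ω) D =
        likelihood (σ ^ 2).toNNReal D.obs fun i => F (D.pts i) ω := fun ω => by
      simp only [Data.likelihood, hev]
      rfl
    have hLm := h.measurable_likelihood_apply D
    have hΨD : ∀ ω, Measurable fun z => Ψ ((g ω, D), z) := fun ω =>
      hΨ.comp measurable_prodMk_left
    have hΨD' : Measurable fun a : Ω × ℝ => Ψ ((g a.1, D), a.2) :=
      hΨ.comp (((r.measurable.comp measurable_fst).prodMk measurable_const).prodMk measurable_snd)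
    simp_rw [hL]
    have e3 : ∀ ω, (likelihood (σ ^ 2).toNNReal D.obs fun i => F (D.pts i) ω) *
        ∫⁻ z, Ψ ((g ω, D), z) ∂(μ.map (ζ n)) =
        ∫⁻ z, (likelihood (σ ^ 2).toNNReal D.obs fun i => F (D.pts i) ω) * Ψ ((g ω, D), z)
          ∂(μ.map (ζ n)) := fun ω => (lintegral_const_mul _ (hΨD ω)).symm
    simp_rw [e3]
    rw [lintegral_lintegral_swap (f := fun ω z =>
      (likelihood (σ ^ 2).toNNReal D.obs fun i => F (D.pts i) ω) * Ψ ((g ω, D), z))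
      ((hLm.comp measurable_fst).mul hΨD').aemeasurable]
    refine lintegral_congr fun z => ?_
    have hθm : Measurable fun u => θ (u - m D z) := hθ.comp (measurable_sub_const _)
    have e4 := congrArg (fun ν => ∫⁻ u, θ (u - m D z) ∂ν)
      (h.map_withDensity_likelihood D.pts D.obs (q (D, z)))
    simp only [lintegral_smul_measure, smul_eq_mul] at e4
    rw [lintegral_map hθm (h.measurable _), lintegral_withDensity_eq_lintegral_mul _ hLm
      (g := fun ω => θ (F (q (D, z)) ω - m D z)) (hθm.comp (h.measurable _))] at e4
    have e5 : ∫⁻ u, θ (u - m D z) ∂gaussianReal (postMean k σ D.pts D.obs (q (D, z)))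
        (postVar k σ D.pts (q (D, z))).toNNReal =
        ∫⁻ u, θ u ∂gaussianReal 0 (postVar k σ D.pts (q (D, z))).toNNReal := by
      rw [← lintegral_map hθ (measurable_sub_const _), gaussianReal_map_sub_const, sub_self]
    rw [e5] at e4
    refine Eq.trans ?_ e4
    simp only [Ψ, hev, Pi.mul_apply]
  refine (key θ₁ hθ₁).trans_le (le_trans ?_ (key θ₂ hθ₂).ge)
  refine lintegral_mono fun D => lintegral_mono fun z => mul_le_mul_right (hθ _ ?_) _
  exact Real.toNNReal_le_one.2 ((h.postVar_le _ _).trans (hk _).le)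

theorem lintegral_abs_gaussianReal_le {w : ℝ≥0} (hw : w ≤ 1) :
    ∫⁻ u, ENNReal.ofReal |u| ∂gaussianReal 0 w ≤ ∫⁻ _, 1 ∂gaussianReal 0 w := by
  have hL : MemLp (fun u : ℝ => u) 2 (gaussianReal 0 w) := memLp_id_gaussianReal 2
  have h1 : ∫ u, u ^ 2 ∂gaussianReal 0 w = w := by
    have := variance_of_integral_eq_zero (μ := gaussianReal 0 w) (X := fun u : ℝ => u)
      (by fun_prop) integral_id_gaussianReal
    rw [← this, variance_fun_id_gaussianReal]
  have h2 : Integrable (fun u : ℝ => (1 + u ^ 2) / 2) (gaussianReal 0 w) :=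
    ((integrable_const 1).add hL.integrable_sq).div_const 2
  calc ∫⁻ u, ENNReal.ofReal |u| ∂gaussianReal 0 w
      ≤ ∫⁻ u, ENNReal.ofReal ((1 + u ^ 2) / 2) ∂gaussianReal 0 w := by
        refine lintegral_mono fun u => ENNReal.ofReal_le_ofReal ?_
        nlinarith [sq_nonneg (|u| - 1), sq_abs u]
    _ = ENNReal.ofReal (∫ u, (1 + u ^ 2) / 2 ∂gaussianReal 0 w) :=
        (ofReal_integral_eq_lintegral_ofReal h2 (ae_of_all _ fun u => by positivity)).symm
    _ ≤ 1 := by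
        rw [integral_div, integral_add (integrable_const 1) hL.integrable_sq, h1]
        simp only [integral_const, probReal_univ, one_smul]
        refine ENNReal.ofReal_le_one.2 ?_
        have : (w : ℝ) ≤ 1 := by exact_mod_cast hw
        linarith
    _ = _ := by simp

/-- The deviation from the posterior mean at an adaptively chosen point is integrable and
centered. -/
theorem integrable_deviation (h : IsNoisyGP μ k σ F ε)
    (r : IsAdaptiveRun μ ev (σ ^ 2).toNNReal g ε ζ y x) (hev : ∀ ω z, ev (g ω) z = F z ω)
    (hk : ∀ z, k z z = 1) {n : ℕ} {q : Data 𝒳 n × ℝ → 𝒳} (hq : Measurable q) :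
    Integrable (fun ω => F (q (runData ζ y x n ω, ζ n ω)) ω -
        postMean k σ (runData ζ y x n ω).pts (runData ζ y x n ω).obs
          (q (runData ζ y x n ω, ζ n ω))) μ ∧
      ∫ ω, F (q (runData ζ y x n ω, ζ n ω)) ω -
        postMean k σ (runData ζ y x n ω).pts (runData ζ y x n ω).obs
          (q (runData ζ y x n ω, ζ n ω)) ∂μ = 0 := by
  have := h.isProbabilityMeasure
  set dev : Ω → ℝ := fun ω => F (q (runData ζ y x n ω, ζ n ω)) ω -
        postMean k σ (runData ζ y x n ω).pts (runData ζ y x n ω).obs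
          (q (runData ζ y x n ω, ζ n ω)) with hdev
  have hkm := h.measurable_kernel r hev
  have hDζ : AEMeasurable (fun ω => (runData ζ y x n ω, ζ n ω)) μ :=
    (r.aemeasurable_runData n).prodMk (r.zeta_measurable n).aemeasurable
  have hmeas : AEMeasurable dev μ := by
    have h1 : Measurable fun a : 𝓖 × (Data 𝒳 n × ℝ) => ev a.1 (q a.2) -
        postMean k σ a.2.1.pts a.2.1.obs (q a.2) :=
      (r.measurable_ev.comp (measurable_fst.prodMk (hq.comp measurable_snd))).sub
        (measurable_postMean hkm
          (Data.measurable_pts.comp (measurable_fst.comp measurable_snd))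
          (Data.measurable_obs.comp (measurable_fst.comp measurable_snd))
          (hq.comp measurable_snd))
    have h2 := h1.comp_aemeasurable (r.measurable.aemeasurable.prodMk hDζ)
    refine h2.congr (ae_of_all _ fun ω => ?_)
    simp only [Function.comp_apply, hev, dev]
  have hint : Integrable dev μ := by
    refine ⟨hmeas.aestronglyMeasurable, ?_⟩
    rw [hasFiniteIntegral_iff_norm]
    have := lintegral_deviation_mono h r hev hk hq (θ₁ := fun u => ENNReal.ofReal |u|)
      (θ₂ := fun _ => 1) (by fun_prop) measurable_const fun w hw => lintegral_abs_gaussianReal_le hw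
    refine this.trans_lt ?_
    simp
  refine ⟨hint, ?_⟩
  have hneg : ∀ w : ℝ≥0, ∫⁻ u, ENNReal.ofReal (-u) ∂gaussianReal 0 w =
      ∫⁻ u, ENNReal.ofReal u ∂gaussianReal 0 w := fun w => by
    have := gaussianReal_map_neg (μ := 0) (v := w)
    rw [neg_zero] at this
    conv_rhs => rw [← this, lintegral_map (by fun_prop) measurable_neg]
  have e1 : ∫⁻ ω, ENNReal.ofReal (dev ω) ∂μ = ∫⁻ ω, ENNReal.ofReal (-dev ω) ∂μ :=
    le_antisymm
      (lintegral_deviation_mono h r hev hk hq (θ₁ := fun u => ENNReal.ofReal u)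
        (θ₂ := fun u => ENNReal.ofReal (-u)) (by fun_prop) (by fun_prop) fun w _ => (hneg w).ge)
      (lintegral_deviation_mono h r hev hk hq (θ₁ := fun u => ENNReal.ofReal (-u))
        (θ₂ := fun u => ENNReal.ofReal u) (by fun_prop) (by fun_prop) fun w _ => (hneg w).le)
  rw [integral_eq_lintegral_pos_part_sub_lintegral_neg_part hint, e1, sub_self]

/-- The mean of the maximum of the process over finitely many points is at most the mean of the
randomized upper confidence bound over these points, both compared with the maximum of the posterior
means. -/
theorem lintegral_sup_le_ucbMax (h : IsNoisyGP μ k σ F ε)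
    (r : IsAdaptiveRun μ ev (σ ^ 2).toNNReal g ε ζ y x) (hev : ∀ ω z, ev (g ω) z = F z ω)
    {κ : Type*} [Fintype κ] [Nonempty κ] (c : κ → 𝒳) {n : ℕ} {s : ℝ} (hs : 0 ≤ s)
    (hζ : μ.map (ζ n) = twoParamExp s (1 / 2))
    (h_card : (Fintype.card κ : ℝ) ≤ 2 * Real.exp (s / 2)) :
    ∫⁻ ω, ENNReal.ofReal (Finset.univ.sup' Finset.univ_nonempty (fun i => F (c i) ω) -
        ucbMax (fun i => postMean k σ (runData ζ y x n ω).pts (runData ζ y x n ω).obs (c i))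
          (fun i => postVar k σ (runData ζ y x n ω).pts (c i)) 0) ∂μ ≤
      ∫⁻ ω, ENNReal.ofReal (
        ucbMax (fun i => postMean k σ (runData ζ y x n ω).pts (runData ζ y x n ω).obs (c i))
          (fun i => postVar k σ (runData ζ y x n ω).pts (c i)) (ζ n ω) -
        ucbMax (fun i => postMean k σ (runData ζ y x n ω).pts (runData ζ y x n ω).obs (c i))
          (fun i => postVar k σ (runData ζ y x n ω).pts (c i)) 0) ∂μ := by
  have := h.isProbabilityMeasure
  have hz := Measure.isProbabilityMeasure_map (r.zeta_measurable n).aemeasurable (μ := μ)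
  obtain ⟨ρ, hρ, hρ_eq⟩ := r.exists_lintegral_runData h.var_ne_zero n
  have hkm := h.measurable_kernel r hev
  obtain ⟨U, hU_eq⟩ : ∃ U : Data 𝒳 n → ℝ → ℝ, ∀ D t, U D t = ucbMax
      (fun i => postMean k σ D.pts D.obs (c i)) (fun i => postVar k σ D.pts (c i)) t :=
    ⟨_, fun _ _ => rfl⟩
  have hm : ∀ i, Measurable fun a : Data 𝒳 n × ℝ => postMean k σ a.1.pts a.1.obs (c i) := fun i =>
    measurable_postMean (z := fun _ => c i) hkm (Data.measurable_pts.comp measurable_fst)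
      (Data.measurable_obs.comp measurable_fst) measurable_const
  have hw : ∀ i, Measurable fun a : Data 𝒳 n × ℝ => postVar k σ a.1.pts (c i) := fun i =>
    measurable_postVar (z := fun _ => c i) hkm (Data.measurable_pts.comp measurable_fst)
      measurable_const
  have hU : Measurable fun a : Data 𝒳 n × ℝ => U a.1 a.2 := by
    simp_rw [hU_eq]
    exact measurable_ucbMax (m := fun a : Data 𝒳 n × ℝ => fun i => postMean k σ a.1.pts a.1.obs (c i))
      (w := fun a i => postVar k σ a.1.pts (c i)) (t := Prod.snd) hm hw measurable_snd
  have hU0 : Measurable fun D => U D 0 := hU.comp (g := fun a : Data 𝒳 n × ℝ => U a.1 a.2)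
    (f := fun D => (D, (0 : ℝ))) (measurable_id.prodMk measurable_const)
  have hsup : Measurable fun a : 𝓖 =>
      Finset.univ.sup' Finset.univ_nonempty (fun i => ev a (c i)) := by
    have := Finset.measurable_sup' (Finset.univ_nonempty (α := κ)) (f := fun i a => ev a (c i))
      fun i _ => r.measurable_ev.comp (measurable_id.prodMk measurable_const)
    convert this using 1
    funext a
    rw [Finset.sup'_apply]
  have hL : ∀ (D : Data 𝒳 n) ω, Data.likelihood ev (σ ^ 2).toNNReal (g ω) D =
      likelihood (σ ^ 2).toNNReal D.obs fun i => F (D.pts i) ω := fun D ω => by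
    simp only [Data.likelihood, hev]
    rfl
  have e1 := hρ_eq (fun a D => ENNReal.ofReal
    (Finset.univ.sup' Finset.univ_nonempty (fun i => ev a (c i)) - U D 0))
    (((hsup.comp measurable_fst).sub (hU0.comp measurable_snd)).ennreal_ofReal)
  have hUd : Measurable fun a : Data 𝒳 n × ℝ => ENNReal.ofReal (U a.1 a.2 - U a.1 0) :=
    (hU.sub (hU0.comp measurable_fst)).ennreal_ofReal
  have e2 := r.lintegral_zeta n (Ψ := fun _ D z => ENNReal.ofReal (U D z - U D 0))
    (hUd.comp ((measurable_snd.comp measurable_fst).prodMk measurable_snd))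
  have e3 := hρ_eq (fun _ D => ∫⁻ z, ENNReal.ofReal (U D z - U D 0) ∂(μ.map (ζ n)))
    (hUd.lintegral_prod_right'.comp measurable_snd)
  rw [e3] at e2
  have e4 : ∫⁻ ω, ENNReal.ofReal (Finset.univ.sup' Finset.univ_nonempty (fun i => F (c i) ω) -
      U (runData ζ y x n ω) 0) ∂μ = ∫⁻ D, ∫⁻ ω, likelihood (σ ^ 2).toNNReal D.obs
        (fun i => F (D.pts i) ω) * ENNReal.ofReal (Finset.univ.sup' Finset.univ_nonempty
          (fun i => F (c i) ω) - U D 0) ∂μ ∂ρ := by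
    simpa only [hev, hL] using e1
  have e5 : ∫⁻ ω, ENNReal.ofReal (U (runData ζ y x n ω) (ζ n ω) - U (runData ζ y x n ω) 0) ∂μ =
      ∫⁻ D, ∫⁻ ω, likelihood (σ ^ 2).toNNReal D.obs (fun i => F (D.pts i) ω) *
        (∫⁻ z, ENNReal.ofReal (U D z - U D 0) ∂twoParamExp s (1 / 2)) ∂μ ∂ρ := by
    simpa only [hL, hζ] using e2
  simp_rw [← hU_eq]
  rw [e4, e5]
  refine lintegral_mono fun D => ?_
  simp_rw [hU_eq]
  exact h.lintegral_likelihood_mul_sup_le c D hs h_card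

end Run

/-! ### The regret of a single step -/

theorem integral_le_of_lintegral_ofReal_le {Ω : Type*} [MeasurableSpace Ω] {μ : Measure Ω}
    {f : Ω → ℝ} {δ : ℝ} (hδ : 0 ≤ δ) (hf : ∫⁻ ω, ENNReal.ofReal (f ω) ∂μ ≤ ENNReal.ofReal δ) :
    ∫ ω, f ω ∂μ ≤ δ := by
  by_cases hi : Integrable f μ
  · rw [integral_eq_lintegral_pos_part_sub_lintegral_neg_part hi]
    have := ENNReal.toReal_mono ENNReal.ofReal_ne_top hf
    rw [ENNReal.toReal_ofReal hδ] at this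
    linarith [ENNReal.toReal_nonneg (a := ∫⁻ ω, ENNReal.ofReal (-f ω) ∂μ)]
  · rwa [integral_undef hi]

theorem integral_mul_le_sqrt_mul_sqrt {Ω : Type*} [MeasurableSpace Ω] {μ : Measure Ω}
    {f g : Ω → ℝ} (hf : MemLp f 2 μ) (hg : MemLp g 2 μ) (hf0 : ∀ ω, 0 ≤ f ω) (hg0 : ∀ ω, 0 ≤ g ω) :
    ∫ ω, f ω * g ω ∂μ ≤ √(∫ ω, f ω ^ 2 ∂μ) * √(∫ ω, g ω ^ 2 ∂μ) := by
  have h2 : ENNReal.ofReal 2 = 2 := by simp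
  have := integral_mul_le_Lp_mul_Lq_of_nonneg (μ := μ) (p := 2) (q := 2)
    Real.HolderConjugate.two_two (ae_of_all _ hf0) (ae_of_all _ hg0) (h2 ▸ hf) (h2 ▸ hg)
  rw [Real.sqrt_eq_rpow, Real.sqrt_eq_rpow]
  simpa only [Real.rpow_two] using this

theorem integrable_sup' {Ω κ : Type*} [MeasurableSpace Ω] {μ : Measure Ω} [Fintype κ] [Nonempty κ]
    {m : κ → Ω → ℝ} (hm : ∀ i, Integrable (m i) μ) :
    Integrable (fun ω => Finset.univ.sup' Finset.univ_nonempty fun i => m i ω) μ := by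
  have := Finset.sup'_induction (s := Finset.univ) Finset.univ_nonempty m
    (p := fun f => Integrable f μ) (fun _ h _ h' => h.sup h') fun i _ => hm i
  refine this.congr (ae_of_all _ fun ω => ?_)
  rw [Finset.sup'_apply]

theorem memLp_sqrt {Ω : Type*} [MeasurableSpace Ω] {μ : Measure Ω} {f : Ω → ℝ} {c : ℝ}
    (hf : Measurable f) (hc : 0 ≤ c) (h : ∫⁻ ω, ENNReal.ofReal (f ω) ∂μ ≤ ENNReal.ofReal c) :
    MemLp (fun ω => √(f ω)) 2 μ ∧ ∫ ω, √(f ω) ^ 2 ∂μ ≤ c := by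
  have e : ∀ ω, ENNReal.ofReal (√(f ω) ^ 2) = ENNReal.ofReal (f ω) := fun ω => by
    rcases le_total 0 (f ω) with h0 | h0
    · rw [Real.sq_sqrt h0]
    · rw [Real.sqrt_eq_zero_of_nonpos h0, ENNReal.ofReal_of_nonpos h0]
      simp
  have h' : ∫⁻ ω, ENNReal.ofReal (√(f ω) ^ 2) ∂μ ≤ ENNReal.ofReal c := by simpa only [e] using h
  refine ⟨(memLp_two_iff_integrable_sq hf.sqrt.aestronglyMeasurable).2 ⟨by fun_prop, ?_⟩,
    integral_le_of_lintegral_ofReal_le hc h'⟩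
  rw [hasFiniteIntegral_iff_ofReal (ae_of_all _ fun ω => sq_nonneg _)]
  exact h'.trans_lt ENNReal.ofReal_lt_top

section Run

variable {Ω 𝓖 𝒳 : Type*} [MeasurableSpace Ω] [MeasurableSpace 𝓖] [MeasurableSpace 𝒳]
  {μ : Measure Ω} {ev : 𝓖 → 𝒳 → ℝ} {k : 𝒳 → 𝒳 → ℝ} {σ : ℝ} {F : 𝒳 → Ω → ℝ} {g : Ω → 𝓖}
  {ε ζ y : ℕ → Ω → ℝ} {x : ℕ → Ω → 𝒳}

theorem aemeasurable_postVar_query (h : IsNoisyGP μ k σ F ε)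
    (r : IsAdaptiveRun μ ev (σ ^ 2).toNNReal g ε ζ y x) (hev : ∀ ω z, ev (g ω) z = F z ω) (n : ℕ) :
    AEMeasurable (fun ω => postVar k σ (runData ζ y x n ω).pts (x n ω)) μ := by
  obtain ⟨q, hq, hq_eq⟩ := r.query n
  have hm : Measurable fun a : Data 𝒳 n × ℝ => postVar k σ a.1.pts (q a) :=
    measurable_postVar (h.measurable_kernel r hev) (Data.measurable_pts.comp measurable_fst) hq
  refine (hm.comp_aemeasurable ((r.aemeasurable_runData n).prodMk
    (r.zeta_measurable n).aemeasurable)).congr (ae_of_all _ fun ω => ?_)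
  simp only [Function.comp_apply, hq_eq ω]
  rfl

theorem memLp_sqrt_postVar_query (h : IsNoisyGP μ k σ F ε)
    (r : IsAdaptiveRun μ ev (σ ^ 2).toNNReal g ε ζ y x) (hev : ∀ ω z, ev (g ω) z = F z ω)
    (hk : ∀ z, k z z = 1) (n : ℕ) :
    MemLp (fun ω => √(postVar k σ (runData ζ y x n ω).pts (x n ω))) 2 μ := by
  have := h.isProbabilityMeasure
  refine MemLp.of_bound (aemeasurable_postVar_query h r hev n).sqrt.aestronglyMeasurable 1
    (ae_of_all _ fun ω => ?_)
  rw [Real.norm_of_nonneg (Real.sqrt_nonneg _)]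
  exact Real.sqrt_le_one.2 ((h.postVar_le _ _).trans (hk _).le)

/-- The mean regret of the `n`-th step. Here `S` stands for the maximum of the process, and `c` for
a finite net on which the maximum is attained up to `δ` in mean. -/
theorem integral_regret_step_le (h : IsNoisyGP μ k σ F ε)
    (r : IsAdaptiveRun μ ev (σ ^ 2).toNNReal g ε ζ y x) (hev : ∀ ω z, ev (g ω) z = F z ω)
    (hk : ∀ z, k z z = 1) {n : ℕ} {s δ : ℝ} (hs : 0 ≤ s) (hδ : 0 ≤ δ)
    (hζ : μ.map (ζ n) = twoParamExp s (1 / 2))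
    {κ : Type*} [Fintype κ] [Nonempty κ] (c : κ → 𝒳)
    (h_card : (Fintype.card κ : ℝ) ≤ 2 * Real.exp (s / 2))
    {S : Ω → ℝ} (hS : Integrable S μ) (hF : Integrable (fun ω => F (x n ω) ω) μ)
    (h_net : ∫⁻ ω, ENNReal.ofReal (S ω -
      Finset.univ.sup' Finset.univ_nonempty (fun i => F (c i) ω)) ∂μ ≤ ENNReal.ofReal δ)
    (h_max : ∀ ω z, postMean k σ (runData ζ y x n ω).pts (runData ζ y x n ω).obs z +
        √(ζ n ω) * √(postVar k σ (runData ζ y x n ω).pts z) ≤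
      postMean k σ (runData ζ y x n ω).pts (runData ζ y x n ω).obs (x n ω) +
        √(ζ n ω) * √(postVar k σ (runData ζ y x n ω).pts (x n ω))) :
    ∫ ω, S ω - F (x n ω) ω ∂μ ≤
      δ + √(2 + s) * √(∫ ω, postVar k σ (runData ζ y x n ω).pts (x n ω) ∂μ) := by
  have := h.isProbabilityMeasure
  obtain ⟨q, hq, hq_eq⟩ := r.query n
  set m : Ω → 𝒳 → ℝ := fun ω z => postMean k σ (runData ζ y x n ω).pts (runData ζ y x n ω).obs z
    with hm_def
  set w : Ω → 𝒳 → ℝ := fun ω z => postVar k σ (runData ζ y x n ω).pts z with hw_def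
  set M : Ω → ℝ := fun ω => Finset.univ.sup' Finset.univ_nonempty (fun i => F (c i) ω) with hM_def
  set H : Ω → ℝ := fun ω => ucbMax (fun i => m ω (c i)) (fun i => w ω (c i)) 0 with hH_def
  set U : Ω → ℝ := fun ω => ucbMax (fun i => m ω (c i)) (fun i => w ω (c i)) (ζ n ω) with hU_def
  set W : Ω → ℝ := fun ω => √(ζ n ω) * √(w ω (x n ω)) with hW_def
  have hζ2 := memLp_sqrt (μ := μ) (r.zeta_measurable n) (c := 2 + s) (by positivity) (by
    have := lintegral_twoParamExp_le hs
    rwa [← hζ, lintegral_map (by fun_prop) (r.zeta_measurable n)] at this)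
  have hw2 := memLp_sqrt_postVar_query h r hev hk n
  have hW : Integrable W μ := hζ2.1.integrable_mul hw2
  have hdev := integrable_deviation h r hev hk hq
  have hrun : ∀ ω, q (runData ζ y x n ω, ζ n ω) = x n ω := fun ω => (hq_eq ω).symm
  simp only [hrun] at hdev
  have hmx : Integrable (fun ω => m ω (x n ω)) μ := by
    refine (hF.sub hdev.1).congr (ae_of_all _ fun ω => ?_)
    simp [m]
  -- the deviation from the posterior mean at the query point is centered
  have hmx_eq : ∫ ω, m ω (x n ω) ∂μ = ∫ ω, F (x n ω) ω ∂μ := by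
    have := hdev.2
    rw [integral_sub hF hmx] at this
    linarith
  have hmc : ∀ i, Integrable (fun ω => m ω (c i)) μ := fun i => by
    have := (integrable_deviation h r hev hk (n := n) (q := fun _ => c i) measurable_const).1
    refine (((h.memLp (c i)).integrable one_le_two).sub this).congr (ae_of_all _ fun ω => ?_)
    simp [m]
  have hH : Integrable H μ := by
    refine (integrable_sup' hmc).congr (ae_of_all _ fun ω => ?_)
    simp [H, ucbMax]
  have hM : Integrable M μ := integrable_sup' fun i => (h.memLp (c i)).integrable one_le_two
  -- the confidence bound at the query point dominates the one on the net
  have hUle : ∀ ω, U ω ≤ m ω (x n ω) + W ω := fun ω => by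
    refine Finset.sup'_le _ _ fun i _ => h_max ω (c i)
  have hHU : ∀ ω, H ω ≤ U ω := fun ω => by
    refine Finset.sup'_mono_fun fun i _ => ?_
    rw [Real.sqrt_zero, zero_mul]
    gcongr
    positivity
  have hpos : ∀ ω, 0 ≤ m ω (x n ω) + W ω - H ω := fun ω => by linarith [hUle ω, hHU ω]
  have h1 : ∫ ω, S ω - M ω ∂μ ≤ δ := integral_le_of_lintegral_ofReal_le hδ h_net
  have h2 : ∫ ω, M ω - H ω ∂μ ≤ ∫ ω, m ω (x n ω) + W ω - H ω ∂μ := by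
    refine integral_le_of_lintegral_ofReal_le (integral_nonneg hpos) ?_
    rw [ofReal_integral_eq_lintegral_ofReal (f := fun ω => m ω (x n ω) + W ω - H ω)
      ((hmx.add hW).sub hH) (ae_of_all _ hpos)]
    refine (lintegral_sup_le_ucbMax h r hev c hs hζ h_card).trans (lintegral_mono fun ω => ?_)
    exact ENNReal.ofReal_le_ofReal (sub_le_sub_right (hUle ω) _)
  have h3 : ∫ ω, W ω ∂μ ≤ √(2 + s) * √(∫ ω, w ω (x n ω) ∂μ) := by
    have e : ∫ ω, √(w ω (x n ω)) ^ 2 ∂μ = ∫ ω, w ω (x n ω) ∂μ :=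
      integral_congr_ae (ae_of_all _ fun ω => Real.sq_sqrt (h.postVar_nonneg _ _))
    have := integral_mul_le_sqrt_mul_sqrt hζ2.1 hw2 (fun _ => Real.sqrt_nonneg _)
      fun _ => Real.sqrt_nonneg _
    rw [e] at this
    exact this.trans (by gcongr; exact hζ2.2)
  rw [integral_sub hS hM] at h1
  rw [integral_sub hM hH, integral_sub (f := fun ω => m ω (x n ω) + W ω) (hmx.add hW) hH,
    integral_add hmx hW, hmx_eq] at h2
  rw [integral_sub hS hF]
  linarith

end Run

/-! ### Posterior variances and information gain -/

/-- Concavity of the logarithm between `1` and `1 + c`. -/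
theorem mul_log_one_add_le {v c : ℝ} (hc : 0 < c) (hv : 0 ≤ v) (hv1 : v ≤ 1) :
    v * Real.log (1 + c) ≤ Real.log (1 + v * c) := by
  have := strictConcaveOn_log_Ioi.concaveOn.2 (Set.mem_Ioi.2 (by linarith : 0 < 1 + c))
    (Set.mem_Ioi.2 one_pos) hv (sub_nonneg.2 hv1) (add_sub_cancel v 1)
  simp only [smul_eq_mul, Real.log_one, mul_zero, add_zero] at this
  refine this.trans (le_of_eq ?_)
  congr 1
  ring

theorem IsNoisyGP.sum_log_le_maxInfoGain {Ω E : Type*} [MeasurableSpace Ω] {μ : Measure Ω}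
    {X : Set E} {k : E → E → ℝ} {σ : ℝ} {f : E → Ω → ℝ} {ε : ℕ → Ω → ℝ}
    (h : IsNoisyGP μ (fun z w : X => k z w) σ (fun z : X => f z) ε) (q : ℕ → X) (n : ℕ) :
    ENNReal.ofReal (∑ i ∈ Finset.range n,
        1 / 2 * Real.log (1 + postVar k σ (fun j : Fin i => (q j : E)) (q i) / σ ^ 2)) ≤
      maxInfoGain μ X f ε n := by
  refine (h.mutualInfo_eq q n).ge.trans ?_
  exact le_iSup (fun A : Fin n → X => mutualInfo μ (fun ω (i : Fin n) => f (A i) ω + ε i ω)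
    (fun ω (i : Fin n) => f (A i) ω)) fun i => q i

theorem IsNoisyGP.maxInfoGain_ne_top {Ω E : Type*} [MeasurableSpace Ω] {μ : Measure Ω}
    {X : Set E} {k : E → E → ℝ} {σ : ℝ} {f : E → Ω → ℝ} {ε : ℕ → Ω → ℝ}
    (h : IsNoisyGP μ (fun z w : X => k z w) σ (fun z : X => f z) ε) (hk : ∀ z ∈ X, k z z = 1)
    (hX : X.Nonempty) (n : ℕ) : maxInfoGain μ X f ε n ≠ ∞ := by
  obtain ⟨z₀, hz₀⟩ := hX
  have hσ := pow_pos h.sigma_pos 2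
  suffices H : maxInfoGain μ X f ε n ≤
      ENNReal.ofReal (∑ i ∈ Finset.range n, 1 / 2 * Real.log (1 + 1 / σ ^ 2)) from
    (H.trans_lt ENNReal.ofReal_lt_top).ne
  refine iSup_le fun A => ?_
  let q : ℕ → X := fun i => if hi : i < n then A ⟨i, hi⟩ else ⟨z₀, hz₀⟩
  have hq : ∀ i : Fin n, q i = A i := fun i => by simp [q]
  have e := h.mutualInfo_eq q n
  simp only [hq] at e
  rw [e]
  refine ENNReal.ofReal_le_ofReal (Finset.sum_le_sum fun i _ => ?_)
  have h0 := h.postVar_nonneg (fun j : Fin i => q j) (q i)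
  have h1 := (h.postVar_le (fun j : Fin i => q j) (q i)).trans (hk _ (q i).2).le
  gcongr

/-- The sum of the posterior variances at successive query points is controlled by the maximum
information gain. -/
theorem IsNoisyGP.sum_postVar_le {Ω E : Type*} [MeasurableSpace Ω] {μ : Measure Ω}
    {X : Set E} {k : E → E → ℝ} {σ : ℝ} {f : E → Ω → ℝ} {ε : ℕ → Ω → ℝ}
    (h : IsNoisyGP μ (fun z w : X => k z w) σ (fun z : X => f z) ε) (hk : ∀ z ∈ X, k z z = 1)
    (q : ℕ → X) (n : ℕ) :
    ∑ i ∈ Finset.range n, postVar k σ (fun j : Fin i => (q j : E)) (q i) ≤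
      2 / Real.log (1 + (σ ^ 2)⁻¹) * (maxInfoGain μ X f ε n).toReal := by
  have hσ := pow_pos h.sigma_pos 2
  have hlog : 0 < Real.log (1 + (σ ^ 2)⁻¹) := Real.log_pos (by linarith [inv_pos.2 hσ])
  have hg := h.sum_log_le_maxInfoGain q n
  have h0 : ∀ i, 0 ≤ postVar k σ (fun j : Fin i => (q j : E)) (q i) := fun i =>
    h.postVar_nonneg (fun j : Fin i => q j) (q i)
  have h1 : ∀ i, postVar k σ (fun j : Fin i => (q j : E)) (q i) ≤ 1 := fun i =>
    (h.postVar_le (fun j : Fin i => q j) (q i)).trans (hk _ (q i).2).le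
  have hsum : 0 ≤ ∑ i ∈ Finset.range n,
      1 / 2 * Real.log (1 + postVar k σ (fun j : Fin i => (q j : E)) (q i) / σ ^ 2) :=
    Finset.sum_nonneg fun i _ => mul_nonneg (by norm_num)
      (Real.log_nonneg (by have := div_nonneg (h0 i) hσ.le; linarith))
  have hg' := (ENNReal.ofReal_le_iff_le_toReal
    (h.maxInfoGain_ne_top hk ⟨q 0, (q 0).2⟩ n)).1 hg
  rw [div_mul_eq_mul_div, le_div_iff₀ hlog, Finset.sum_mul]
  refine (Finset.sum_le_sum fun i _ => mul_log_one_add_le (inv_pos.2 hσ) (h0 i) (h1 i)).trans ?_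
  rw [← Finset.mul_sum] at hg'
  simp only [← div_eq_mul_inv]
  linarith

/-! ### Discretization of the domain -/

/-- Layer cake for a sub-Gaussian tail with prefactor `A`: the tail is bounded by `1` up to
`√(log A)` and by a Gaussian function beyond. -/
theorem lintegral_ofReal_le_of_tail {Ω : Type*} [MeasurableSpace Ω] {μ : Measure Ω}
    [IsProbabilityMeasure μ] {f : Ω → ℝ} (hf : AEMeasurable f μ) {A c : ℝ} (hA : 1 ≤ A)
    (hc : 0 < c)
    (h : ∀ l : ℝ, 0 < l → μ {ω | c * l < f ω} ≤ ENNReal.ofReal (A * Real.exp (-l ^ 2))) :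
    ∫⁻ ω, ENNReal.ofReal (f ω) ∂μ ≤ ENNReal.ofReal (c * (√(Real.log A) + √Real.pi / 2)) := by
  set u := √(Real.log A) with hu_def
  have hu : 0 ≤ u := Real.sqrt_nonneg _
  have hAu : A = Real.exp (u ^ 2) := by
    rw [hu_def, Real.sq_sqrt (Real.log_nonneg hA), Real.exp_log (by linarith)]
  let p : ℝ → ℝ≥0∞ := fun l => ENNReal.ofReal (A * Real.exp (-l ^ 2))
  have hp : Measurable p := by fun_prop
  have e1 : ∫⁻ ω, ENNReal.ofReal (f ω / c) ∂μ = ∫⁻ l in Set.Ioi 0, μ {ω | l < max (f ω / c) 0} := by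
    rw [← lintegral_eq_lintegral_meas_lt (f := fun ω => max (f ω / c) 0) μ
      (ae_of_all _ fun ω => le_max_right _ _) ((hf.div_const c).max aemeasurable_const)]
    refine lintegral_congr fun ω => ?_
    rw [ENNReal.ofReal_max, ENNReal.ofReal_zero, max_eq_left (zero_le)]
  have e2 : ∀ l ∈ Set.Ioi (0 : ℝ), μ {ω | l < max (f ω / c) 0} ≤ p l := fun l hl => by
    refine le_trans (measure_mono fun ω hω => ?_) (h l hl)
    rw [Set.mem_ofPred_eq, lt_max_iff] at hω
    rcases hω with hω | hω
    · rw [Set.mem_ofPred_eq, mul_comm]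
      exact (lt_div_iff₀ hc).1 hω
    · exact absurd hω (not_lt.2 (le_of_lt hl))
  have e3 : ∫⁻ l in Set.Ioi u, p l ≤ ENNReal.ofReal (√Real.pi / 2) := by
    have hg : Integrable (fun l : ℝ => Real.exp (-1 * l ^ 2)) (volume.restrict (Set.Ioi 0)) :=
      (integrable_exp_neg_mul_sq one_pos).integrableOn
    have hG : ∫⁻ l in Set.Ioi (0 : ℝ), ENNReal.ofReal (Real.exp (-1 * l ^ 2)) =
        ENNReal.ofReal (√Real.pi / 2) := by
      rw [← ofReal_integral_eq_lintegral_ofReal hg (ae_of_all _ fun _ => (Real.exp_pos _).le),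
        integral_gaussian_Ioi, div_one]
    rw [← hG, ← lintegral_indicator measurableSet_Ioi, ← lintegral_indicator measurableSet_Ioi,
      ← lintegral_add_right_eq_self _ u]
    refine lintegral_mono fun l => ?_
    by_cases hl : 0 < l
    · rw [Set.indicator_of_mem (by simpa using hl), Set.indicator_of_mem (by simpa using hl)]
      refine ENNReal.ofReal_le_ofReal ?_
      rw [hAu, ← Real.exp_add]
      refine Real.exp_le_exp.2 ?_
      nlinarith [mul_nonneg hl.le hu]
    · rw [Set.indicator_of_notMem (by simpa using hl)]
      exact zero_le
  have e4 : ∫⁻ ω, ENNReal.ofReal (f ω / c) ∂μ ≤ ENNReal.ofReal (u + √Real.pi / 2) := by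
    rw [e1, ENNReal.ofReal_add hu (by positivity), ← Set.Ioc_union_Ioi_eq_Ioi hu,
      lintegral_union measurableSet_Ioi (Set.Ioc_disjoint_Ioi le_rfl)]
    refine add_le_add ?_ ?_
    · refine (setLIntegral_mono (g := fun _ => 1) measurable_const fun l _ => prob_le_one).trans ?_
      simp
    · exact (setLIntegral_mono hp fun l hl => e2 l (hu.trans_lt hl)).trans e3
  calc ∫⁻ ω, ENNReal.ofReal (f ω) ∂μ = ∫⁻ ω, ENNReal.ofReal c * ENNReal.ofReal (f ω / c) ∂μ := by
        refine lintegral_congr fun ω => ?_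
        rw [← ENNReal.ofReal_mul hc.le, mul_div_cancel₀ _ hc.ne']
    _ = ENNReal.ofReal c * ∫⁻ ω, ENNReal.ofReal (f ω / c) ∂μ :=
        lintegral_const_mul' _ _ ENNReal.ofReal_ne_top
    _ ≤ ENNReal.ofReal c * ENNReal.ofReal (u + √Real.pi / 2) := by gcongr
    _ = _ := (ENNReal.ofReal_mul hc.le).symm

section Euclidean

variable {d : ℕ} {X : Set (EuclideanSpace ℝ (Fin d))}

theorem norm_le_sqrt_mul_of_abs_le {v : EuclideanSpace ℝ (Fin d)} {l : ℝ} (hl : 0 ≤ l)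
    (hv : ∀ j, |v j| ≤ l) : ‖v‖ ≤ √d * l := by
  rw [EuclideanSpace.norm_eq, ← Real.sqrt_sq hl, ← Real.sqrt_mul (Nat.cast_nonneg d)]
  refine Real.sqrt_le_sqrt ((Finset.sum_le_sum (g := fun _ => l ^ 2) fun j _ => ?_).trans ?_)
  · exact pow_le_pow_left₀ (norm_nonneg _) (hv j) 2
  · simp

theorem norm_sub_le_of_mem_box {r : ℝ} (hr : 0 < r) (hX : ∀ x ∈ X, ∀ i, x i ∈ Set.Icc 0 r)
    {x y : EuclideanSpace ℝ (Fin d)} (hx : x ∈ X) (hy : y ∈ X) : ‖x - y‖ ≤ √d * r :=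
  norm_le_sqrt_mul_of_abs_le hr.le fun j => by
    rw [PiLp.sub_apply, abs_le]
    constructor <;> linarith [(hX x hx j).1, (hX x hx j).2, (hX y hy j).1, (hX y hy j).2]

/-- Moving a point to its projection onto a convex set brings it closer to all points of the set. -/
theorem exists_mem_forall_norm_sub_le (hX : IsCompact X) (hc : Convex ℝ X) (hne : X.Nonempty)
    (p : EuclideanSpace ℝ (Fin d)) : ∃ v ∈ X, ∀ x ∈ X, ‖x - v‖ ≤ ‖x - p‖ := by
  obtain ⟨v, hv, hv_eq⟩ := exists_norm_eq_iInf_of_complete_convex hne hX.isComplete hc p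
  refine ⟨v, hv, fun x hx => ?_⟩
  have h1 := (norm_eq_iInf_iff_real_inner_le_zero hc hv).1 hv_eq x hx
  have h2 : x - p = (x - v) - (p - v) := by abel
  have h3 := norm_sub_sq_real (x - v) (p - v)
  rw [real_inner_comm] at h3
  rw [h2]
  refine le_of_sq_le_sq ?_ (norm_nonneg _)
  nlinarith [sq_nonneg ‖p - v‖]

/-- The centres of the cells of a regular subdivision of the interval. -/
theorem exists_cell {r u : ℝ} (hr : 0 < r) (hu : u ∈ Set.Icc 0 r) {N : ℕ} (hN : 0 < N) :
    ∃ m : Fin N, |u - (m + 1 / 2) * (r / N)| ≤ r / (2 * N) := by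
  have hN' : (0 : ℝ) < N := by exact_mod_cast hN
  obtain ⟨w, hw⟩ : ∃ w, w = u * N / r := ⟨_, rfl⟩
  have hw0 : 0 ≤ w := hw ▸ div_nonneg (mul_nonneg hu.1 hN'.le) hr.le
  have hwN : w ≤ N := by
    rw [hw, div_le_iff₀ hr]
    nlinarith [hu.2]
  have huw : u = w * (r / N) := by rw [hw]; field_simp
  have key : ∀ m : ℕ, |w - (m + 1 / 2)| ≤ 1 / 2 → |u - (m + 1 / 2) * (r / N)| ≤ r / (2 * N) := by
    intro m hm
    have hrN : 0 < r / N := div_pos hr hN'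
    rw [huw, ← sub_mul, abs_mul, abs_of_pos hrN]
    calc |w - (m + 1 / 2)| * (r / N) ≤ 1 / 2 * (r / N) := by gcongr
      _ = r / (2 * N) := by field_simp
  rcases hwN.lt_or_eq with h | h
  · refine ⟨⟨⌊w⌋₊, (Nat.floor_lt hw0).2 h⟩, key ⌊w⌋₊ ?_⟩
    rw [abs_le]
    constructor <;> linarith [Nat.floor_le hw0, Nat.lt_floor_add_one w]
  · refine ⟨⟨N - 1, by omega⟩, key (N - 1) ?_⟩
    rw [h, Nat.cast_sub hN, abs_le]
    constructor <;> push_cast <;> linarith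

theorem exists_net {r : ℝ} (hr : 0 < r) (hX_box : ∀ x ∈ X, ∀ i, x i ∈ Set.Icc 0 r)
    (hX : IsCompact X) (hc : Convex ℝ X) (hne : X.Nonempty) {N : ℕ} (hN : 0 < N) :
    ∃ c : (Fin d → Fin N) → X, ∀ x ∈ X, ∃ i, ‖x - c i‖ ≤ √d * (r / (2 * N)) := by
  choose v hv hv' using fun i : Fin d → Fin N => exists_mem_forall_norm_sub_le hX hc hne
    (WithLp.toLp 2 fun j => ((i j : ℕ) + 1 / 2 : ℝ) * (r / N))
  refine ⟨fun i => ⟨v i, hv i⟩, fun x hx => ?_⟩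
  choose i hi using fun j => exists_cell hr (hX_box x hx j) hN
  exact ⟨i, (hv' i x hx).trans (norm_le_sqrt_mul_of_abs_le (by positivity) fun j =>
    by simpa using hi j)⟩

/-- A random variable bounded by `ρ` times the Lipschitz constant of the path has mean at most
`ρ` times the mean of the tail bound for the gradient. -/
theorem HasSubGaussianDerivatives.lintegral_le {Ω : Type*} [MeasurableSpace Ω] {μ : Measure Ω}
    [IsProbabilityMeasure μ] {f : EuclideanSpace ℝ (Fin d) → Ω → ℝ} {a b : ℝ}
    (h : HasSubGaussianDerivatives μ X f a b) (hX : Convex ℝ X) (hb : 0 < b)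
    (had : 1 ≤ a * d) {D : Ω → ℝ} (hD : AEMeasurable D μ) {ρ : ℝ} (hρ : 0 < ρ)
    (H : ∀ᵐ ω ∂μ, ∀ M : ℝ, 0 ≤ M → (∀ x ∈ X, ∀ y ∈ X, |f x ω - f y ω| ≤ M * ‖x - y‖) →
      D ω ≤ ρ * M) :
    ∫⁻ ω, ENNReal.ofReal (D ω) ∂μ ≤
      ENNReal.ofReal (√d * ρ * b * (√(Real.log (a * d)) + √Real.pi / 2)) := by
  have hd : 0 < d := Nat.pos_of_ne_zero fun h0 => by
    rw [h0, Nat.cast_zero, mul_zero] at had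
    linarith
  have hd' : (0 : ℝ) < d := by exact_mod_cast hd
  obtain ⟨g, hg, hg_tail⟩ := h
  refine lintegral_ofReal_le_of_tail hD had (by positivity) fun l hl => ?_
  have hbl : 0 < b * l := mul_pos hb hl
  have h1 : ∀ᵐ ω ∂μ, √d * ρ * b * l < D ω → ∃ j, ω ∈ {ω | ∃ x ∈ X, b * l < |g x ω j|} := by
    filter_upwards [hg, H] with ω hgω hω hlt
    by_contra hcon
    simp only [not_exists, not_and, not_lt] at hcon
    refine hlt.not_ge ?_
    have := hω (√d * (b * l)) (by positivity) fun x hx y hy =>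
      hX.norm_image_sub_le_of_norm_hasFDerivWithin_le (𝕜 := ℝ) (f := fun z => f z ω)
        (f' := fun z => InnerProductSpace.toDual ℝ _ (g z ω)) (fun z hz => hgω z hz)
        (fun z hz => by
          rw [LinearIsometryEquiv.norm_map]
          exact norm_le_sqrt_mul_of_abs_le hbl.le fun j => hcon j z hz) hy hx
    linarith
  calc μ {ω | √d * ρ * b * l < D ω} ≤ μ (⋃ j, {ω | ∃ x ∈ X, b * l < |g x ω j|}) := by
        refine measure_mono_ae ?_
        filter_upwards [h1] with ω hω hlt
        exact Set.mem_iUnion.2 (hω hlt)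
    _ ≤ ∑ j, μ {ω | ∃ x ∈ X, b * l < |g x ω j|} := measure_iUnion_fintype_le _ _
    _ ≤ ∑ _j : Fin d, ENNReal.ofReal (a * Real.exp (-l ^ 2)) := by
        refine Finset.sum_le_sum fun j _ => (hg_tail j _ hbl).trans (le_of_eq ?_)
        rw [mul_div_cancel_left₀ _ hb.ne']
    _ = ENNReal.ofReal (a * d * Real.exp (-l ^ 2)) := by
        rw [Finset.sum_const, Finset.card_univ, Fintype.card_fin, nsmul_eq_mul,
          ← ENNReal.ofReal_natCast, ← ENNReal.ofReal_mul hd'.le]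
        congr 1
        ring

/-- The number of cells per coordinate: the resulting net has at most `2 exp (s_t / 2)` points and
the mean discretization error is at most `1 / t²`. -/
theorem exists_resolution {a b r : ℝ} (hr : 0 < r) (hb : 0 < b) (had : 1 ≤ a * d)
    {t : ℕ} (ht : 1 ≤ t) (hs : 0 ≤ shift d a b r t) :
    ∃ N : ℕ, 0 < N ∧ ((N ^ d : ℕ) : ℝ) ≤ 2 * Real.exp (shift d a b r t / 2) ∧
      √d * (√d * (r / (2 * N))) * b * (√(Real.log (a * d)) + √Real.pi / 2) ≤ 1 / (t : ℝ) ^ 2 := by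
  have hd : 0 < d := Nat.pos_of_ne_zero fun h0 => by
    rw [h0, Nat.cast_zero, mul_zero] at had
    linarith
  have hd' : (0 : ℝ) < d := by exact_mod_cast hd
  have ht' : (0 : ℝ) < t := by exact_mod_cast ht
  have hpi := Real.pi_pos
  obtain ⟨C, hC⟩ : ∃ C, C = √(Real.log (a * d)) + √Real.pi / 2 := ⟨_, rfl⟩
  have hCpos : 0 < C := by rw [hC]; positivity
  obtain ⟨τ, hτ⟩ : ∃ τ, τ = b * d * r * (t : ℝ) ^ 2 * C := ⟨_, rfl⟩
  have hτpos : 0 < τ := by rw [hτ]; positivity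
  have hs_eq : shift d a b r t = 2 * d * Real.log τ - 2 * Real.log 2 := by
    rw [shift, hτ, hC]
  have hτ1 : 1 < τ := by
    rw [← Real.log_pos_iff hτpos.le]
    have h2 := Real.log_pos one_lt_two
    by_contra hcon
    have : 2 * d * Real.log τ ≤ 0 :=
      mul_nonpos_of_nonneg_of_nonpos (by positivity) (not_lt.1 hcon)
    linarith
  have hN1 : 1 ≤ ⌊τ⌋₊ := Nat.floor_pos.2 hτ1.le
  have hN1' : (1 : ℝ) ≤ ⌊τ⌋₊ := by exact_mod_cast hN1
  refine ⟨⌊τ⌋₊, hN1, ?_, ?_⟩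
  · have : 2 * Real.exp (shift d a b r t / 2) = τ ^ d := by
      rw [hs_eq, show (2 * d * Real.log τ - 2 * Real.log 2) / 2 =
        d * Real.log τ - Real.log 2 by ring, Real.exp_sub, Real.exp_log two_pos, Real.exp_nat_mul,
        Real.exp_log hτpos]
      ring
    rw [this, Nat.cast_pow]
    exact pow_le_pow_left₀ (Nat.cast_nonneg _) (Nat.floor_le hτpos.le) d
  -- with cell centres, rounding `τ` down costs a factor `2`, which the half-width compensates
  · have hτN : τ ≤ 2 * ⌊τ⌋₊ := by linarith [Nat.lt_floor_add_one τ]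
    rw [← hC, le_div_iff₀ (by positivity)]
    calc √d * (√d * (r / (2 * ⌊τ⌋₊))) * b * C * (t : ℝ) ^ 2
        = (√d * √d) * b * r * (t : ℝ) ^ 2 * C / (2 * ⌊τ⌋₊) := by ring
      _ = τ / (2 * ⌊τ⌋₊) := by
          rw [Real.mul_self_sqrt hd'.le, hτ]
          ring
      _ ≤ 1 := (div_le_one (by positivity)).2 hτN

theorem shift_mono {a b r : ℝ} (hr : 0 < r) (hb : 0 < b) (had : 1 ≤ a * d) {m n : ℕ}
    (hm : 1 ≤ m) (hmn : m ≤ n) : shift d a b r m ≤ shift d a b r n := by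
  have hd : 0 < d := Nat.pos_of_ne_zero fun h0 => by
    rw [h0, Nat.cast_zero, mul_zero] at had
    linarith
  have hm' : (0 : ℝ) < m := by exact_mod_cast hm
  have hpi := Real.pi_pos
  unfold shift
  gcongr

end Euclidean

/-! ### Continuous paths -/

theorem IsNoisyGP.congr {Ω E : Type*} [MeasurableSpace Ω] {μ : Measure Ω} {k : E → E → ℝ} {σ : ℝ}
    {f F : E → Ω → ℝ} {ε : ℕ → Ω → ℝ} (h : IsNoisyGP μ k σ f ε) (hF : ∀ z, Measurable (F z))
    (hfF : ∀ z, f z =ᵐ[μ] F z) : IsNoisyGP μ k σ F ε where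
  sigma_pos := h.sigma_pos
  measurable := hF
  gaussian := h.gaussian.congr hfF
  mean_eq z := by rw [← h.mean_eq z, integral_congr_ae (hfF z)]
  cov_eq z w := by
    rw [← h.cov_eq z w, covariance, covariance, integral_congr_ae (hfF z),
      integral_congr_ae (hfF w)]
    refine integral_congr_ae ?_
    filter_upwards [hfF z, hfF w] with ω h1 h2
    rw [h1, h2]
  noise_measurable := h.noise_measurable
  noise_law := h.noise_law
  noise_indep := h.noise_indep
  indep := h.indep.process_congr_left hfF

theorem exists_continuous_modification {Ω E : Type*} [MeasurableSpace Ω] [TopologicalSpace E]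
    {μ : Measure Ω} {X : Set E} {f : E → Ω → ℝ} (hf : ∀ z ∈ X, Measurable (f z))
    (hc : ∀ᵐ ω ∂μ, ContinuousOn (fun z => f z ω) X) :
    ∃ F : X → Ω → ℝ, (∀ z, Measurable (F z)) ∧ (∀ ω, Continuous fun z => F z ω) ∧
      ∀ᵐ ω ∂μ, ∀ z : X, F z ω = f z ω := by
  classical
  obtain ⟨B, hB, hBm, hB0⟩ := exists_measurable_superset_of_null (ae_iff.1 hc)
  refine ⟨fun z ω => if ω ∈ B then 0 else f z ω,
    fun z => Measurable.ite hBm measurable_const (hf z z.2), fun ω => ?_, ?_⟩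
  · by_cases hω : ω ∈ B
    · simpa only [if_pos hω] using continuous_const
    · simp only [if_neg hω]
      have : ContinuousOn (fun z => f z ω) X := by
        by_contra hcon
        exact hω (hB hcon)
      exact continuousOn_iff_continuous_domRestrict.1 this
  · filter_upwards [measure_eq_zero_iff_ae_notMem.1 hB0] with ω hω z
    rw [if_neg hω]

/-- The continuous real functions on a space, with the σ-algebra generated by the evaluations. -/
abbrev Path (𝒳 : Type*) [TopologicalSpace 𝒳] : Type _ := {p : 𝒳 → ℝ // Continuous p}

theorem Path.measurable_eval {𝒳 : Type*} [TopologicalSpace 𝒳] [TopologicalSpace.MetrizableSpace 𝒳]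
    [MeasurableSpace 𝒳] [SecondCountableTopology 𝒳] [OpensMeasurableSpace 𝒳] :
    Measurable fun q : Path 𝒳 × 𝒳 => q.1.1 q.2 := by
  have := measurable_uncurry_of_continuous_of_measurable (u := fun (z : 𝒳) (p : Path 𝒳) => p.1 z)
    (fun p => p.2) fun z => (measurable_pi_apply z).comp measurable_subtype_coe
  exact this.comp measurable_swap

theorem indepFun_subtype_mk {Ω α β : Type*} [MeasurableSpace Ω] [MeasurableSpace α]
    [MeasurableSpace β] {μ : Measure Ω} {p : α → Prop} {A : Ω → α} (hA : ∀ ω, p (A ω)) {B : Ω → β}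
    (h : IndepFun A B μ) : IndepFun (fun ω => (⟨A ω, hA ω⟩ : Subtype p)) B μ := by
  rw [IndepFun_iff_Indep] at h ⊢
  rwa [Subtype.instMeasurableSpace, MeasurableSpace.comap_comp]

theorem indepFun_subtype_mk_prodMk {Ω α β γ : Type*} [MeasurableSpace Ω] [MeasurableSpace α]
    [MeasurableSpace β] [MeasurableSpace γ] {μ : Measure Ω} {p : α → Prop} {A : Ω → α}
    (hA : ∀ ω, p (A ω)) {B : Ω → β} {C : Ω → γ} (h : IndepFun (fun ω => (A ω, B ω)) C μ) :
    IndepFun (fun ω => ((⟨A ω, hA ω⟩ : Subtype p), B ω)) C μ := by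
  rw [IndepFun_iff_Indep] at h ⊢
  rw [Prod.instMeasurableSpace, MeasurableSpace.comap_prodMk] at h ⊢
  rwa [Subtype.instMeasurableSpace, MeasurableSpace.comap_comp]

theorem indepFun_process_prodMk_congr {Ω S γ : Type*} [MeasurableSpace Ω] [MeasurableSpace γ]
    {μ : Measure Ω} {f F : S → Ω → ℝ} {ε : ℕ → Ω → ℝ} {C : Ω → γ}
    (h : IndepFun (fun ω => ((fun z => f z ω), (fun n => ε n ω))) C μ) (hfF : ∀ z, f z =ᵐ[μ] F z) :
    IndepFun (fun ω => ((fun z => F z ω), (fun n => ε n ω))) C μ := by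
  -- regard the pair as a single process indexed by a disjoint union
  have h1 : IndepFun (fun ω (i : S ⊕ ℕ) => Sum.elim (fun z => f z ω) (fun n => ε n ω) i) C μ :=
    h.comp (φ := fun (q : (S → ℝ) × (ℕ → ℝ)) (i : S ⊕ ℕ) => Sum.elim q.1 q.2 i) (ψ := id)
      (measurable_pi_lambda _ fun i => by
        rcases i with z | n
        · exact (measurable_pi_apply z).comp measurable_fst
        · exact (measurable_pi_apply n).comp measurable_snd) measurable_id
  have h2 := IndepFun.process_congr_left
    (X := fun (i : S ⊕ ℕ) ω => Sum.elim (fun z => f z ω) (fun n => ε n ω) i)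
    (X' := fun (i : S ⊕ ℕ) ω => Sum.elim (fun z => F z ω) (fun n => ε n ω) i) h1 fun i => by
      rcases i with z | n
      · exact hfF z
      · exact EventuallyEq.rfl
  exact h2.comp (φ := fun u : S ⊕ ℕ → ℝ => ((fun z => u (Sum.inl z)), fun n => u (Sum.inr n)))
    (ψ := id) (Measurable.prodMk (measurable_pi_lambda _ fun z => measurable_pi_apply _)
      (measurable_pi_lambda _ fun n => measurable_pi_apply _)) measurable_id

/-- The maximum of a continuous process over a separable space is a random variable, being a
supremum over a countable dense set. -/
theorem aemeasurable_of_isMaxOn {Ω 𝒳 : Type*} [MeasurableSpace Ω] [TopologicalSpace 𝒳]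
    [TopologicalSpace.SeparableSpace 𝒳] [Nonempty 𝒳] {μ : Measure Ω} {F : 𝒳 → Ω → ℝ}
    (hF : ∀ z, Measurable (F z)) (hc : ∀ ω, Continuous fun z => F z ω) {S : Ω → ℝ}
    (hS : ∀ᵐ ω ∂μ, ∃ z₀, S ω = F z₀ ω ∧ ∀ z, F z ω ≤ F z₀ ω) : AEMeasurable S μ := by
  refine ⟨fun ω => ⨆ i, F (TopologicalSpace.denseSeq 𝒳 i) ω, Measurable.iSup fun i => hF _, ?_⟩
  filter_upwards [hS] with ω ⟨z₀, hz₀, hmax⟩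
  have hbdd : BddAbove (Set.range fun i => F (TopologicalSpace.denseSeq 𝒳 i) ω) :=
    ⟨F z₀ ω, by rintro _ ⟨i, rfl⟩; exact hmax _⟩
  rw [hz₀]
  refine le_antisymm ?_ (ciSup_le fun i => hmax _)
  exact (TopologicalSpace.denseRange_denseSeq 𝒳).induction_on
    (p := fun z => F z ω ≤ ⨆ i, F (TopologicalSpace.denseSeq 𝒳 i) ω) z₀
    (isClosed_le (hc ω) continuous_const) fun i => le_ciSup hbdd i

section Run

variable {Ω : Type*} [MeasurableSpace Ω] {μ : Measure Ω} {d : ℕ}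
  {X : Set (EuclideanSpace ℝ (Fin d))}
  {k : EuclideanSpace ℝ (Fin d) → EuclideanSpace ℝ (Fin d) → ℝ} {σ : ℝ} {s : ℕ → ℝ}
  {f : EuclideanSpace ℝ (Fin d) → Ω → ℝ} {ε ζ : ℕ → Ω → ℝ}
  {x : ℕ → Ω → EuclideanSpace ℝ (Fin d)}

theorem IsIRGPUCBRun.isNoisyGP (hrun : IsIRGPUCBRun μ X k σ s f ε ζ x)
    (hf : IsCenteredGP μ X k f) (hσ : 0 < σ) :
    IsNoisyGP μ (fun z w : X => k z w) σ (fun z : X => f z) ε where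
  sigma_pos := hσ
  measurable z := hf.measurable z z.2
  gaussian := hf.gaussian
  mean_eq z := hf.mean_eq z z.2
  cov_eq z w := hf.cov_eq z z.2 w w.2
  noise_measurable := hrun.noise_measurable
  noise_law := hrun.noise_law
  noise_indep := hrun.noise_indep
  indep := hrun.noise_indep_f

/-- In terms of the modification `F` with continuous paths, a run of the algorithm is an adaptive run
on the space of paths. The parameters drawn before step `n` are kept in the data, so that the query
rule, which may depend on all of them, takes the form required there. -/
theorem IsIRGPUCBRun.isAdaptiveRun (hrun : IsIRGPUCBRun μ X k σ s f ε ζ x)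
    (hX : MeasurableSet X) (hne : X.Nonempty) {F : X → Ω → ℝ} (hF : ∀ z, Measurable (F z))
    (hFc : ∀ ω, Continuous fun z => F z ω) (hFf : ∀ᵐ ω ∂μ, ∀ z : X, F z ω = f z ω) :
    IsAdaptiveRun μ (fun (p : Path X) z => p.1 z) (σ ^ 2).toNNReal
      (fun ω => ⟨fun z => F z ω, hFc ω⟩) ε ζ (obs f ε x) fun n ω => ⟨x n ω, hrun.query_mem n ω⟩ where
  measurable_ev := Path.measurable_eval
  measurable := (measurable_pi_lambda _ hF).subtype_mk
  noise_measurable := hrun.noise_measurable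
  zeta_measurable := hrun.zeta_measurable
  noise_law := hrun.noise_law
  noise_indep := hrun.noise_indep
  zeta_indep := hrun.zeta_indep
  indep_noise := indepFun_subtype_mk hFc (hrun.noise_indep_f.process_congr_left fun z =>
    hFf.mono fun ω h => (h z).symm)
  indep_zeta := indepFun_subtype_mk_prodMk hFc (indepFun_process_prodMk_congr
    hrun.zeta_indep_f_noise fun z => hFf.mono fun ω h => (h z).symm)
  query n := by
    have : Nonempty X := hne.to_subtype
    obtain ⟨φ, hφ, hφ_eq⟩ := hrun.query_rule n
    obtain ⟨ρ, hρ, hρ_eq⟩ := (MeasurableEmbedding.subtype_coe hX).exists_measurable_extend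
      (measurable_id (α := X)) fun _ => this
    refine ⟨fun q => ρ (φ (fun i => ((q.1 i).1, (q.1 i).2.2),
      Fin.snoc (α := fun _ => ℝ) (fun i => (q.1 i).2.1) q.2)), ?_, fun ω => ?_⟩
    · refine hρ.comp (hφ.comp (Measurable.prodMk (by fun_prop) ?_))
      refine measurable_pi_lambda _ fun i => ?_
      refine Fin.lastCases ?_ (fun j => ?_) i
      · simpa using measurable_snd
      · simp only [Fin.snoc_castSucc]
        fun_prop
    · have e : (Fin.snoc (α := fun _ => ℝ) (fun i : Fin n => ζ i ω) (ζ n ω) : Fin (n + 1) → ℝ) =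
          fun i : Fin (n + 1) => ζ i ω := by
        funext i
        refine Fin.lastCases ?_ (fun j => ?_) i <;> simp
      have h1 := congrFun hρ_eq ⟨x n ω, hrun.query_mem n ω⟩
      simp only [Function.comp_apply, id] at h1
      simp only [e]
      rw [← hφ_eq ω, h1]
  obs_eq n := by
    filter_upwards [hFf] with ω hω
    rw [obs, hω]

end Run

/-! ### The cumulative regret -/

theorem sum_inv_sq_le (T : ℕ) :
    ∑ n ∈ Finset.range T, 1 / ((n + 1 : ℕ) : ℝ) ^ 2 ≤ Real.pi ^ 2 / 6 := by
  have h := sum_le_hasSum (Finset.range (T + 1)) (fun i _ => by positivity) hasSum_zeta_two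
  rw [Finset.sum_range_succ'] at h
  simpa using h

/-- The values of the process at random points of the domain are integrable, since they differ from
the value at a fixed point by at most the diameter times the Lipschitz constant of the path. -/
theorem HasSubGaussianDerivatives.integrable_apply {Ω : Type*} [MeasurableSpace Ω] {μ : Measure Ω}
    [IsProbabilityMeasure μ] {d : ℕ} {X : Set (EuclideanSpace ℝ (Fin d))} {a b r : ℝ}
    {f : EuclideanSpace ℝ (Fin d) → Ω → ℝ} (h : HasSubGaussianDerivatives μ X f a b)
    (hX : Convex ℝ X) (hX_box : ∀ x ∈ X, ∀ i, x i ∈ Set.Icc 0 r) (hr : 0 < r) (hb : 0 < b)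
    (had : 1 ≤ a * d) {x₀ : EuclideanSpace ℝ (Fin d)} (hx₀ : x₀ ∈ X) (hf : Integrable (f x₀) μ)
    {p : Ω → EuclideanSpace ℝ (Fin d)} (hp : ∀ᵐ ω ∂μ, p ω ∈ X)
    (hfp : AEMeasurable (fun ω => f (p ω) ω) μ) : Integrable (fun ω => f (p ω) ω) μ := by
  have hd : 0 < d := Nat.pos_of_ne_zero fun h0 => by
    rw [h0, Nat.cast_zero, mul_zero] at had
    linarith
  have hD : AEMeasurable (fun ω => |f (p ω) ω - f x₀ ω|) μ := (hfp.sub hf.aemeasurable).abs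
  have hi := h.lintegral_le hX hb had hD (ρ := √d * r) (by positivity) (by
    filter_upwards [hp] with ω hω M hM hL
    refine (hL _ hω _ hx₀).trans ?_
    rw [mul_comm]
    exact mul_le_mul_of_nonneg_right (norm_sub_le_of_mem_box hr hX_box hω hx₀) hM)
  have hdiff : Integrable (fun ω => f (p ω) ω - f x₀ ω) μ := by
    refine ⟨(hfp.sub hf.aemeasurable).aestronglyMeasurable, ?_⟩
    rw [hasFiniteIntegral_iff_norm]
    exact hi.trans_lt ENNReal.ofReal_lt_top
  exact (hdiff.add hf).congr (ae_of_all _ fun ω => sub_add_cancel _ _)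

end BayesOpt

theorem theorem4 {Ω : Type*} [MeasurableSpace Ω] (μ : Measure Ω) [IsProbabilityMeasure μ]
    (d : ℕ) (X : Set (EuclideanSpace ℝ (Fin d))) (r a b σ : ℝ)
    (hr : 0 < r) (ha : 0 < a) (hb : 0 < b) (hσ : 0 < σ)
    (hX_box : ∀ x ∈ X, ∀ i, x i ∈ Set.Icc 0 r)
    (hX_compact : IsCompact X) (hX_convex : Convex ℝ X)
    -- the square root in `s_t` is that of a nonnegative number
    (had : 1 ≤ a * d)
    -- `s_t ≥ 0` for all `t ≥ 1`, so that every `ζ_t` is nonnegative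
    (hs : ∀ t : ℕ, 1 ≤ t → 0 ≤ BayesOpt.shift d a b r t)
    (k : EuclideanSpace ℝ (Fin d) → EuclideanSpace ℝ (Fin d) → ℝ)
    (hk_stat : BayesOpt.IsStationaryOn X k) (hk_one : ∀ x ∈ X, k x x = 1)
    (f : EuclideanSpace ℝ (Fin d) → Ω → ℝ)
    (hf : BayesOpt.IsCenteredGP μ X k f)
    (hf_deriv : BayesOpt.HasSubGaussianDerivatives μ X f a b)
    (ε ζ : ℕ → Ω → ℝ) (x : ℕ → Ω → EuclideanSpace ℝ (Fin d))
    (hrun : BayesOpt.IsIRGPUCBRun μ X k σ (BayesOpt.shift d a b r) f ε ζ x)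
    (xstar : Ω → EuclideanSpace ℝ (Fin d))
    (hxstar : ∀ᵐ ω ∂μ, xstar ω ∈ X ∧ IsMaxOn (fun z => f z ω) X (xstar ω))
    (T : ℕ) (hT : 1 ≤ T) :
    BayesOpt.maxInfoGain μ X f ε T ≠ ∞ ∧
    Integrable (fun ω => ∑ t ∈ Finset.range T, (f (xstar ω) ω - f (x t ω) ω)) μ ∧
    ∫ ω, ∑ t ∈ Finset.range T, (f (xstar ω) ω - f (x t ω) ω) ∂μ ≤
      Real.pi ^ 2 / 6 +
        Real.sqrt (2 / Real.log (1 + (σ ^ 2)⁻¹) * T * (BayesOpt.maxInfoGain μ X f ε T).toReal *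
          (2 + BayesOpt.shift d a b r T)) := by
  open BayesOpt Filter in
  obtain ⟨ω₀⟩ := nonempty_of_isProbabilityMeasure μ
  have hx₀ := hrun.query_mem 0 ω₀
  set x₀ := x 0 ω₀
  have hne : X.Nonempty := ⟨x₀, hx₀⟩
  have : Nonempty X := hne.to_subtype
  have hGP := hrun.isNoisyGP hf hσ
  have hcont : ∀ᵐ ω ∂μ, ContinuousOn (fun z => f z ω) X := by
    obtain ⟨g, hg, -⟩ := hf_deriv
    filter_upwards [hg] with ω hω z hz
    exact (hω z hz).continuousWithinAt
  obtain ⟨F, hF, hFc, hFf⟩ := exists_continuous_modification hf.measurable hcont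
  have hFf' : ∀ z : X, f z =ᵐ[μ] F z := fun z => hFf.mono fun ω h => (h z).symm
  have hGP' := hGP.congr hF hFf'
  have hAR := hrun.isAdaptiveRun hX_compact.measurableSet hne hF hFc hFf
  have hk_one' : ∀ z : X, k z z = 1 := fun z => hk_one z z.2
  -- integrability of the values at the maximizer and at the query points
  have hf₀ : Integrable (f x₀) μ := (hGP.memLp ⟨x₀, hx₀⟩).integrable one_le_two
  have hSm : AEMeasurable (fun ω => f (xstar ω) ω) μ := by
    refine aemeasurable_of_isMaxOn hF hFc ?_
    filter_upwards [hxstar, hFf] with ω ⟨hmem, hmax⟩ hω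
    refine ⟨⟨xstar ω, hmem⟩, (hω ⟨xstar ω, hmem⟩).symm, fun z => ?_⟩
    rw [hω, hω]
    exact hmax z.2
  have hS : Integrable (fun ω => f (xstar ω) ω) μ :=
    hf_deriv.integrable_apply hX_convex hX_box hr hb had hx₀ hf₀ (hxstar.mono fun _ h => h.1) hSm
  have hFx : ∀ n, (fun ω => F ⟨x n ω, hrun.query_mem n ω⟩ ω) =ᵐ[μ] fun ω => f (x n ω) ω :=
    fun n => hFf.mono fun ω h => h _
  have hQ : ∀ n, Integrable (fun ω => f (x n ω) ω) μ := fun n => by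
    refine hf_deriv.integrable_apply hX_convex hX_box hr hb had hx₀ hf₀
      (ae_of_all _ fun ω => hrun.query_mem n ω) ?_
    have hx : AEMeasurable (fun ω => (⟨x n ω, hrun.query_mem n ω⟩ : X)) μ :=
      ((measurable_fst.comp (measurable_pi_apply (Fin.last n))).comp_aemeasurable
        (hAR.aemeasurable_runData (n + 1)) :)
    exact (hAR.measurable_ev.comp_aemeasurable (hAR.measurable.aemeasurable.prodMk hx)).congr
      (hFx n)
  have hreg : ∀ n, Integrable (fun ω => f (xstar ω) ω - f (x n ω) ω) μ := fun n => hS.sub (hQ n)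
  refine ⟨hGP.maxInfoGain_ne_top hk_one hne T, integrable_finsetSum _ fun n _ => hreg n, ?_⟩
  let v : ℕ → Ω → ℝ := fun n ω => postVar k σ (fun i : Fin n => x i ω) (x n ω)
  have hv0 : ∀ n ω, 0 ≤ v n ω := fun n ω =>
    hGP.postVar_nonneg (fun i : Fin n => ⟨x i ω, hrun.query_mem i ω⟩) ⟨x n ω, hrun.query_mem n ω⟩
  have hvi : ∀ n, Integrable (v n) μ := fun n => by
    have := (memLp_sqrt_postVar_query hGP' hAR (fun _ _ => rfl) hk_one' n).integrable_sq
    exact this.congr (ae_of_all _ fun ω => Real.sq_sqrt (hv0 n ω))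
  have hstep : ∀ n, ∫ ω, f (xstar ω) ω - f (x n ω) ω ∂μ ≤
      1 / ((n + 1 : ℕ) : ℝ) ^ 2 + √(2 + shift d a b r (n + 1)) * √(∫ ω, v n ω ∂μ) := fun n => by
    have hs' := hs (n + 1) (by omega)
    obtain ⟨N, hN, hcard, hres⟩ := exists_resolution hr hb had (by omega : 1 ≤ n + 1) hs'
    have : Nonempty (Fin d → Fin N) := ⟨fun _ => ⟨0, hN⟩⟩
    obtain ⟨c, hc⟩ := exists_net hr hX_box hX_compact hX_convex hne hN
    have hMm : Measurable fun ω => Finset.univ.sup' Finset.univ_nonempty fun i => F (c i) ω := by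
      have := Finset.measurable_sup' (Finset.univ_nonempty (α := Fin d → Fin N))
        (f := fun i ω => F (c i) ω) fun i _ => hF _
      convert this using 1
      funext ω
      rw [Finset.sup'_apply]
    have hd : 0 < d := Nat.pos_of_ne_zero fun h0 => by
      rw [h0, Nat.cast_zero, mul_zero] at had
      linarith
    have hnet := hf_deriv.lintegral_le hX_convex hb had (hSm.sub hMm.aemeasurable)
      (ρ := √d * (r / (2 * N))) (by positivity) (by
        filter_upwards [hxstar, hFf] with ω ⟨hmem, _⟩ hω M hM hL
        obtain ⟨i, hi⟩ := hc _ hmem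
        have h1 : F (c i) ω ≤ Finset.univ.sup' Finset.univ_nonempty fun i => F (c i) ω :=
          Finset.le_sup' (fun i => F (c i) ω) (Finset.mem_univ i)
        have h2 := (le_abs_self _).trans (hL _ hmem _ (c i).2)
        have h3 := mul_le_mul_of_nonneg_left hi hM
        rw [hω] at h1
        change f (xstar ω) ω - _ ≤ _
        linarith)
    have key := integral_regret_step_le hGP' hAR (fun _ _ => rfl) hk_one' hs'
      (δ := 1 / ((n + 1 : ℕ) : ℝ) ^ 2) (by positivity) (hrun.zeta_law n) c
      (by simpa using hcard) hS ((hQ n).congr (hFx n).symm)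
      (hnet.trans (ENNReal.ofReal_le_ofReal hres)) fun ω z => hrun.query_max n ω z.2
    refine le_trans (le_of_eq (integral_congr_ae ?_)) key
    filter_upwards [hFx n] with ω hω
    rw [hω]
  have hvsum : ∑ n ∈ Finset.range T, ∫ ω, v n ω ∂μ ≤
      2 / Real.log (1 + (σ ^ 2)⁻¹) * (maxInfoGain μ X f ε T).toReal := by
    rw [← integral_finsetSum _ fun n _ => hvi n]
    refine (integral_mono (integrable_finsetSum _ fun n _ => hvi n) (integrable_const _)
      fun ω => hGP.sum_postVar_le hk_one (fun n => ⟨x n ω, hrun.query_mem n ω⟩) T).trans ?_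
    simp
  have hs2 : ∀ n : ℕ, 0 ≤ 2 + shift d a b r (n + 1) := fun n => by
    linarith [hs (n + 1) (by omega)]
  have hssum : ∑ n ∈ Finset.range T, (2 + shift d a b r (n + 1)) ≤ T * (2 + shift d a b r T) := by
    refine (Finset.sum_le_card_nsmul _ _ (2 + shift d a b r T) fun n hn => ?_).trans
      (by rw [Finset.card_range, nsmul_eq_mul])
    have := shift_mono hr hb had (by omega : 1 ≤ n + 1) (Finset.mem_range.1 hn)
    linarith
  rw [integral_finsetSum _ fun n _ => hreg n]
  calc ∑ n ∈ Finset.range T, ∫ ω, f (xstar ω) ω - f (x n ω) ω ∂μ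
      ≤ ∑ n ∈ Finset.range T, (1 / ((n + 1 : ℕ) : ℝ) ^ 2 +
          √(2 + shift d a b r (n + 1)) * √(∫ ω, v n ω ∂μ)) := Finset.sum_le_sum fun n _ => hstep n
    _ ≤ Real.pi ^ 2 / 6 + √(∑ n ∈ Finset.range T, (2 + shift d a b r (n + 1))) *
          √(∑ n ∈ Finset.range T, ∫ ω, v n ω ∂μ) := by
        rw [Finset.sum_add_distrib]
        exact add_le_add (sum_inv_sq_le T) (Real.sum_sqrt_mul_sqrt_le _ hs2
          fun n => integral_nonneg (hv0 n))
    _ ≤ Real.pi ^ 2 / 6 + √(T * (2 + shift d a b r T)) *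
          √(2 / Real.log (1 + (σ ^ 2)⁻¹) * (maxInfoGain μ X f ε T).toReal) := by
        gcongr
    _ = _ := by
        rw [← Real.sqrt_mul (mul_nonneg (Nat.cast_nonneg T) (by linarith [hs T hT]))]
        congr 2
        ring
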